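/- Let $\Bbbk$ be an algebraically closed field, let $A$ be a connected, basic, finite dimensional (associative, unital) $\Bbbk$-algebra and let $\mathcal{C}$ be a small $\Bbbk$-linear category which is $\Bbbk$-linearly equivalent to the category $A\text{-mod}$ of finitely generated left $A$-modules. Put $A^*=\mathrm{Hom}_{\Bbbk}(A,\Bbbk)$. Let $\mathcal{D}_A$ be the 2-category with one object $\mathtt{i}$ (identified with $\mathcal{C}$), whose 1-morphisms are all endofunctors of $\mathcal{C}$ that are isomorphic (under the equivalence $\mathcal{C}\simeq A\text{-mod}$) to tensoring with an $A$-$A$-bimodule in $\mathrm{add}\big(A\oplus(A\otimes_{\Bbbk}A)\oplus(A^*\otimes_{\Bbbk}A)\big)$, and whose 2-morphisms are all natural transformations of functors. Here $\mathrm{add}$ denotes the class of all direct summands of finite direct sums. For 1-morphisms $F,G$ write $F\geq_L G$ if $F$ is isomorphic to a direct summand of $H\circ G$ for some 1-morphism $H$, and $F\geq_J G$ if $F$ is isomorphic to a direct summand of $H\circ G\circ H'$ for some 1-morphisms $H,H'$. Left cells and two-sided cells are the equivalence classes of indecomposable 1-morphisms with respect to these preorders. Let $\mathcal{J}$ be a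 two-sided cell of $\mathcal{D}_A$ which does not contain the identity 1-morphism. A 2-representation is a 2-functor to the 2-category of small $\Bbbk$-linear categories, $\Bbbk$-linear functors and natural transformations. Two 2-representations are equivalent if there is a strong (2-natural up to coherent isomorphism) transformation between them whose components are equivalences of categories. For a left cell $\mathcal{L}$, the cell 2-representation $\mathbf{C}_{\mathcal{L}}$ is defined as follows: in the principal 2-representation $\mathbf{P}_{\mathtt{i}}=\mathcal{D}_A(\mathtt{i},-)$ take the 2-subrepresentation given by the additive closure of all 1-morphisms $F$ with $F\geq_L G$ for some $G\in\mathcal{L}$, and divide by the sum of all its ideals (families of two-sided ideals of morphisms, stable under the action of $\mathcal{D}_A$) that do not contain the identity $\mathrm{id}_F$ for any $F\in\mathcal{L}$; this sum is the unique maximal ideal with this property. Finally, let $\mathbf{N}$ be the 2-representation of $\mathcal{D}_A$ given by its natural action on the additive closure, in $\mathcal{C}$, of all projective and all injective objects. Then for every left cell $\mathcal{L}$ contained in $\mathcal{J}$, the cell 2-representation $\mathbf{C}_{\mathcal{L}}$ is equivalent to $\mathbf{N}$. -/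

import Mathlib

set_option linter.unusedVariables false
set_option linter.unusedSectionVars false

open CategoryTheory Bicategory
open scoped TensorProduct

universe w v u

noncomputable section

/-! ## The 2-category of small `k`-linear categories -/

/-- A small `k`-linear category. -/
structure LinCat (k : Type u) [Field k] where
  carrier : Type w
  [cat : SmallCategory carrier]
  [preadditive : Preadditive carrier]
  [linear : Linear k carrier]

namespace LinCat

variable {k : Type u} [Field k]

attribute [instance] LinCat.cat LinCat.preadditive LinCat.linear

/-- A `k`-linear (in particular additive) functor. -/
structure Hom (C D : LinCat.{w} k) where
  functor : C.carrier ⥤ D.carrier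
  [additive : functor.Additive]
  [linear : functor.Linear k]

attribute [instance] Hom.additive Hom.linear

/-- A natural transformation between `k`-linear functors. -/
@[ext]
structure Hom₂ {C D : LinCat.{w} k} (F G : Hom C D) where
  nat : F.functor ⟶ G.functor

instance (C D : LinCat.{w} k) : Category (Hom C D) where
  Hom F G := Hom₂ F G
  id F := ⟨𝟙 F.functor⟩
  comp a b := ⟨a.nat ≫ b.nat⟩

@[simp] lemma id_nat {C D : LinCat.{w} k} (F : Hom C D) :
    Hom₂.nat (𝟙 F) = 𝟙 F.functor := rfl

@[simp] lemma comp_nat {C D : LinCat.{w} k} {F G H : Hom C D} (a : F ⟶ G) (b : G ⟶ H) :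
    Hom₂.nat (a ≫ b) = a.nat ≫ b.nat := rfl

@[ext] lemma hom₂_ext {C D : LinCat.{w} k} {F G : Hom C D} {a b : F ⟶ G}
    (h : ∀ X, a.nat.app X = b.nat.app X) : a = b :=
  Hom₂.ext (NatTrans.ext (funext h))

/-- A natural isomorphism of functors, as an invertible 2-morphism. -/
@[simps] def isoMk {C D : LinCat.{w} k} {F G : Hom C D} (e : F.functor ≅ G.functor) : F ≅ G where
  hom := ⟨e.hom⟩
  inv := ⟨e.inv⟩

/-- The identity functor. -/
@[simps] def idHom (C : LinCat.{w} k) : Hom C C where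
  functor := 𝟭 C.carrier

/-- Composition of linear functors, first `F`, then `G`. -/
@[simps] def compHom {C D E : LinCat.{w} k} (F : Hom C D) (G : Hom D E) : Hom C E where
  functor := F.functor ⋙ G.functor

instance : CategoryStruct (LinCat.{w} k) where
  Hom C D := Hom C D
  id C := idHom C
  comp F G := compHom F G

instance (C D : LinCat.{w} k) : Category (C ⟶ D) := inferInstanceAs (Category (Hom C D))

instance : Bicategory (LinCat.{w} k) where
  whiskerLeft {_ _ _} F {G H} a :=
    (Hom₂.mk (Functor.whiskerLeft (Hom.functor F) (Hom₂.nat a)) : Hom₂ (compHom F G) (compHom F H))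
  whiskerRight {_ _ _ F G} a H :=
    (Hom₂.mk (Functor.whiskerRight (Hom₂.nat a) (Hom.functor H)) :
      Hom₂ (compHom F H) (compHom G H))
  associator F G H := isoMk (F := compHom (compHom F G) H) (G := compHom F (compHom G H))
    (Functor.associator (Hom.functor F) (Hom.functor G) (Hom.functor H))
  leftUnitor {C _} F := isoMk (F := compHom (idHom C) F) (G := F) (Hom.functor F).leftUnitor
  rightUnitor {_ D} F := isoMk (F := compHom F (idHom D)) (G := F) (Hom.functor F).rightUnitor
  whiskerLeft_id _ _ := rfl
  whiskerLeft_comp _ _ _ _ _ _ := rfl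
  id_whiskerLeft a := Hom₂.ext (NatTrans.ext (funext fun X =>
    show (Hom₂.nat a).app _ = 𝟙 _ ≫ (Hom₂.nat a).app _ ≫ 𝟙 _ by simp))
  comp_whiskerLeft F G _ _ a := Hom₂.ext (NatTrans.ext (funext fun X =>
    show (Hom₂.nat a).app _ = 𝟙 _ ≫ (Hom₂.nat a).app _ ≫ 𝟙 _ by simp))
  id_whiskerRight _ H := Hom₂.ext (NatTrans.ext (funext fun X => (Hom.functor H).map_id _))
  comp_whiskerRight _ _ H := Hom₂.ext (NatTrans.ext (funext fun X => (Hom.functor H).map_comp _ _))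
  whiskerRight_id a := Hom₂.ext (NatTrans.ext (funext fun X =>
    show (Hom₂.nat a).app _ = 𝟙 _ ≫ (Hom₂.nat a).app _ ≫ 𝟙 _ by simp))
  whiskerRight_comp a G H := Hom₂.ext (NatTrans.ext (funext fun X =>
    show (Hom.functor H).map ((Hom.functor G).map ((Hom₂.nat a).app _)) =
      𝟙 _ ≫ (Hom.functor H).map ((Hom.functor G).map ((Hom₂.nat a).app _)) ≫ 𝟙 _ by simp))
  whisker_assoc F _ _ a H := Hom₂.ext (NatTrans.ext (funext fun X =>
    show (Hom.functor H).map ((Hom₂.nat a).app _) =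
      𝟙 _ ≫ (Hom.functor H).map ((Hom₂.nat a).app _) ≫ 𝟙 _ by simp))
  whisker_exchange a b := Hom₂.ext (NatTrans.ext (funext fun X =>
    ((Hom₂.nat b).naturality ((Hom₂.nat a).app X)).symm))
  pentagon {_ _ _ _ _} F G H K := Hom₂.ext (NatTrans.ext (funext fun X =>
    show (Hom.functor K).map (𝟙 _) ≫ 𝟙 _ ≫ 𝟙 _ = 𝟙 _ ≫ 𝟙 _ by simp))
  triangle F G := Hom₂.ext (NatTrans.ext (funext fun X =>
    show 𝟙 _ ≫ 𝟙 _ = (Hom.functor G).map (𝟙 _) by simp))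

instance : Bicategory.Strict (LinCat.{w} k) where
  id_comp _ := rfl
  comp_id _ := rfl
  assoc _ _ _ := rfl
  leftUnitor_eqToIso _ := rfl
  rightUnitor_eqToIso _ := rfl
  associator_eqToIso _ _ _ := rfl

@[simp] lemma id_functor (C : LinCat.{w} k) : Hom.functor (𝟙 C) = 𝟭 C.carrier := rfl

@[simp] lemma comp_functor {C D E : LinCat.{w} k} (F : C ⟶ D) (G : D ⟶ E) :
    Hom.functor (F ≫ G) = Hom.functor F ⋙ Hom.functor G := rfl

@[simp] lemma whiskerLeft_nat {C D E : LinCat.{w} k} (F : C ⟶ D) {G H : D ⟶ E} (a : G ⟶ H) :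
    Hom₂.nat (F ◁ a) = Functor.whiskerLeft (Hom.functor F) (Hom₂.nat a) := rfl

@[simp] lemma whiskerRight_nat {C D E : LinCat.{w} k} {F G : C ⟶ D} (a : F ⟶ G) (H : D ⟶ E) :
    Hom₂.nat (a ▷ H) = Functor.whiskerRight (Hom₂.nat a) (Hom.functor H) := rfl

@[simp] lemma associator_hom_nat {B C D E : LinCat.{w} k} (F : B ⟶ C) (G : C ⟶ D) (H : D ⟶ E) :
    Hom₂.nat (α_ F G H).hom =
      (Functor.associator (Hom.functor F) (Hom.functor G) (Hom.functor H)).hom := rfl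

@[simp] lemma associator_inv_nat {B C D E : LinCat.{w} k} (F : B ⟶ C) (G : C ⟶ D) (H : D ⟶ E) :
    Hom₂.nat (α_ F G H).inv =
      (Functor.associator (Hom.functor F) (Hom.functor G) (Hom.functor H)).inv := rfl

@[simp] lemma leftUnitor_hom_nat {C D : LinCat.{w} k} (F : C ⟶ D) :
    Hom₂.nat (λ_ F).hom = (Hom.functor F).leftUnitor.hom := rfl

@[simp] lemma leftUnitor_inv_nat {C D : LinCat.{w} k} (F : C ⟶ D) :
    Hom₂.nat (λ_ F).inv = (Hom.functor F).leftUnitor.inv := rfl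

@[simp] lemma rightUnitor_hom_nat {C D : LinCat.{w} k} (F : C ⟶ D) :
    Hom₂.nat (ρ_ F).hom = (Hom.functor F).rightUnitor.hom := rfl

@[simp] lemma rightUnitor_inv_nat {C D : LinCat.{w} k} (F : C ⟶ D) :
    Hom₂.nat (ρ_ F).inv = (Hom.functor F).rightUnitor.inv := rfl

end LinCat

/-! ## Additive closure and indecomposable objects -/

/-- The additive closure `add(P)`: all objects whose identity factors through a finite direct sum
of objects satisfying `P`, i.e. all direct summands of finite direct sums of such objects. -/
def addClosure {C : Type*} [Category C] [Preadditive C] (P : ObjectProperty C) :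
    ObjectProperty C := fun X =>
  ∃ (n : ℕ) (Y : Fin n → C) (_ : ∀ t, P (Y t)) (a : ∀ t, X ⟶ Y t) (b : ∀ t, Y t ⟶ X),
    ∑ t, a t ≫ b t = 𝟙 X

section addClosure

variable {C D : Type*} [Category C] [Preadditive C] [Category D] [Preadditive D]

lemma addClosure_of_fintype {P : ObjectProperty C} {X : C} {ι : Type*} [Fintype ι]
    (Y : ι → C) (hY : ∀ t, P (Y t)) (a : ∀ t, X ⟶ Y t) (b : ∀ t, Y t ⟶ X)
    (h : ∑ t, a t ≫ b t = 𝟙 X) : addClosure P X := by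
  let e := (Fintype.equivFin ι).symm
  refine ⟨Fintype.card ι, fun t => Y (e t), fun t => hY _, fun t => a (e t), fun t => b (e t), ?_⟩
  rw [← h]
  exact e.sum_comp (fun t => a t ≫ b t)

lemma addClosure_of {P : ObjectProperty C} {X : C} (h : P X) : addClosure P X :=
  addClosure_of_fintype (ι := Unit) (fun _ => X) (fun _ => h) (fun _ => 𝟙 X) (fun _ => 𝟙 X)
    (by simp)

lemma addClosure_retract {P : ObjectProperty C} {X Y : C} (hY : addClosure P Y)
    (i : X ⟶ Y) (r : Y ⟶ X) (h : i ≫ r = 𝟙 X) : addClosure P X := by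
  obtain ⟨n, Z, hZ, a, b, hab⟩ := hY
  refine ⟨n, Z, hZ, fun t => i ≫ a t, fun t => b t ≫ r, ?_⟩
  have : ∀ t, (i ≫ a t) ≫ b t ≫ r = i ≫ (a t ≫ b t) ≫ r := by intro t; simp
  simp only [this]
  rw [← Preadditive.comp_sum, ← Preadditive.sum_comp, hab, Category.id_comp, h]

lemma addClosure_map {P : ObjectProperty C} {Q : ObjectProperty D} (F : C ⥤ D) [F.Additive]
    (hF : ∀ X, P X → addClosure Q (F.obj X)) {X : C} (hX : addClosure P X) :
    addClosure Q (F.obj X) := by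
  obtain ⟨n, Y, hY, a, b, hab⟩ := hX
  choose m Z hZ a' b' hab' using fun t => hF (Y t) (hY t)
  refine addClosure_of_fintype (ι := Σ t : Fin n, Fin (m t)) (fun s => Z s.1 s.2)
    (fun s => hZ _ _) (fun s => F.map (a s.1) ≫ a' s.1 s.2)
    (fun s => b' s.1 s.2 ≫ F.map (b s.1)) ?_
  rw [Fintype.sum_sigma]
  have : ∀ t, ∑ s, (F.map (a t) ≫ a' t s) ≫ b' t s ≫ F.map (b t) = F.map (a t ≫ b t) := by
    intro t
    have : ∀ s, (F.map (a t) ≫ a' t s) ≫ b' t s ≫ F.map (b t) =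
      F.map (a t) ≫ (a' t s ≫ b' t s) ≫ F.map (b t) := by intro s; simp
    simp only [this]
    rw [← Preadditive.comp_sum, ← Preadditive.sum_comp, hab', Category.id_comp, F.map_comp]
  simp only [this]
  rw [← F.map_sum, hab, F.map_id]

end addClosure

/-- An object is indecomposable if it is nonzero and in every decomposition as a direct sum of
two objects one of the summands is zero. -/
def IsIndecomposable {C : Type*} [Category C] [Preadditive C] (X : C) : Prop :=
  ¬ Limits.IsZero X ∧ ∀ (Y Z : C) (b : Limits.BinaryBicone Y Z),
    Nonempty b.IsBilimit → Nonempty (X ≅ b.pt) → Limits.IsZero Y ∨ Limits.IsZero Z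

/-! ## 2-representations -/

/-- The horizontal composition of a 2-category enriched in `k`-linear categories is biadditive
and `k`-bilinear. -/
class BilinearComp (k : Type u) [Field k] (𝒞 : Type v) [Bicategory.{w, w} 𝒞]
    [∀ i j : 𝒞, Preadditive (i ⟶ j)] [∀ i j : 𝒞, Linear k (i ⟶ j)] : Prop where
  whiskerLeft_add : ∀ {i j l : 𝒞} (f : i ⟶ j) {g h : j ⟶ l} (a b : g ⟶ h),
    f ◁ (a + b) = f ◁ a + f ◁ b
  whiskerLeft_smul : ∀ {i j l : 𝒞} (f : i ⟶ j) {g h : j ⟶ l} (c : k) (a : g ⟶ h),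
    f ◁ (c • a) = c • (f ◁ a)
  add_whiskerRight : ∀ {i j l : 𝒞} {f g : i ⟶ j} (a b : f ⟶ g) (h : j ⟶ l),
    (a + b) ▷ h = a ▷ h + b ▷ h
  smul_whiskerRight : ∀ {i j l : 𝒞} {f g : i ⟶ j} (c : k) (a : f ⟶ g) (h : j ⟶ l),
    (c • a) ▷ h = c • (a ▷ h)

/-- A 2-representation of `𝒞`: a 2-functor from `𝒞` to small `k`-linear categories, `k`-linear
functors and natural transformations. -/
abbrev TwoRep (k : Type u) [Field k] (𝒞 : Type v) [Bicategory.{w, w} 𝒞] :=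
  Pseudofunctor 𝒞 (LinCat.{w} k)

namespace TwoRep

variable {k : Type u} [Field k] {𝒞 : Type v} [Bicategory.{w, w} 𝒞]

/-- Two 2-representations are equivalent if there is a strong natural transformation
between them all of whose components are equivalences of categories. -/
def Equivalent (M N : TwoRep.{w} k 𝒞) : Prop :=
  ∃ Φ : Pseudofunctor.StrongTrans M N, ∀ i : 𝒞, (Φ.app i).functor.IsEquivalence

lemma nat_congr {C D : LinCat.{w} k} {F G : C ⟶ D} {a b : F ⟶ G} (h : a = b) (X : C.carrier) :
    (LinCat.Hom₂.nat a).app X = (LinCat.Hom₂.nat b).app X := by rw [h]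

@[simp] lemma iso_hom_inv_nat {C D : LinCat.{w} k} {F G : C ⟶ D} (e : F ≅ G) (X : C.carrier) :
    (LinCat.Hom₂.nat e.hom).app X ≫ (LinCat.Hom₂.nat e.inv).app X = 𝟙 _ :=
  nat_congr e.hom_inv_id X

@[simp] lemma iso_inv_hom_nat {C D : LinCat.{w} k} {F G : C ⟶ D} (e : F ≅ G) (X : C.carrier) :
    (LinCat.Hom₂.nat e.inv).app X ≫ (LinCat.Hom₂.nat e.hom).app X = 𝟙 _ :=
  nat_congr e.inv_hom_id X

/-- The 2-subrepresentation of `M` on full subcategories which are stable under the action. -/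
def sub (M : TwoRep.{w} k 𝒞) (P : ∀ j, ObjectProperty (M.obj j).carrier)
    (hP : ∀ ⦃i j : 𝒞⦄ (f : i ⟶ j) (X : (M.obj i).carrier), P i X → P j ((M.map f).functor.obj X)) :
    TwoRep.{w} k 𝒞 where
  obj j := { carrier := (P j).FullSubcategory }
  map {i j} f :=
    { functor := (P j).lift ((P i).ι ⋙ (M.map f).functor) (fun X => hP f _ X.property)
      additive := ⟨ObjectProperty.hom_ext _ ((M.map f).functor.map_add)⟩
      linear := ⟨fun a c => ObjectProperty.hom_ext _ ((M.map f).functor.map_smul c a.hom)⟩ }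
  map₂ a := ⟨{ app := fun X => ObjectProperty.homMk ((M.map₂ a).nat.app X.obj)
               naturality := fun _ _ u =>
                ObjectProperty.hom_ext _ ((M.map₂ a).nat.naturality u.hom) }⟩
  mapId i := LinCat.isoMk (NatIso.ofComponents
    (fun X => (P i).isoMk
      { hom := (M.mapId i).hom.nat.app X.obj
        inv := (M.mapId i).inv.nat.app X.obj
        hom_inv_id := iso_hom_inv_nat (M.mapId i) X.obj
        inv_hom_id := iso_inv_hom_nat (M.mapId i) X.obj })
    (fun u => ObjectProperty.hom_ext _ ((M.mapId i).hom.nat.naturality u.hom)))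
  mapComp {_ _ l} f g := LinCat.isoMk (NatIso.ofComponents
    (fun X => (P l).isoMk
      { hom := (M.mapComp f g).hom.nat.app X.obj
        inv := (M.mapComp f g).inv.nat.app X.obj
        hom_inv_id := iso_hom_inv_nat (M.mapComp f g) X.obj
        inv_hom_id := iso_inv_hom_nat (M.mapComp f g) X.obj })
    (fun u => ObjectProperty.hom_ext _ ((M.mapComp f g).hom.nat.naturality u.hom)))
  map₂_id f := LinCat.hom₂_ext fun X =>
    ObjectProperty.hom_ext _ (nat_congr (M.map₂_id f) X.obj)
  map₂_comp a b := LinCat.hom₂_ext fun X =>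
    ObjectProperty.hom_ext _ (nat_congr (M.map₂_comp a b) X.obj)
  map₂_whisker_left f _ _ a := LinCat.hom₂_ext fun X =>
    ObjectProperty.hom_ext _ (nat_congr (M.map₂_whisker_left f a) X.obj)
  map₂_whisker_right a h := LinCat.hom₂_ext fun X =>
    ObjectProperty.hom_ext _ (nat_congr (M.map₂_whisker_right a h) X.obj)
  map₂_associator f g h := LinCat.hom₂_ext fun X =>
    ObjectProperty.hom_ext _ (nat_congr (M.map₂_associator f g h) X.obj)
  map₂_left_unitor f := LinCat.hom₂_ext fun X =>
    ObjectProperty.hom_ext _ (nat_congr (M.map₂_left_unitor f) X.obj)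
  map₂_right_unitor f := LinCat.hom₂_ext fun X =>
    ObjectProperty.hom_ext _ (nat_congr (M.map₂_right_unitor f) X.obj)

/-- An ideal of a 2-representation `M`: a two-sided ideal in each of the categories `M(j)`, such
that this collection is stable under the action of all 1-morphisms. -/
structure Ideal (M : TwoRep.{w} k 𝒞) where
  hom : ∀ (j : 𝒞) (X Y : (M.obj j).carrier), Submodule k (X ⟶ Y)
  comp_mem : ∀ (j : 𝒞) {X Y Z : (M.obj j).carrier} (a : X ⟶ Y) {b : Y ⟶ Z},
    b ∈ hom j Y Z → a ≫ b ∈ hom j X Z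
  mem_comp : ∀ (j : 𝒞) {X Y Z : (M.obj j).carrier} {a : X ⟶ Y} (b : Y ⟶ Z),
    a ∈ hom j X Y → a ≫ b ∈ hom j X Z
  map_mem : ∀ {i j : 𝒞} (f : i ⟶ j) {X Y : (M.obj i).carrier} {a : X ⟶ Y},
    a ∈ hom i X Y → (M.map f).functor.map a ∈ hom j _ _

namespace Ideal

variable {M : TwoRep.{w} k 𝒞} (I : Ideal M)

/-- Congruence of morphisms modulo an ideal. -/
def rel (j : 𝒞) : HomRel (M.obj j).carrier := fun X Y a b => a - b ∈ I.hom j X Y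

instance (j : 𝒞) : Congruence (I.rel j) where
  comp_left f g g' h := by
    have := I.comp_mem j f h
    rwa [Preadditive.comp_sub] at this
  comp_right g h := by
    have := I.mem_comp j g h
    rwa [Preadditive.sub_comp] at this
  equivalence :=
    { refl := fun a => by simp [rel]
      symm := fun {a b} h => by
        have := (I.hom j _ _).neg_mem h
        rwa [neg_sub] at this
      trans := fun {a b c} h h' => by
        have := (I.hom j _ _).add_mem h h'
        rwa [sub_add_sub_cancel] at this }

lemma rel_add (j : 𝒞) ⦃X Y : (M.obj j).carrier⦄ (a a' b b' : X ⟶ Y) (h : I.rel j a a')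
    (h' : I.rel j b b') : I.rel j (a + b) (a' + b') := by
  have := (I.hom j _ _).add_mem h h'
  rwa [sub_add_sub_comm] at this

lemma rel_smul (j : 𝒞) (c : k) ⦃X Y : (M.obj j).carrier⦄ (a a' : X ⟶ Y) (h : I.rel j a a') :
    I.rel j (c • a) (c • a') := by
  have := (I.hom j _ _).smul_mem c h
  rwa [smul_sub] at this

/-- The quotient category `M(j)/I(j)`: same objects, morphisms taken modulo the ideal. -/
@[simps carrier cat]
def quotObj (j : 𝒞) : LinCat.{w} k :=
  letI : Preadditive (CategoryTheory.Quotient (I.rel j)) := Quotient.preadditive _ (I.rel_add j)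
  haveI : (Quotient.functor (I.rel j)).Additive := Quotient.functor_additive _ (I.rel_add j)
  letI : Linear k (CategoryTheory.Quotient (I.rel j)) := Quotient.linear k _ (I.rel_smul j)
  { carrier := CategoryTheory.Quotient (I.rel j) }

/-- The projection onto the quotient. -/
def proj (j : 𝒞) : (M.obj j).carrier ⥤ (I.quotObj j).carrier := Quotient.functor (I.rel j)

lemma proj_add {j : 𝒞} {X Y : (M.obj j).carrier} (a b : X ⟶ Y) :
    (I.proj j).map (a + b) = (I.proj j).map a + (I.proj j).map b := rfl

lemma proj_smul {j : 𝒞} {X Y : (M.obj j).carrier} (c : k) (a : X ⟶ Y) :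
    (I.proj j).map (c • a) = c • (I.proj j).map a := rfl

lemma proj_surj {j : 𝒞} {X Y : (M.obj j).carrier}
    (a : (I.proj j).obj X ⟶ (I.proj j).obj Y) : ∃ b, (I.proj j).map b = a :=
  (Quotient.functor (I.rel j)).map_surjective a

lemma proj_eq_iff {j : 𝒞} {X Y : (M.obj j).carrier} (a b : X ⟶ Y) :
    (I.proj j).map a = (I.proj j).map b ↔ a - b ∈ I.hom j X Y :=
  CategoryTheory.Quotient.functor_map_eq_iff (I.rel j) a b

/-- The functor induced by a 1-morphism on the quotient categories. -/
def quotFunctor {i j : 𝒞} (f : i ⟶ j) : (I.quotObj i).carrier ⥤ (I.quotObj j).carrier :=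
  CategoryTheory.Quotient.lift (I.rel i) ((M.map f).functor ⋙ I.proj j) (fun X Y a b h => by
    have := I.map_mem f h
    rw [Functor.map_sub] at this
    exact (I.proj_eq_iff _ _).2 this)

lemma quotFunctor_map {i j : 𝒞} (f : i ⟶ j) {X Y : (M.obj i).carrier} (a : X ⟶ Y) :
    (I.quotFunctor f).map ((I.proj i).map a) = (I.proj j).map ((M.map f).functor.map a) := rfl

/-- A natural transformation between functors out of the quotient, from its components. -/
def natMk {j : 𝒞} {D : Type w} [SmallCategory D] {F G : (I.quotObj j).carrier ⥤ D}
    (t : I.proj j ⋙ F ⟶ I.proj j ⋙ G) : F ⟶ G where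
  app X := t.app X.as
  naturality := by
    rintro ⟨X⟩ ⟨Y⟩ a
    obtain ⟨b, rfl⟩ := I.proj_surj a
    exact t.naturality b

/-- The quotient 2-representation `M/I`. -/
def quot : TwoRep.{w} k 𝒞 where
  obj j := I.quotObj j
  map {i j} f :=
    { functor := I.quotFunctor f
      additive := ⟨by
        rintro ⟨X⟩ ⟨Y⟩ a b
        obtain ⟨a, rfl⟩ := I.proj_surj a
        obtain ⟨b, rfl⟩ := I.proj_surj b
        exact congrArg (I.proj j).map (M.map f).functor.map_add⟩
      linear := ⟨by
        rintro ⟨X⟩ ⟨Y⟩ a c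
        obtain ⟨a, rfl⟩ := I.proj_surj a
        exact congrArg (I.proj j).map ((M.map f).functor.map_smul c a)⟩ }
  map₂ {i j f g} a := ⟨I.natMk (F := I.quotFunctor f) (G := I.quotFunctor g)
    (Functor.whiskerRight (M.map₂ a).nat (I.proj j))⟩
  mapId i :=
    { hom := ⟨I.natMk (F := I.quotFunctor (𝟙 i)) (G := 𝟭 _)
        (Functor.whiskerRight (M.mapId i).hom.nat (I.proj i))⟩
      inv := ⟨I.natMk (F := 𝟭 _) (G := I.quotFunctor (𝟙 i))
        (Functor.whiskerRight (M.mapId i).inv.nat (I.proj i))⟩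
      hom_inv_id := LinCat.hom₂_ext fun X =>
        congrArg (I.proj i).map (iso_hom_inv_nat (M.mapId i) X.as)
      inv_hom_id := LinCat.hom₂_ext fun X =>
        congrArg (I.proj i).map (iso_inv_hom_nat (M.mapId i) X.as) }
  mapComp {i j l} f g :=
    { hom := ⟨I.natMk (F := I.quotFunctor (f ≫ g)) (G := I.quotFunctor f ⋙ I.quotFunctor g)
        (Functor.whiskerRight (M.mapComp f g).hom.nat (I.proj l))⟩
      inv := ⟨I.natMk (F := I.quotFunctor f ⋙ I.quotFunctor g) (G := I.quotFunctor (f ≫ g))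
        (Functor.whiskerRight (M.mapComp f g).inv.nat (I.proj l))⟩
      hom_inv_id := LinCat.hom₂_ext fun X =>
        congrArg (I.proj l).map (iso_hom_inv_nat (M.mapComp f g) X.as)
      inv_hom_id := LinCat.hom₂_ext fun X =>
        congrArg (I.proj l).map (iso_inv_hom_nat (M.mapComp f g) X.as) }
  map₂_id {i j} f := LinCat.hom₂_ext fun X =>
    congrArg (I.proj j).map (nat_congr (M.map₂_id f) X.as)
  map₂_comp {i j} _ _ _ a b := LinCat.hom₂_ext fun X =>
    congrArg (I.proj j).map (nat_congr (M.map₂_comp a b) X.as)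
  map₂_whisker_left {_ _ l} f _ _ a := LinCat.hom₂_ext fun X =>
    congrArg (I.proj l).map (nat_congr (M.map₂_whisker_left f a) X.as)
  map₂_whisker_right {_ _ l} _ _ a h := LinCat.hom₂_ext fun X =>
    congrArg (I.proj l).map (nat_congr (M.map₂_whisker_right a h) X.as)
  map₂_associator {_ _ _ l} f g h := LinCat.hom₂_ext fun X =>
    congrArg (I.proj l).map (nat_congr (M.map₂_associator f g h) X.as)
  map₂_left_unitor {_ l} f := LinCat.hom₂_ext fun X =>
    congrArg (I.proj l).map (nat_congr (M.map₂_left_unitor f) X.as)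
  map₂_right_unitor {_ l} f := LinCat.hom₂_ext fun X =>
    congrArg (I.proj l).map (nat_congr (M.map₂_right_unitor f) X.as)

end Ideal

end TwoRep

/-! ## Cells and cell 2-representations -/

section Cells

variable {𝒞 : Type v} [Bicategory.{w, w} 𝒞] [∀ i j : 𝒞, Preadditive (i ⟶ j)]

/-- `F ≥_L G`: the 1-morphism `F` is isomorphic to a direct summand of `H ∘ G` (first `G`, then
`H`) for some 1-morphism `H`. -/
def LeftGE {i j l : 𝒞} (F : i ⟶ j) (G : i ⟶ l) : Prop :=
  ∃ H : l ⟶ j, Nonempty (Retract F (G ≫ H))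

/-- `F ≥_J G`: the 1-morphism `F` is isomorphic to a direct summand of `H ∘ G ∘ H'` for some
1-morphisms `H` and `H'`. -/
def TwoSidedGE {i j i' j' : 𝒞} (F : i ⟶ j) (G : i' ⟶ j') : Prop :=
  ∃ (H' : i ⟶ i') (H : j' ⟶ j), Nonempty (Retract F (H' ≫ G ≫ H))

/-- `L` is a left cell, all of whose elements start at `i`: an equivalence class of indecomposable
1-morphisms with respect to the left preorder. -/
def IsLeftCell {i : 𝒞} (L : ∀ j : 𝒞, (i ⟶ j) → Prop) : Prop :=
  ∃ (l : 𝒞) (G : i ⟶ l), IsIndecomposable G ∧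
    ∀ (j : 𝒞) (F : i ⟶ j), L j F ↔ IsIndecomposable F ∧ LeftGE F G ∧ LeftGE G F

/-- `J` is a two-sided cell: an equivalence class of indecomposable 1-morphisms with respect to
the two-sided preorder. -/
def IsTwoSidedCell (J : ∀ i j : 𝒞, (i ⟶ j) → Prop) : Prop :=
  ∃ (i' j' : 𝒞) (G : i' ⟶ j'), IsIndecomposable G ∧
    ∀ (i j : 𝒞) (F : i ⟶ j), J i j F ↔ IsIndecomposable F ∧ TwoSidedGE F G ∧ TwoSidedGE G F

end Cells

section CellTwoRep

variable (k : Type u) [Field k] {𝒞 : Type v} [Bicategory.{w, w} 𝒞]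
  [∀ i j : 𝒞, Preadditive (i ⟶ j)] [∀ i j : 𝒞, Linear k (i ⟶ j)] [BilinearComp k 𝒞]

/-- The principal 2-representation `P_i = 𝒞(i, -)`. -/
def principal (i : 𝒞) : TwoRep.{w} k 𝒞 where
  obj j := { carrier := (i ⟶ j) }
  map {j l} h :=
    { functor := { obj := fun F => F ≫ h, map := fun a => a ▷ h }
      additive := ⟨BilinearComp.add_whiskerRight k _ _ _⟩
      linear := ⟨fun a c => BilinearComp.smul_whiskerRight c a h⟩ }
  map₂ a := ⟨{ app := fun F => F ◁ a, naturality := fun _ _ u => (whisker_exchange u a).symm }⟩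
  mapId j := LinCat.isoMk (NatIso.ofComponents (fun F => ρ_ F) (fun u => by simp))
  mapComp f g := LinCat.isoMk (NatIso.ofComponents (fun F => (α_ F f g).symm) (fun u => by simp))
  map₂_id f := LinCat.hom₂_ext fun F => whiskerLeft_id F f
  map₂_comp a b := LinCat.hom₂_ext fun F => whiskerLeft_comp F a b
  map₂_whisker_left f _ _ a := LinCat.hom₂_ext fun F =>
    show F ◁ f ◁ a = (α_ F f _).inv ≫ (F ≫ f) ◁ a ≫ (α_ F f _).hom by simp
  map₂_whisker_right a h := LinCat.hom₂_ext fun F =>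
    show F ◁ a ▷ h = (α_ F _ h).inv ≫ (F ◁ a) ▷ h ≫ (α_ F _ h).hom by simp
  map₂_associator f g h := LinCat.hom₂_ext fun F =>
    show F ◁ (α_ f g h).hom = (α_ F (f ≫ g) h).inv ≫ (α_ F f g).inv ▷ h ≫ 𝟙 _ ≫
      (α_ (F ≫ f) g h).hom ≫ (α_ F f (g ≫ h)).hom by simp
  map₂_left_unitor f := LinCat.hom₂_ext fun F =>
    show F ◁ (λ_ f).hom = (α_ F (𝟙 _) f).inv ≫ (ρ_ F).hom ▷ f ≫ 𝟙 _ by simp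
  map₂_right_unitor f := LinCat.hom₂_ext fun F =>
    show F ◁ (ρ_ f).hom = (α_ F f (𝟙 _)).inv ≫ (ρ_ (F ≫ f)).hom ≫ 𝟙 _ by simp

variable {i : 𝒞} (L : ∀ j : 𝒞, (i ⟶ j) → Prop)

/-- The additive closure of all 1-morphisms `F` with `F ≥_L G` for some `G` in `L`. -/
def cellObj (j : 𝒞) : ObjectProperty (i ⟶ j) :=
  addClosure fun F => ∃ (l : 𝒞) (G : i ⟶ l), L l G ∧ LeftGE F G

lemma cellObj_stable (k : Type u) [Field k] {𝒞 : Type v} [Bicategory.{w, w} 𝒞]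
    [∀ i j : 𝒞, Preadditive (i ⟶ j)] [∀ i j : 𝒞, Linear k (i ⟶ j)] [BilinearComp k 𝒞]
    {i : 𝒞} (L : ∀ j : 𝒞, (i ⟶ j) → Prop) ⦃j l : 𝒞⦄ (h : j ⟶ l) (F : i ⟶ j)
    (hF : cellObj L j F) : cellObj L l (F ≫ h) := by
  have key : ∀ F : i ⟶ j, (∃ (l : 𝒞) (G : i ⟶ l), L l G ∧ LeftGE F G) →
      cellObj L l (F ≫ h) := by
    rintro F ⟨m, G, hG, H, ⟨r⟩⟩
    refine addClosure_of ⟨m, G, hG, H ≫ h, ⟨?_⟩⟩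
    exact
      { i := r.i ▷ h ≫ (α_ G H h).hom
        r := (α_ G H h).inv ≫ r.r ▷ h
        retract := by simp [← comp_whiskerRight] }
  have : (postcomp i h).Additive := ⟨BilinearComp.add_whiskerRight k _ _ _⟩
  exact addClosure_map (postcomp i h) key hF

/-- The 2-subrepresentation of the principal 2-representation `P_i` given by the additive closure
of all 1-morphisms `F ≥_L L`. -/
def cellSub : TwoRep.{w} k 𝒞 :=
  (principal k i).sub (cellObj L) (cellObj_stable k L)

/-- An ideal of `cellSub` is proper if it does not contain the identity of any 1-morphism in the
left cell. -/
def IsProperIdeal (I : (cellSub k L).Ideal) : Prop :=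
  ∀ (j : 𝒞) (X : (cellObj L j).FullSubcategory), L j X.obj → 𝟙 X ∉ I.hom j X X

/-- The sum of all ideals of `cellSub` which contain no identity of a 1-morphism in the left cell
(for a left cell of a finitary 2-category, this is the unique maximal such ideal). -/
def maxIdeal : (cellSub k L).Ideal where
  hom j X Y := ⨆ I : {I : (cellSub k L).Ideal // IsProperIdeal k L I}, I.1.hom j X Y
  comp_mem j X Y Z a b hb := by
    have : (⨆ I : {I : (cellSub k L).Ideal // IsProperIdeal k L I}, I.1.hom j Y Z) ≤
        (⨆ I : {I : (cellSub k L).Ideal // IsProperIdeal k L I}, I.1.hom j X Z).comap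
          (Linear.leftComp k Z a) :=
      iSup_le fun I b hb => Submodule.mem_iSup_of_mem I (I.1.comp_mem j a hb)
    exact this hb
  mem_comp j X Y Z a b ha := by
    have : (⨆ I : {I : (cellSub k L).Ideal // IsProperIdeal k L I}, I.1.hom j X Y) ≤
        (⨆ I : {I : (cellSub k L).Ideal // IsProperIdeal k L I}, I.1.hom j X Z).comap
          (Linear.rightComp k X b) :=
      iSup_le fun I a ha => Submodule.mem_iSup_of_mem I (I.1.mem_comp j b ha)
    exact this ha
  map_mem {j l} f X Y a ha := by
    have : (⨆ I : {I : (cellSub k L).Ideal // IsProperIdeal k L I}, I.1.hom j X Y) ≤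
        (⨆ I : {I : (cellSub k L).Ideal // IsProperIdeal k L I}, I.1.hom l _ _).comap
          (((cellSub k L).map f).functor.mapLinearMap k) :=
      iSup_le fun I a ha => Submodule.mem_iSup_of_mem I (I.1.map_mem f ha)
    exact this ha

/-- The cell 2-representation `C_L`: the (unique) simple transitive quotient of `cellSub`. -/
def cellTwoRep : TwoRep.{w} k 𝒞 := (maxIdeal k L).quot

end CellTwoRep

/-! ## Bimodules and the tensor product over a noncommutative algebra -/

/-- An `A`-`A`-bimodule which is finitely generated as a left module (for a finite dimensional
algebra `A` this means finite dimensional). The right action is an action of the opposite ring. -/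
structure FDBimod (A : Type u) [Ring A] where
  carrier : Type u
  [addCommGroup : AddCommGroup carrier]
  [left : Module A carrier]
  [right : Module Aᵐᵒᵖ carrier]
  [comm : SMulCommClass A Aᵐᵒᵖ carrier]
  [finite : Module.Finite A carrier]

namespace FDBimod

open MulOpposite (op)

variable {A : Type u} [Ring A]

attribute [instance] addCommGroup left right comm finite

/-- Bimodule homomorphisms, as a subgroup of the left module homomorphisms. -/
def homSubgroup (B B' : FDBimod A) : AddSubgroup (B.carrier →ₗ[A] B'.carrier) where
  carrier := {f | ∀ (a : A) (x : B.carrier), f (op a • x) = op a • f x}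
  add_mem' := by intro f g hf hg a x; simp [hf a x, hg a x]
  zero_mem' := by intro a x; simp
  neg_mem' := by intro f hf a x; simp [hf a x]

instance : Category (FDBimod A) where
  Hom B B' := homSubgroup B B'
  id B := ⟨LinearMap.id, fun _ _ => rfl⟩
  comp f g := ⟨g.1.comp f.1, fun a x => by
    rw [LinearMap.comp_apply, f.2 a x, g.2 a, LinearMap.comp_apply]⟩

instance : Preadditive (FDBimod A) where
  homGroup B B' := inferInstanceAs (AddCommGroup (homSubgroup B B'))
  add_comp _ _ _ f f' g := Subtype.ext (LinearMap.ext fun x => g.1.map_add (f.1 x) (f'.1 x))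
  comp_add _ _ _ _ _ _ := rfl

/-- The homomorphism underlying a morphism of bimodules. -/
def Hom.lin {B B' : FDBimod A} (f : B ⟶ B') : B.carrier →ₗ[A] B'.carrier := f.1

lemma Hom.lin_op {B B' : FDBimod A} (f : B ⟶ B') (a : A) (x : B.carrier) :
    Hom.lin f (op a • x) = op a • Hom.lin f x := f.2 a x

/-- Constructor for morphisms of bimodules. -/
def homMk {B B' : FDBimod A} (f : B.carrier →ₗ[A] B'.carrier)
    (h : ∀ (a : A) (x : B.carrier), f (op a • x) = op a • f x) : B ⟶ B' := ⟨f, h⟩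

@[simp] lemma lin_homMk {B B' : FDBimod A} (f : B.carrier →ₗ[A] B'.carrier)
    (h : ∀ (a : A) (x : B.carrier), f (op a • x) = op a • f x) : Hom.lin (homMk f h) = f := rfl

@[simp] lemma lin_id (B : FDBimod A) : Hom.lin (𝟙 B) = LinearMap.id := rfl

@[simp] lemma lin_comp {B B' B'' : FDBimod A} (f : B ⟶ B') (g : B' ⟶ B'') :
    Hom.lin (f ≫ g) = (Hom.lin g).comp (Hom.lin f) := rfl

@[simp] lemma lin_add {B B' : FDBimod A} (f g : B ⟶ B') :
    Hom.lin (f + g) = Hom.lin f + Hom.lin g := rfl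

lemma hom_ext {B B' : FDBimod A} {f g : B ⟶ B'} (h : ∀ x, Hom.lin f x = Hom.lin g x) : f = g :=
  Subtype.ext (LinearMap.ext h)

lemma lin_sum {B B' : FDBimod A} {ι : Type*} (s : Finset ι) (f : ι → (B ⟶ B')) (x : B.carrier) :
    Hom.lin (∑ t ∈ s, f t) x = ∑ t ∈ s, Hom.lin (f t) x := by
  let φ : (B ⟶ B') →+ B'.carrier :=
    { toFun := fun f => Hom.lin f x, map_zero' := rfl, map_add' := fun _ _ => rfl }
  exact map_sum φ f s

end FDBimod

section Tensor

open MulOpposite (op)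
open FDBimod (Hom.lin Hom.lin_op homMk)

variable {A : Type u} [Ring A]

/-- The tensor product `B ⊗_A M` of a bimodule and a left module: the quotient of the tensor
product of abelian groups by the relations `(b a) ⊗ m = b ⊗ (a m)`, with the left action of `A`
on `B`. -/
def BTensor (B : FDBimod A) (M : Type u) [AddCommGroup M] [Module A M] : Type u :=
  (B.carrier ⊗[ℤ] M) ⧸ Submodule.span A
    {x : B.carrier ⊗[ℤ] M | ∃ (b : B.carrier) (a : A) (m : M),
      x = (op a • b) ⊗ₜ[ℤ] m - b ⊗ₜ[ℤ] (a • m)}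

namespace BTensor

variable {B B' B'' : FDBimod A} {M M' M'' : Type u} [AddCommGroup M] [Module A M]
  [AddCommGroup M'] [Module A M'] [AddCommGroup M''] [Module A M'']

instance : AddCommGroup (BTensor B M) := inferInstanceAs (AddCommGroup (_ ⧸ Submodule.span A _))

instance : Module A (BTensor B M) := inferInstanceAs (Module A (_ ⧸ Submodule.span A _))

/-- The class of `b ⊗ m`. -/
def tmul (b : B.carrier) (m : M) : BTensor B M := Submodule.Quotient.mk (b ⊗ₜ[ℤ] m)

lemma add_tmul (b b' : B.carrier) (m : M) : tmul (b + b') m = tmul b m + tmul b' m :=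
  congrArg Submodule.Quotient.mk (TensorProduct.add_tmul b b' m)

lemma tmul_add (b : B.carrier) (m m' : M) : tmul b (m + m') = tmul b m + tmul b m' :=
  congrArg Submodule.Quotient.mk (TensorProduct.tmul_add b m m')

lemma smul_tmul (a : A) (b : B.carrier) (m : M) : tmul (a • b) m = a • tmul b m := rfl

lemma op_tmul (a : A) (b : B.carrier) (m : M) : tmul (op a • b) m = tmul b (a • m) :=
  (Submodule.Quotient.eq _).2 (Submodule.subset_span ⟨b, a, m, rfl⟩)

lemma induction {p : BTensor B M → Prop} (h : ∀ b m, p (tmul b m))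
    (hadd : ∀ x y, p x → p y → p (x + y)) (x : BTensor B M) : p x := by
  obtain ⟨x, rfl⟩ := Submodule.Quotient.mk_surjective _ x
  induction x using TensorProduct.induction_on with
  | zero =>
    have := h 0 0
    rwa [tmul, TensorProduct.zero_tmul] at this
  | tmul b m => exact h b m
  | add x y hx hy => exact hadd _ _ hx hy

/-- The universal property of the tensor product. -/
def liftAdd {P : Type u} [AddCommGroup P] (f : B.carrier → M → P)
    (h₁ : ∀ b b' m, f (b + b') m = f b m + f b' m) (h₂ : ∀ b m m', f b (m + m') = f b m + f b m')
    (h₃ : ∀ (a : A) b m, f (op a • b) m = f b (a • m)) : BTensor B M →+ P :=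
  QuotientAddGroup.lift (Submodule.span A _).toAddSubgroup
    (TensorProduct.lift (AddMonoidHom.toIntLinearMap
        (AddMonoidHom.mk' (fun b => AddMonoidHom.toIntLinearMap (AddMonoidHom.mk' (f b) (h₂ b)))
          (fun b b' => LinearMap.ext fun m => h₁ b b' m))) : B.carrier ⊗[ℤ] M →ₗ[ℤ] P).toAddMonoidHom
    (by
      have key : ∀ x ∈ Submodule.span A {x : B.carrier ⊗[ℤ] M | ∃ (b : B.carrier) (a : A) (m : M),
          x = (op a • b) ⊗ₜ[ℤ] m - b ⊗ₜ[ℤ] (a • m)}, ∀ c : A,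
          TensorProduct.lift (AddMonoidHom.toIntLinearMap
            (AddMonoidHom.mk' (fun b => AddMonoidHom.toIntLinearMap (AddMonoidHom.mk' (f b) (h₂ b)))
              (fun b b' => LinearMap.ext fun m => h₁ b b' m))) (c • x) = 0 := by
        intro x hx
        induction hx using Submodule.span_induction with
        | mem x hx =>
          obtain ⟨b, a, m, rfl⟩ := hx
          intro c
          rw [smul_sub, map_sub, sub_eq_zero, TensorProduct.smul_tmul', TensorProduct.smul_tmul',
            smul_comm c (op a) b]
          exact h₃ a (c • b) m
        | zero => intro c; rw [smul_zero, map_zero]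
        | add x y _ _ hx hy => intro c; rw [smul_add, map_add, hx, hy, add_zero]
        | smul a x _ hx => intro c; rw [← mul_smul]; exact hx _
      intro x hx
      have := key x hx 1
      rwa [one_smul] at this)

@[simp] lemma liftAdd_tmul {P : Type u} [AddCommGroup P] (f : B.carrier → M → P)
    (h₁ h₂ h₃) (b : B.carrier) (m : M) : liftAdd f h₁ h₂ h₃ (tmul b m) = f b m := rfl

/-- The universal property of the tensor product, for maps linear with respect to the left
action. -/
def lift {P : Type u} [AddCommGroup P] [Module A P] (f : B.carrier → M → P)
    (h₁ : ∀ b b' m, f (b + b') m = f b m + f b' m) (h₂ : ∀ b m m', f b (m + m') = f b m + f b m')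
    (h₃ : ∀ (a : A) b m, f (a • b) m = a • f b m)
    (h₄ : ∀ (a : A) b m, f (op a • b) m = f b (a • m)) : BTensor B M →ₗ[A] P where
  toFun := liftAdd f h₁ h₂ h₄
  map_add' := map_add _
  map_smul' a x := by
    induction x using induction with
    | h b m => exact h₃ a b m
    | hadd x y hx hy => rw [smul_add, map_add, map_add, smul_add, hx, hy]

@[simp] lemma lift_tmul {P : Type u} [AddCommGroup P] [Module A P] (f : B.carrier → M → P)
    (h₁ h₂ h₃ h₄) (b : B.carrier) (m : M) : lift f h₁ h₂ h₃ h₄ (tmul b m) = f b m := rfl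

lemma add_ext {P : Type u} [AddCommGroup P] {f g : BTensor B M →+ P}
    (h : ∀ b m, f (tmul b m) = g (tmul b m)) (x : BTensor B M) : f x = g x :=
  induction (p := fun x => f x = g x) h (fun x y hx hy => by rw [map_add, map_add, hx, hy]) x

lemma lin_ext {P : Type u} [AddCommGroup P] [Module A P] {f g : BTensor B M →ₗ[A] P}
    (h : ∀ b m, f (tmul b m) = g (tmul b m)) : f = g :=
  LinearMap.ext fun x => induction (p := fun x => f x = g x) h
    (fun x y hx hy => by rw [map_add, map_add, hx, hy]) x

/-- Functoriality of the tensor product in both variables. -/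
def map (f : B ⟶ B') (g : M →ₗ[A] M') : BTensor B M →ₗ[A] BTensor B' M' :=
  lift (fun b m => tmul (Hom.lin f b) (g m))
    (fun _ _ _ => by rw [map_add, add_tmul]) (fun _ _ _ => by rw [map_add, tmul_add])
    (fun _ _ _ => by rw [map_smul, smul_tmul])
    (fun _ _ _ => by rw [Hom.lin_op, op_tmul, map_smul])

@[simp] lemma map_tmul (f : B ⟶ B') (g : M →ₗ[A] M') (b : B.carrier) (m : M) :
    map f g (tmul b m) = tmul (Hom.lin f b) (g m) := rfl

lemma map_id : map (𝟙 B) (LinearMap.id : M →ₗ[A] M) = LinearMap.id := lin_ext fun _ _ => rfl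

lemma map_comp (f : B ⟶ B') (f' : B' ⟶ B'') (g : M →ₗ[A] M') (g' : M' →ₗ[A] M'') :
    map (f ≫ f') (g'.comp g) = (map f' g').comp (map f g) := lin_ext fun _ _ => rfl

lemma map_add_left (f f' : B ⟶ B') (g : M →ₗ[A] M') :
    map (f + f') g = map f g + map f' g := lin_ext fun _ _ => add_tmul _ _ _

lemma map_add_right (f : B ⟶ B') (g g' : M →ₗ[A] M') :
    map f (g + g') = map f g + map f g' := lin_ext fun _ _ => tmul_add _ _ _

instance [Module.Finite A M] : Module.Finite A (BTensor B M) := by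
  obtain ⟨s, hs⟩ := (inferInstance : Module.Finite A B.carrier).fg_top
  obtain ⟨t, ht⟩ := (inferInstance : Module.Finite A M).fg_top
  classical
  let U : Submodule A (BTensor B M) :=
    Submodule.span A (Finset.image₂ (fun b m => (tmul b m : BTensor B M)) s t)
  refine ⟨⟨Finset.image₂ (fun b m => (tmul b m : BTensor B M)) s t, ?_⟩⟩
  change U = ⊤
  have h1 : ∀ m ∈ t, ∀ b : B.carrier, (tmul b m : BTensor B M) ∈ U := by
    intro m hm b
    have hb : b ∈ Submodule.span A (s : Set B.carrier) := by rw [hs]; trivial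
    induction hb using Submodule.span_induction with
    | mem b hb => exact Submodule.subset_span (Finset.mem_image₂_of_mem hb hm)
    | zero =>
      have : (tmul (0 : B.carrier) m : BTensor B M) = (0 : A) • tmul 0 m := by
        rw [← smul_tmul, zero_smul]
      rw [this, zero_smul]
      exact U.zero_mem
    | add x y _ _ hx hy => rw [add_tmul]; exact U.add_mem hx hy
    | smul a x _ hx => rw [smul_tmul]; exact U.smul_mem a hx
  have h2 : ∀ (m : M) (b : B.carrier), (tmul b m : BTensor B M) ∈ U := by
    intro m
    have hm : m ∈ Submodule.span A (t : Set M) := by rw [ht]; trivial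
    induction hm using Submodule.span_induction with
    | mem m hm => exact h1 m hm
    | zero =>
      intro b
      have : (tmul b (0 : M) : BTensor B M) = (0 : A) • tmul (0 : B.carrier) (0 : M) := by
        rw [← smul_tmul, zero_smul]
        have := op_tmul (0 : A) b (0 : M)
        rw [zero_smul, MulOpposite.op_zero, zero_smul] at this
        exact this.symm
      rw [this, zero_smul]
      exact U.zero_mem
    | add x y _ _ hx hy => intro b; rw [tmul_add]; exact U.add_mem (hx b) (hy b)
    | smul a x _ hx => intro b; rw [← op_tmul]; exact hx _
  rw [eq_top_iff]
  rintro x -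
  exact induction (fun b m => h2 m b) (fun x y hx hy => U.add_mem hx hy) x

/-- The right action of `a` on `B ⊗_A M` for a bimodule `M`. -/
def rightMul (B B' : FDBimod A) (a : A) : BTensor B B'.carrier →ₗ[A] BTensor B B'.carrier :=
  map (𝟙 B)
    { toFun := fun x => op a • x
      map_add' := fun x y => smul_add _ x y
      map_smul' := fun c x => (smul_comm c (op a) x).symm }

instance : SMul Aᵐᵒᵖ (BTensor B B'.carrier) := ⟨fun a x => rightMul B B' a.unop x⟩

lemma op_smul_tmul (a : A) (b : B.carrier) (x : B'.carrier) :
    op a • (tmul b x : BTensor B B'.carrier) = tmul b (op a • x) := rfl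

lemma op_smul_add (a : A) (x y : BTensor B B'.carrier) : op a • (x + y) = op a • x + op a • y :=
  map_add (rightMul B B' a) x y

instance : Module Aᵐᵒᵖ (BTensor B B'.carrier) where
  one_smul x := LinearMap.congr_fun (f := rightMul B B' 1) (g := LinearMap.id)
    (lin_ext fun b x => congrArg (tmul b) (one_smul Aᵐᵒᵖ x)) x
  mul_smul a c x := LinearMap.congr_fun (f := rightMul B B' (c.unop * a.unop))
    (g := (rightMul B B' a.unop).comp (rightMul B B' c.unop))
    (lin_ext fun b x => congrArg (tmul b) (mul_smul a c x)) x
  smul_zero a := map_zero (rightMul B B' a.unop)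
  smul_add a := map_add (rightMul B B' a.unop)
  add_smul a c x := LinearMap.congr_fun (f := rightMul B B' (a.unop + c.unop))
    (g := rightMul B B' a.unop + rightMul B B' c.unop)
    (lin_ext fun b x => (congrArg (tmul b) (add_smul a c x)).trans (tmul_add _ _ _)) x
  zero_smul x := LinearMap.congr_fun (f := rightMul B B' 0) (g := 0)
    (lin_ext fun b x => by
      have h : rightMul B B' 0 (tmul b x) = tmul b ((0 : Aᵐᵒᵖ) • x) := rfl
      have h' := op_tmul (0 : A) b (0 : B'.carrier)
      rw [zero_smul, MulOpposite.op_zero, zero_smul] at h'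
      rw [h, zero_smul, ← h', ← zero_smul A (0 : B.carrier), smul_tmul, zero_smul]
      rfl) x

instance : SMulCommClass A Aᵐᵒᵖ (BTensor B B'.carrier) :=
  ⟨fun a c x => ((rightMul B B' c.unop).map_smul a x).symm⟩

end BTensor

/-- The tensor product of two bimodules. -/
def FDBimod.tensor (B B' : FDBimod A) : FDBimod A where
  carrier := BTensor B B'.carrier

/-- The functor `B ⊗_A -` on finitely generated left modules. -/
def tensorFunctor (B : FDBimod A) : FGModuleCat.{u} A ⥤ FGModuleCat.{u} A where
  obj M := FGModuleCat.of A (BTensor B M)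
  map g := FGModuleCat.ofHom (BTensor.map (𝟙 B) g.hom.hom)
  map_id _ := FGModuleCat.hom_ext BTensor.map_id
  map_comp g g' := FGModuleCat.hom_ext (BTensor.map_comp (𝟙 B) (𝟙 B) g.hom.hom g'.hom.hom)

end Tensor


/-! ## The bimodules `A`, `A ⊗ A` and `A* ⊗ A` and their additive closure -/

section Generators

open MulOpposite (op)
open FDBimod (Hom.lin Hom.lin_op homMk)

/-- The regular bimodule. -/
def FDBimod.regular (A : Type u) [Ring A] : FDBimod A where
  carrier := A

variable (k : Type u) [Field k] (A : Type u) [Ring A] [Algebra k A]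

/-- The underlying space of the outer tensor product `V ⊗_k A` of a left `A`-module `V` and the
right `A`-module `A`. -/
def Outer (V : Type u) [AddCommGroup V] [Module k V] : Type u := V ⊗[k] A

namespace Outer

variable (V : Type u) [AddCommGroup V] [Module k V]

instance : AddCommGroup (Outer k A V) := inferInstanceAs (AddCommGroup (V ⊗[k] A))

instance : Module k (Outer k A V) := inferInstanceAs (Module k (V ⊗[k] A))

variable {V} in
/-- The element `v ⊗ x`. -/
def tmul (v : V) (x : A) : Outer k A V := v ⊗ₜ[k] x

/-- The right action: `(v ⊗ x) a = v ⊗ (x a)`. -/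
instance : Module Aᵐᵒᵖ (Outer k A V) where
  smul a x := LinearMap.lTensor V (LinearMap.mulRight k a.unop) x
  one_smul x := by
    change LinearMap.lTensor V (LinearMap.mulRight k (1 : A)) x = x
    rw [LinearMap.mulRight_one, LinearMap.lTensor_id]
    rfl
  mul_smul a c x := by
    change LinearMap.lTensor V (LinearMap.mulRight k (c.unop * a.unop)) x =
      LinearMap.lTensor V (LinearMap.mulRight k a.unop)
        (LinearMap.lTensor V (LinearMap.mulRight k c.unop) x)
    rw [LinearMap.mulRight_mul, LinearMap.lTensor_comp]
    rfl
  smul_zero a := map_zero (LinearMap.lTensor V (LinearMap.mulRight k a.unop))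
  smul_add a := map_add (LinearMap.lTensor V (LinearMap.mulRight k a.unop))
  add_smul a c x := by
    change LinearMap.lTensor V (LinearMap.mul k A |>.flip (a.unop + c.unop)) x = _
    rw [map_add, LinearMap.lTensor_add]
    rfl
  zero_smul x := by
    change LinearMap.lTensor V (LinearMap.mul k A |>.flip 0) x = _
    rw [map_zero, LinearMap.lTensor_zero]
    rfl

lemma op_smul_tmul (a : A) (v : V) (x : A) :
    op a • tmul k A v x = tmul k A v (x * a) := rfl

variable {k A V} in
lemma induction {p : Outer k A V → Prop} (h0 : p 0) (h : ∀ v x, p (tmul k A v x))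
    (hadd : ∀ x y, p x → p y → p (x + y)) (x : Outer k A V) : p x :=
  TensorProduct.induction_on (motive := p) x h0 h hadd

lemma add_ext {k A V : Type u} [Field k] [Ring A] [Algebra k A] [AddCommGroup V] [Module k V]
    {P : Type u} [AddCommGroup P] (F G : Outer k A V →+ P)
    (h : ∀ v c, F (tmul k A v c) = G (tmul k A v c)) (x : Outer k A V) : F x = G x :=
  induction (p := fun x => F x = G x) (by rw [map_zero, map_zero]) h
    (fun x y hx hy => by rw [map_add, map_add, hx, hy]) x

variable [Module A V] [IsScalarTower k A V]

/-- The left action: `a (v ⊗ x) = (a v) ⊗ x`. -/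
instance : Module A (Outer k A V) := inferInstanceAs (Module A (V ⊗[k] A))

instance : IsScalarTower k A (Outer k A V) := inferInstanceAs (IsScalarTower k A (V ⊗[k] A))

lemma smul_tmul (a : A) (v : V) (x : A) : a • tmul k A v x = tmul k A (a • v) x := rfl

instance : SMulCommClass A Aᵐᵒᵖ (Outer k A V) where
  smul_comm a c x := by
    induction x using Outer.induction with
    | h0 => simp only [smul_zero]
    | h v x => rfl
    | hadd x y hx hy => simp only [smul_add, hx, hy]

instance [FiniteDimensional k A] [FiniteDimensional k V] : Module.Finite A (Outer k A V) :=
  haveI : Module.Finite k (Outer k A V) := inferInstanceAs (Module.Finite k (V ⊗[k] A))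
  Module.Finite.of_restrictScalars_finite k A _

end Outer

/-- The `k`-dual `A*` of `A`. -/
def DualMod : Type u := Module.Dual k A

namespace DualMod

instance : AddCommGroup (DualMod k A) := inferInstanceAs (AddCommGroup (Module.Dual k A))

instance : Module k (DualMod k A) := inferInstanceAs (Module k (Module.Dual k A))

variable {k A} in
/-- An element of `A*` as a linear form. -/
def form (φ : DualMod k A) : A →ₗ[k] k := φ

variable {k A} in
lemma ext {φ ψ : DualMod k A} (h : ∀ x, φ.form x = ψ.form x) : φ = ψ := LinearMap.ext h

/-- The left action: `(a φ)(x) = φ(x a)`. -/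
instance : Module A (DualMod k A) where
  smul a φ := LinearMap.comp φ.form (LinearMap.mulRight k a)
  one_smul φ := ext fun x => congrArg φ.form (mul_one x)
  mul_smul a c φ := ext fun x => congrArg φ.form (mul_assoc x a c).symm
  smul_zero a := LinearMap.zero_comp _
  smul_add a φ ψ := LinearMap.add_comp _ _ _
  add_smul a c φ := ext fun x => (congrArg φ.form (mul_add x a c)).trans (map_add φ.form _ _)
  zero_smul φ := ext fun x => (congrArg φ.form (mul_zero x)).trans (map_zero φ.form)

lemma smul_form (a : A) (φ : DualMod k A) (x : A) : (a • φ).form x = φ.form (x * a) := rfl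

instance : IsScalarTower k A (DualMod k A) where
  smul_assoc c a φ := ext fun x =>
    (congrArg φ.form (mul_smul_comm c x a)).trans (map_smul φ.form _ _)

instance [FiniteDimensional k A] : FiniteDimensional k (DualMod k A) :=
  inferInstanceAs (FiniteDimensional k (Module.Dual k A))

end DualMod

variable [FiniteDimensional k A]

/-- The bimodule `V ⊗_k A` for a finite dimensional left module `V`. -/
def FDBimod.outer (V : Type u) [AddCommGroup V] [Module k V] [Module A V] [IsScalarTower k A V]
    [FiniteDimensional k V] : FDBimod A where
  carrier := Outer k A V

/-- The bimodules `A`, `A ⊗_k A` and `A* ⊗_k A`. -/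
def IsGenerator : ObjectProperty (FDBimod A) := fun X =>
  X = FDBimod.regular A ∨ X = FDBimod.outer k A A ∨ X = FDBimod.outer k A (DualMod k A)

/-- The bimodules in `add(A ⊕ (A ⊗_k A) ⊕ (A* ⊗_k A))`. -/
def addBimod : ObjectProperty (FDBimod A) := addClosure (IsGenerator k A)

end Generators

section Isos

open MulOpposite (op)
open FDBimod (Hom.lin Hom.lin_op homMk)

variable {A : Type u} [Ring A]

/-- `A ⊗_A M ≅ M`. -/
def regularTensorEquiv (M : Type u) [AddCommGroup M] [Module A M] :
    BTensor (FDBimod.regular A) M ≃ₗ[A] M :=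
  LinearEquiv.ofLinearMap
    (BTensor.lift (B := FDBimod.regular A) (fun (a : A) m => a • m)
      (fun a b m => add_smul (R := A) a b m) (fun a m m' => smul_add (M := A) a m m')
      (fun a b m => mul_smul (α := A) a b m) (fun a b m => mul_smul (α := A) b a m))
    { toFun := fun m => BTensor.tmul (B := FDBimod.regular A) (1 : A) m
      map_add' := fun m m' => BTensor.tmul_add _ _ _
      map_smul' := fun a m => by
        refine (BTensor.op_tmul (B := FDBimod.regular A) a (1 : A) m).symm.trans ?_
        refine Eq.trans ?_ (BTensor.smul_tmul (B := FDBimod.regular A) a (1 : A) m)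
        exact congrArg (fun x : A => BTensor.tmul (B := FDBimod.regular A) x m)
          ((one_mul a).trans (mul_one a).symm) }
    (LinearMap.ext fun m => one_smul A m)
    (BTensor.lin_ext fun (a : A) m => by
      refine (BTensor.op_tmul (B := FDBimod.regular A) a (1 : A) m).symm.trans ?_
      exact congrArg (fun x : A => BTensor.tmul (B := FDBimod.regular A) x m) (one_mul a))

/-- Tensoring with the regular bimodule is isomorphic to the identity functor. -/
def tensorFunctorRegular : tensorFunctor (FDBimod.regular A) ≅ 𝟭 (FGModuleCat.{u} A) :=
  NatIso.ofComponents
    (fun M => LinearEquiv.toFGModuleCatIso (V := BTensor (FDBimod.regular A) M) (W := M)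
      (regularTensorEquiv (A := A) M))
    (fun {M _} g => FGModuleCat.hom_ext (BTensor.lin_ext (M := M) (fun (a : A) m =>
      (g.hom.hom.map_smul a m).symm)))

/-- The homomorphism `b ↦ b ⊗ m` of left modules. -/
def tmulRight (B : FDBimod A) {M : Type u} [AddCommGroup M] [Module A M] (m : M) :
    B.carrier →ₗ[A] BTensor B M where
  toFun b := BTensor.tmul b m
  map_add' b b' := BTensor.add_tmul b b' m
  map_smul' a b := BTensor.smul_tmul a b m

/-- `(B ⊗_A B') ⊗_A M → B ⊗_A (B' ⊗_A M)`. -/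
def assocHom (B B' : FDBimod A) (M : Type u) [AddCommGroup M] [Module A M] :
    BTensor (B.tensor B') M →ₗ[A] BTensor B (BTensor B' M) :=
  BTensor.lift (B := B.tensor B') (fun x m => BTensor.map (𝟙 B) (tmulRight B' m) x)
    (fun x x' m => map_add (BTensor.map (𝟙 B) (tmulRight B' m)) x x')
    (fun x m m' => by
      have h : tmulRight B' (m + m') = tmulRight B' m + tmulRight B' m' :=
        LinearMap.ext fun b => BTensor.tmul_add b m m'
      rw [h, BTensor.map_add_right]
      rfl)
    (fun a x m => map_smul (BTensor.map (𝟙 B) (tmulRight B' m)) a x)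
    (fun a x m => LinearMap.congr_fun
      (f := (BTensor.map (𝟙 B) (tmulRight B' m)).comp (BTensor.rightMul B B' a))
      (g := BTensor.map (𝟙 B) (tmulRight B' (a • m)))
      (BTensor.lin_ext fun b b' => congrArg (BTensor.tmul b) (BTensor.op_tmul a b' m)) x)

/-- The map `B' ⊗_A M → (B ⊗_A B') ⊗_A M` sending `b' ⊗ m` to `(b ⊗ b') ⊗ m`. -/
def assocInvAux (B B' : FDBimod A) (M : Type u) [AddCommGroup M] [Module A M] (b : B.carrier) :
    BTensor B' M →+ BTensor (B.tensor B') M :=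
  BTensor.liftAdd (fun b' m => BTensor.tmul (B := B.tensor B') (BTensor.tmul b b') m)
    (fun b' b'' m => (congrArg (fun x => BTensor.tmul (B := B.tensor B') x m)
      (BTensor.tmul_add b b' b'')).trans (BTensor.add_tmul (B := B.tensor B') _ _ m))
    (fun b' m m' => BTensor.tmul_add _ m m')
    (fun a b' m => BTensor.op_tmul (B := B.tensor B') a (BTensor.tmul b b') m)

/-- `B ⊗_A (B' ⊗_A M) → (B ⊗_A B') ⊗_A M`. -/
def assocInv (B B' : FDBimod A) (M : Type u) [AddCommGroup M] [Module A M] :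
    BTensor B (BTensor B' M) →ₗ[A] BTensor (B.tensor B') M :=
  BTensor.lift (fun b y => assocInvAux B B' M b y)
    (fun b c y => BTensor.add_ext (f := assocInvAux B B' M (b + c))
      (g := assocInvAux B B' M b + assocInvAux B B' M c)
      (fun b' m => (congrArg (fun x => BTensor.tmul (B := B.tensor B') x m)
        (BTensor.add_tmul b c b')).trans (BTensor.add_tmul (B := B.tensor B') _ _ m)) y)
    (fun b y y' => map_add _ y y')
    (fun a b y => BTensor.add_ext (f := assocInvAux B B' M (a • b))
      (g := (DistribSMul.toAddMonoidHom _ a).comp (assocInvAux B B' M b))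
      (fun b' m => rfl) y)
    (fun a b y => BTensor.add_ext (f := assocInvAux B B' M (op a • b))
      (g := (assocInvAux B B' M b).comp (DistribSMul.toAddMonoidHom _ a))
      (fun b' m => congrArg (fun x => BTensor.tmul (B := B.tensor B') x m)
        (BTensor.op_tmul a b b')) y)

lemma assocInv_assocHom (B B' : FDBimod A) (M : Type u) [AddCommGroup M] [Module A M] :
    (assocInv B B' M).comp (assocHom B B' M) = LinearMap.id :=
  BTensor.lin_ext fun x m => BTensor.add_ext
    (f := ((assocInv B B' M).comp (BTensor.map (𝟙 B) (tmulRight B' m))).toAddMonoidHom)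
    (g := (tmulRight (B.tensor B') m).toAddMonoidHom) (fun b b' => rfl) x

lemma assocHom_assocInv (B B' : FDBimod A) (M : Type u) [AddCommGroup M] [Module A M] :
    (assocHom B B' M).comp (assocInv B B' M) = LinearMap.id :=
  BTensor.lin_ext fun b y => BTensor.add_ext
    (f := (assocHom B B' M).toAddMonoidHom.comp (assocInvAux B B' M b))
    (g := AddMonoidHom.mk' (fun y => BTensor.tmul b y) (BTensor.tmul_add b))
    (fun b' m => rfl) y

/-- `(B ⊗_A B') ⊗_A -` is the composition of `B' ⊗_A -` and `B ⊗_A -`. -/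
def tensorFunctorTensor (B B' : FDBimod A) :
    tensorFunctor (B.tensor B') ≅ tensorFunctor B' ⋙ tensorFunctor B :=
  NatIso.ofComponents
    (fun M => show FGModuleCat.of A (BTensor (B.tensor B') M) ≅
        FGModuleCat.of A (BTensor B (BTensor B' M)) from
      LinearEquiv.toFGModuleCatIso
        (LinearEquiv.ofLinearMap (assocHom B B' M) (assocInv B B' M)
          (assocHom_assocInv B B' M) (assocInv_assocHom B B' M)))
    (fun {M N} g => FGModuleCat.hom_ext (BTensor.lin_ext (M := M) (fun x m =>
      BTensor.add_ext (f := ((assocHom B B' N).comp ((BTensor.map (𝟙 (B.tensor B')) g.hom.hom).comp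
          (tmulRight (B.tensor B') m))).toAddMonoidHom)
        (g := ((BTensor.map (𝟙 B) (BTensor.map (𝟙 B') g.hom.hom)).comp ((assocHom B B' M).comp
          (tmulRight (B.tensor B') m))).toAddMonoidHom) (fun b b' => rfl) x)))

/-- Bimodule morphisms induce natural transformations of the tensor functors; evaluated at a
module, this is functorial. -/
@[simps] def tensorEval (M : FGModuleCat.{u} A) : FDBimod A ⥤ FGModuleCat.{u} A where
  obj B := (tensorFunctor B).obj M
  map f := FGModuleCat.ofHom (BTensor.map f LinearMap.id)
  map_id B := FGModuleCat.hom_ext BTensor.map_id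
  map_comp f g := FGModuleCat.hom_ext (BTensor.map_comp f g LinearMap.id LinearMap.id)

instance (M : FGModuleCat.{u} A) : (tensorEval M).Additive where
  map_add {_ _ f g} := FGModuleCat.hom_ext (BTensor.map_add_left f g LinearMap.id)

/-- `B ↦ B ⊗_A B'` as a functor on bimodules. -/
@[simps] def tensorOnRight (B' : FDBimod A) : FDBimod A ⥤ FDBimod A where
  obj B := B.tensor B'
  map {B C} f := homMk (B := B.tensor B') (B' := C.tensor B') (BTensor.map f LinearMap.id)
    (fun a x => BTensor.add_ext
      (f := ((BTensor.map f LinearMap.id).comp (BTensor.rightMul B B' a)).toAddMonoidHom)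
      (g := ((BTensor.rightMul C B' a).comp (BTensor.map f LinearMap.id)).toAddMonoidHom)
      (fun b b' => rfl) x)
  map_id B := Subtype.ext BTensor.map_id
  map_comp f g := Subtype.ext (BTensor.map_comp f g LinearMap.id LinearMap.id)

instance (B' : FDBimod A) : (tensorOnRight B').Additive where
  map_add {_ _ f g} := Subtype.ext (BTensor.map_add_left f g LinearMap.id)

/-- `B' ↦ B ⊗_A B'` as a functor on bimodules. -/
@[simps] def tensorOnLeft (B : FDBimod A) : FDBimod A ⥤ FDBimod A where
  obj B' := B.tensor B'
  map {B' C} f := homMk (B := B.tensor B') (B' := B.tensor C) (BTensor.map (𝟙 B) (Hom.lin f))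
    (fun a x => BTensor.add_ext
      (f := ((BTensor.map (𝟙 B) (Hom.lin f)).comp (BTensor.rightMul B B' a)).toAddMonoidHom)
      (g := ((BTensor.rightMul B C a).comp (BTensor.map (𝟙 B) (Hom.lin f))).toAddMonoidHom)
      (fun b b' => congrArg (BTensor.tmul b) (Hom.lin_op f a b')) x)
  map_id B' := Subtype.ext BTensor.map_id
  map_comp f g := Subtype.ext (BTensor.map_comp (𝟙 B) (𝟙 B) (Hom.lin f) (Hom.lin g))

instance (B : FDBimod A) : (tensorOnLeft B).Additive where
  map_add {_ _ f g} := Subtype.ext (BTensor.map_add_right (𝟙 B) (Hom.lin f) (Hom.lin g))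

end Isos

section OuterTensor

open MulOpposite (op)
open FDBimod (Hom.lin Hom.lin_op homMk)

variable (k : Type u) [Field k] (A : Type u) [Ring A] [Algebra k A] [FiniteDimensional k A]
  (V : Type u) [AddCommGroup V] [Module k V] [Module A V] [IsScalarTower k A V]
  [FiniteDimensional k V]
  (M : Type u) [AddCommGroup M] [Module k M] [Module A M] [IsScalarTower k A M]

/-- `(V ⊗_k A) ⊗_A M → V ⊗_k M → V ⊗_k N` for a linear map `g : M → N`. -/
def outerAlpha {N : Type u} [AddCommGroup N] [Module k N] (g : M →ₗ[k] N) :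
    BTensor (FDBimod.outer k A V) M →ₗ[A] V ⊗[k] N :=
  BTensor.lift (B := FDBimod.outer k A V)
    (fun x m => TensorProduct.AlgebraTensorModule.lTensor A V
      (g ∘ₗ (Algebra.lsmul k k M : A →ₐ[k] _).toLinearMap.flip m) x)
    (fun x y m => map_add (TensorProduct.AlgebraTensorModule.lTensor A V
      (g ∘ₗ (Algebra.lsmul k k M : A →ₐ[k] _).toLinearMap.flip m)) x y)
    (fun x m m' => by
      rw [map_add, LinearMap.comp_add, map_add]
      rfl)
    (fun a x m => map_smul (TensorProduct.AlgebraTensorModule.lTensor A V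
      (g ∘ₗ (Algebra.lsmul k k M : A →ₐ[k] _).toLinearMap.flip m)) a x)
    (fun a x m => Outer.add_ext
      (F := (TensorProduct.AlgebraTensorModule.lTensor A V
        (g ∘ₗ (Algebra.lsmul k k M : A →ₐ[k] _).toLinearMap.flip m)).toAddMonoidHom.comp
          (DistribSMul.toAddMonoidHom (Outer k A V) (op a)))
      (G := (TensorProduct.AlgebraTensorModule.lTensor A V
        (g ∘ₗ (Algebra.lsmul k k M : A →ₐ[k] _).toLinearMap.flip (a • m))).toAddMonoidHom)
      (fun v c => congrArg (fun y => v ⊗ₜ[k] g y) (mul_smul c a m)) x)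

/-- `V ⊗_k N → V ⊗_k M → (V ⊗_k A) ⊗_A M` for a linear map `h : N → M`. -/
def outerBeta {N : Type u} [AddCommGroup N] [Module k N] (h : N →ₗ[k] M) :
    V ⊗[k] N →ₗ[A] BTensor (FDBimod.outer k A V) M where
  toFun := TensorProduct.liftAddHom
    (AddMonoidHom.mk' (fun v => AddMonoidHom.mk'
        (fun n => (BTensor.tmul (B := FDBimod.outer k A V) (Outer.tmul k A v 1) (h n) :
          BTensor (FDBimod.outer k A V) M))
        (fun n n' => by rw [map_add]; exact BTensor.tmul_add _ _ _))
      (fun v v' => AddMonoidHom.ext fun n =>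
        (congrArg (fun x => BTensor.tmul (B := FDBimod.outer k A V) x (h n))
          (TensorProduct.add_tmul v v' (1 : A))).trans
          (BTensor.add_tmul (B := FDBimod.outer k A V) _ _ _)))
    (fun c v n => by
      refine Eq.trans ?_ ((BTensor.op_tmul (B := FDBimod.outer k A V) (algebraMap k A c)
        (Outer.tmul k A v 1) (h n)).trans ?_)
      · refine congrArg (fun x => BTensor.tmul (B := FDBimod.outer k A V) x (h n)) ?_
        change (c • v) ⊗ₜ[k] (1 : A) = v ⊗ₜ[k] (1 * algebraMap k A c)
        rw [one_mul, TensorProduct.smul_tmul, Algebra.algebraMap_eq_smul_one]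
      · refine congrArg (BTensor.tmul (B := FDBimod.outer k A V) (Outer.tmul k A v 1)) ?_
        rw [algebraMap_smul, map_smul])
  map_add' := map_add _
  map_smul' a x := by
    induction x using TensorProduct.induction_on with
    | zero => rw [smul_zero]; exact (map_zero _).trans ((congrArg _ (map_zero _)).trans
        (smul_zero _)).symm
    | tmul v n => rfl
    | add x y hx hy =>
      rw [smul_add, map_add, hx, hy, map_add, smul_add]

lemma outer_sum {N : Type u} [AddCommGroup N] [Module k N] {ι : Type*} [Fintype ι]
    (g : ι → (M →ₗ[k] N)) (h : ι → (N →ₗ[k] M)) (hgh : ∀ m, ∑ t, h t (g t m) = m)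
    (x : BTensor (FDBimod.outer k A V) M) :
    ∑ t, outerBeta k A V M (h t) (outerAlpha k A V M (g t) x) = x := by
  induction x using BTensor.induction with
  | hadd x y hx hy => simp only [map_add, Finset.sum_add_distrib, hx, hy]
  | h x m =>
    induction x using Outer.induction with
    | h0 =>
      have : (BTensor.tmul (B := FDBimod.outer k A V) 0 m : BTensor _ M) = 0 :=
        map_zero (tmulRight (FDBimod.outer k A V) m)
      refine Eq.trans ?_ this.symm
      refine Finset.sum_eq_zero fun t _ => ?_
      exact (congrArg (fun y => outerBeta k A V M (h t) (outerAlpha k A V M (g t) y)) this).trans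
        (by rw [map_zero, map_zero])
    | h v c =>
      have h1 : ∀ t, outerBeta k A V M (h t) (outerAlpha k A V M (g t)
          (BTensor.tmul (B := FDBimod.outer k A V) (Outer.tmul k A v c) m)) =
          BTensor.tmul (B := FDBimod.outer k A V) (Outer.tmul k A v 1) (h t (g t (c • m))) :=
        fun t => rfl
      simp only [h1]
      let φ : M →+ BTensor (FDBimod.outer k A V) M :=
        AddMonoidHom.mk' (fun m => BTensor.tmul (B := FDBimod.outer k A V) (Outer.tmul k A v 1) m)
          (BTensor.tmul_add _)
      refine (map_sum φ (fun t => h t (g t (c • m))) Finset.univ).symm.trans ?_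
      rw [hgh]
      refine (BTensor.op_tmul (B := FDBimod.outer k A V) c (Outer.tmul k A v 1) m).symm.trans ?_
      refine congrArg (fun x => BTensor.tmul (B := FDBimod.outer k A V) x m) ?_
      exact congrArg (fun y => v ⊗ₜ[k] y) (one_mul c)
    | hadd x y hx hy =>
      have := BTensor.add_tmul (B := FDBimod.outer k A V) x y m
      refine Eq.trans ?_ this.symm
      refine Eq.trans ?_ (congrArg₂ (· + ·) hx hy)
      rw [← Finset.sum_add_distrib]
      refine Finset.sum_congr rfl fun t _ => ?_
      exact (congrArg (fun y => outerBeta k A V M (h t) (outerAlpha k A V M (g t) y)) this).trans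
        (by rw [map_add, map_add])

end OuterTensor

section Closure

open MulOpposite (op)
open FDBimod (Hom.lin Hom.lin_op homMk)

variable (k : Type u) [Field k] (A : Type u) [Ring A] [Algebra k A] [FiniteDimensional k A]

lemma FGModuleCat.hom_sum {X Y : FGModuleCat.{u} A} {ι : Type*} (s : Finset ι)
    (f : ι → (X ⟶ Y)) (x : X) : (∑ t ∈ s, f t).hom.hom x = ∑ t ∈ s, (f t).hom.hom x :=
  map_sum (AddMonoidHom.mk' (fun f : X ⟶ Y => f.hom.hom x) (fun _ _ => rfl)) f s

/-- `(V ⊗_k A) ⊗_A M` is a direct sum of copies of `V`. -/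
lemma outer_module (V : Type u) [AddCommGroup V] [Module k V] [Module A V]
    [IsScalarTower k A V] [FiniteDimensional k V] [Module.Finite A V] (M : FGModuleCat.{u} A) :
    addClosure (fun X => X = FGModuleCat.of A V)
      ((tensorFunctor (FDBimod.outer k A V)).obj M) := by
  let : Module k M := Module.compHom M (algebraMap k A)
  have : IsScalarTower k A M := IsScalarTower.of_algebraMap_smul fun _ _ => rfl
  have : FiniteDimensional k M := Module.Finite.trans A M
  let b := Module.finBasis k M
  let e := TensorProduct.AlgebraTensorModule.rid k A V
  refine ⟨_, fun _ => FGModuleCat.of A V, fun _ => rfl,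
    fun t => FGModuleCat.ofHom (e.toLinearMap ∘ₗ outerAlpha k A V M (b.coord t)),
    fun t => FGModuleCat.ofHom
      (outerBeta k A V M (LinearMap.toSpanSingleton k M (b t)) ∘ₗ e.symm.toLinearMap), ?_⟩
  refine FGModuleCat.hom_ext (LinearMap.ext fun x => (FGModuleCat.hom_sum A _ _ x).trans ?_)
  refine Eq.trans (Finset.sum_congr rfl fun t _ => ?_)
    (outer_sum k A V M b.coord (fun t => LinearMap.toSpanSingleton k M (b t))
      (fun m => b.sum_repr m) x)
  exact congrArg (outerBeta k A V M _) (e.symm_apply_apply _)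

/-- `(V ⊗_k A) ⊗_A (W ⊗_k A)` is a direct sum of copies of `V ⊗_k A`. -/
lemma outer_outer (V W : Type u) [AddCommGroup V] [Module k V] [Module A V]
    [IsScalarTower k A V] [FiniteDimensional k V] [AddCommGroup W] [Module k W] [Module A W]
    [IsScalarTower k A W] [FiniteDimensional k W] :
    addClosure (fun X => X = FDBimod.outer k A V)
      ((FDBimod.outer k A V).tensor (FDBimod.outer k A W)) := by
  let b := Module.finBasis k W
  let g : Fin _ → (Outer k A W →ₗ[k] A) := fun t =>
    (TensorProduct.lid k A).toLinearMap ∘ₗ LinearMap.rTensor A (b.coord t)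
  let h : Fin _ → (A →ₗ[k] Outer k A W) := fun t => TensorProduct.mk k W A (b t)
  have hgh : ∀ m, ∑ t, h t (g t m) = m := by
    intro m
    induction m using Outer.induction with
    | h0 => simp only [map_zero, Finset.sum_const_zero]
    | hadd x y hx hy => simp only [map_add, Finset.sum_add_distrib, hx, hy]
    | h w d =>
      have : ∀ t, h t (g t (Outer.tmul k A w d)) = (b.coord t w • b t) ⊗ₜ[k] d := by
        intro t
        exact (TensorProduct.smul_tmul _ _ _).symm
      simp only [this]
      refine (TensorProduct.sum_tmul _ _ _).symm.trans ?_
      exact congrArg (fun w => w ⊗ₜ[k] d) (b.sum_repr w)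
  refine ⟨_, fun _ => FDBimod.outer k A V, fun _ => rfl,
    fun t => homMk (B := (FDBimod.outer k A V).tensor (FDBimod.outer k A W))
      (B' := FDBimod.outer k A V) (outerAlpha k A V (Outer k A W) (g t)) ?_,
    fun t => homMk (B := FDBimod.outer k A V)
      (B' := (FDBimod.outer k A V).tensor (FDBimod.outer k A W))
      (outerBeta k A V (Outer k A W) (h t)) ?_, ?_⟩
  · intro a x
    refine BTensor.add_ext
      (f := (outerAlpha k A V (Outer k A W) (g t)).toAddMonoidHom.comp
        (BTensor.rightMul (FDBimod.outer k A V) (FDBimod.outer k A W) a).toAddMonoidHom)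
      (g := (DistribSMul.toAddMonoidHom (Outer k A V) (op a)).comp
        (outerAlpha k A V (Outer k A W) (g t)).toAddMonoidHom) (fun x m => ?_) x
    refine Outer.add_ext
      (F := ((outerAlpha k A V (Outer k A W) (g t)).comp
        (tmulRight (FDBimod.outer k A V) (M := Outer k A W) (op a • m))).toAddMonoidHom)
      (G := (DistribSMul.toAddMonoidHom (Outer k A V) (op a)).comp
        ((outerAlpha k A V (Outer k A W) (g t)).comp
          (tmulRight (FDBimod.outer k A V) (M := Outer k A W) m)).toAddMonoidHom)
      (fun v c => ?_) x
    have hg : ∀ m, g t (op a • m) = g t m * a := Outer.add_ext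
      (F := (g t).toAddMonoidHom.comp (DistribSMul.toAddMonoidHom (Outer k A W) (op a)))
      (G := (AddMonoidHom.mulRight a).comp (g t).toAddMonoidHom)
      (fun w d => (smul_mul_assoc (b.coord t w) d a).symm)
    have h1 : g t (c • op a • m) = g t (c • m) * a :=
      (congrArg (g t) (smul_comm c (op a) (m : Outer k A W))).trans (hg (c • m))
    exact congrArg (fun y => v ⊗ₜ[k] y) h1
  · intro a x
    exact Outer.add_ext
      (F := (outerBeta k A V (Outer k A W) (h t)).toAddMonoidHom.comp
        (DistribSMul.toAddMonoidHom (Outer k A V) (op a)))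
      (G := (BTensor.rightMul (FDBimod.outer k A V) (FDBimod.outer k A W) a).toAddMonoidHom.comp
        (outerBeta k A V (Outer k A W) (h t)).toAddMonoidHom) (fun v d => rfl) x
  · refine FDBimod.hom_ext fun x => (FDBimod.lin_sum _ _ x).trans ?_
    exact outer_sum k A V (Outer k A W) g h hgh x

end Closure

section ClosedUnderTensor

open MulOpposite (op)
open FDBimod (Hom.lin Hom.lin_op homMk)

variable (k : Type u) [Field k] (A : Type u) [Ring A] [Algebra k A] [FiniteDimensional k A]

lemma addClosure_mono {C : Type*} [Category C] [Preadditive C] {P Q : ObjectProperty C}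
    (h : ∀ X, P X → Q X) {X : C} (hX : addClosure P X) : addClosure Q X := by
  obtain ⟨n, Y, hY, a, b, hab⟩ := hX
  exact ⟨n, Y, fun t => h _ (hY t), a, b, hab⟩

lemma addBimod_of {X : FDBimod A} (h : IsGenerator k A X) : addBimod k A X := addClosure_of h

lemma addBimod_regular : addBimod k A (FDBimod.regular A) := addBimod_of k A (Or.inl rfl)

lemma addBimod_regular_tensor {B : FDBimod A} (hB : addBimod k A B) :
    addBimod k A ((FDBimod.regular A).tensor B) := by
  refine addClosure_retract hB
    (homMk (B := (FDBimod.regular A).tensor B) (B' := B)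
      (regularTensorEquiv (A := A) B.carrier).toLinearMap ?_)
    (homMk (B := B) (B' := (FDBimod.regular A).tensor B)
      (regularTensorEquiv (A := A) B.carrier).symm.toLinearMap ?_) ?_
  · intro a x
    exact BTensor.add_ext
      (f := (regularTensorEquiv (A := A) B.carrier).toLinearMap.toAddMonoidHom.comp
        (BTensor.rightMul (FDBimod.regular A) B a).toAddMonoidHom)
      (g := (DistribSMul.toAddMonoidHom B.carrier (op a)).comp
        (regularTensorEquiv (A := A) B.carrier).toLinearMap.toAddMonoidHom)
      (fun (c : A) b => smul_comm c (op a) b) x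
  · intro a x
    rfl
  · exact FDBimod.hom_ext fun x => (regularTensorEquiv (A := A) B.carrier).symm_apply_apply x

/-- `B ⊗_A A → B`. -/
def tensorRegularHom (B : FDBimod A) : BTensor B (FDBimod.regular A).carrier →ₗ[A] B.carrier :=
  BTensor.lift (M := (FDBimod.regular A).carrier) (fun b (a : A) => (op a : Aᵐᵒᵖ) • b)
    (fun b b' (a : A) => smul_add (op a) b b')
    (fun b (a a' : A) => add_smul (op a) (op a') b)
    (fun c b (a : A) => (smul_comm c (op a) b).symm)
    (fun c b (a : A) => (mul_smul (op a) (op c) b).symm)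

lemma addBimod_tensor_regular {B : FDBimod A} (hB : addBimod k A B) :
    addBimod k A (B.tensor (FDBimod.regular A)) := by
  refine addClosure_retract hB
    (homMk (B := B.tensor (FDBimod.regular A)) (B' := B) (tensorRegularHom A B) ?_)
    (homMk (B := B) (B' := B.tensor (FDBimod.regular A))
      (tmulRight B (M := (FDBimod.regular A).carrier) (1 : A)) ?_) ?_
  · intro a x
    exact BTensor.add_ext
      (f := (tensorRegularHom A B).toAddMonoidHom.comp
        (BTensor.rightMul B (FDBimod.regular A) a).toAddMonoidHom)
      (g := (DistribSMul.toAddMonoidHom B.carrier (op a)).comp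
        (tensorRegularHom A B).toAddMonoidHom)
      (fun b (c : A) => mul_smul (op a) (op c) b) x
  · intro a x
    refine (BTensor.op_tmul (M := (FDBimod.regular A).carrier) a x (1 : A)).trans ?_
    exact congrArg (fun y : A => BTensor.tmul (M := (FDBimod.regular A).carrier) x y)
      ((mul_one a).trans (one_mul a).symm)
  · refine FDBimod.hom_ext fun x => BTensor.add_ext
      (f := ((tmulRight B (M := (FDBimod.regular A).carrier) (1 : A)).comp
        (tensorRegularHom A B)).toAddMonoidHom) (g := AddMonoidHom.id _) (fun b (a : A) => ?_) x
    refine (BTensor.op_tmul (M := (FDBimod.regular A).carrier) a b (1 : A)).trans ?_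
    exact congrArg (fun y : A => BTensor.tmul (M := (FDBimod.regular A).carrier) b y) (mul_one a)

/-- `add(A ⊕ (A ⊗_k A) ⊕ (A* ⊗_k A))` is closed under tensor products. -/
lemma addBimod_tensor {B B' : FDBimod A} (hB : addBimod k A B) (hB' : addBimod k A B') :
    addBimod k A (B.tensor B') := by
  have key : ∀ (V : Type u) [AddCommGroup V] [Module k V] [Module A V] [IsScalarTower k A V]
      [FiniteDimensional k V], IsGenerator k A (FDBimod.outer k A V) →
      addBimod k A ((FDBimod.outer k A V).tensor B') := by
    intro V _ _ _ _ _ hV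
    refine addClosure_map (tensorOnLeft (FDBimod.outer k A V)) (fun Y hY => ?_) hB'
    rcases hY with rfl | rfl | rfl
    · exact addBimod_tensor_regular k A (addBimod_of k A hV)
    · exact addClosure_mono (fun X hX => hX ▸ hV) (outer_outer k A V A)
    · exact addClosure_mono (fun X hX => hX ▸ hV) (outer_outer k A V (DualMod k A))
  refine addClosure_map (tensorOnRight B') (fun X hX => ?_) hB
  rcases hX with rfl | rfl | rfl
  · exact addBimod_regular_tensor k A hB'
  · exact key A (Or.inr (Or.inl rfl))
  · exact key (DualMod k A) (Or.inr (Or.inr rfl))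

/-- `k` acts centrally on every bimodule in `add(A ⊕ (A ⊗_k A) ⊕ (A* ⊗_k A))`. -/
lemma addBimod_central {B : FDBimod A} (hB : addBimod k A B) (c : k) (x : B.carrier) :
    op (algebraMap k A c) • x = algebraMap k A c • x := by
  obtain ⟨n, Y, hY, a, b, hab⟩ := hB
  have h1 : ∀ x : B.carrier, x = ∑ t, Hom.lin (b t) (Hom.lin (a t) x) := by
    intro x
    have := FDBimod.lin_sum Finset.univ (fun t => a t ≫ b t) x
    rw [hab] at this
    exact this
  have hout : ∀ (V : Type u) [AddCommGroup V] [Module k V] [Module A V] [IsScalarTower k A V]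
      (y : Outer k A V), op (algebraMap k A c) • y = algebraMap k A c • y := by
    intro V _ _ _ _ y
    refine Outer.add_ext (F := DistribSMul.toAddMonoidHom (Outer k A V) (op (algebraMap k A c)))
      (G := DistribSMul.toAddMonoidHom (Outer k A V) (algebraMap k A c)) (fun v d => ?_) y
    change v ⊗ₜ[k] (d * algebraMap k A c) = (algebraMap k A c • v) ⊗ₜ[k] d
    rw [algebraMap_smul, TensorProduct.smul_tmul, Algebra.smul_def, Algebra.commutes]
  have h2 : ∀ Z, IsGenerator k A Z → ∀ y : Z.carrier,
      op (algebraMap k A c) • y = algebraMap k A c • y := by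
    rintro Z (rfl | rfl | rfl)
    · exact fun (y : A) => (Algebra.commutes c y).symm
    · exact hout A
    · exact hout (DualMod k A)
  rw [h1 (op (algebraMap k A c) • x), h1 (algebraMap k A c • x)]
  refine Finset.sum_congr rfl fun t _ => ?_
  rw [Hom.lin_op, h2 _ (hY t), map_smul, map_smul, map_smul]

end ClosedUnderTensor

/-! ## The 2-category `D_A` -/

section DA

variable (k : Type u) [Field k] {A : Type u} [Ring A] [Algebra k A] [FiniteDimensional k A]
  {C : Type w} [SmallCategory C] [Preadditive C] [Linear k C] (E : C ≌ FGModuleCat.{u} A)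

/-- The endofunctors of `C ≃ A-mod` which are isomorphic to tensoring with a bimodule in
`add(A ⊕ (A ⊗_k A) ⊕ (A* ⊗_k A))`. -/
def IsDFunctor : ObjectProperty (C ⥤ C) := fun G =>
  ∃ B : FDBimod A, addBimod k A B ∧ Nonempty (G ⋙ E.functor ≅ E.functor ⋙ tensorFunctor B)

lemma isDFunctor_id : IsDFunctor k E (𝟭 C) :=
  ⟨FDBimod.regular A, addBimod_regular k A,
    ⟨E.functor.leftUnitor ≪≫ E.functor.rightUnitor.symm ≪≫
      Functor.isoWhiskerLeft E.functor tensorFunctorRegular.symm⟩⟩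

lemma isDFunctor_comp {F G : C ⥤ C} (hF : IsDFunctor k E F) (hG : IsDFunctor k E G) :
    IsDFunctor k E (F ⋙ G) := by
  obtain ⟨B, hB, ⟨e⟩⟩ := hF
  obtain ⟨B', hB', ⟨e'⟩⟩ := hG
  exact ⟨B'.tensor B, addBimod_tensor k A hB' hB,
    ⟨Functor.associator _ _ _ ≪≫ Functor.isoWhiskerLeft F e' ≪≫ (Functor.associator _ _ _).symm ≪≫
      Functor.isoWhiskerRight e (tensorFunctor B') ≪≫ Functor.associator _ _ _ ≪≫
      Functor.isoWhiskerLeft E.functor (tensorFunctorTensor B' B).symm⟩⟩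

instance (B : FDBimod A) : (tensorFunctor B).Additive where
  map_add {_ _ g h} := FGModuleCat.hom_ext (BTensor.map_add_right (𝟙 B) g.hom.hom h.hom.hom)

lemma tensorFunctor_linear {B : FDBimod A} (hB : addBimod k A B) :
    (tensorFunctor B).Linear k where
  map_smul {M N} g c := FGModuleCat.hom_ext (BTensor.lin_ext (fun b m => by
    change BTensor.tmul b (algebraMap k A c • g.hom.hom m) =
      algebraMap k A c • BTensor.tmul b (g.hom.hom m)
    rw [← BTensor.op_tmul, addBimod_central k A hB, BTensor.smul_tmul]))

variable {k E}

lemma IsDFunctor.additive [E.functor.Additive] {G : C ⥤ C} (hG : IsDFunctor k E G) :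
    G.Additive := by
  obtain ⟨B, hB, ⟨e⟩⟩ := hG
  have : (G ⋙ E.functor).Additive := Functor.additive_of_iso e.symm
  exact ⟨fun {X Y f g} => E.functor.map_injective (by
    rw [E.functor.map_add]
    exact (G ⋙ E.functor).map_add)⟩

lemma IsDFunctor.linear [E.functor.Additive] [E.functor.Linear k] {G : C ⥤ C}
    (hG : IsDFunctor k E G) : G.Linear k := by
  obtain ⟨B, hB, ⟨e⟩⟩ := hG
  have := tensorFunctor_linear k hB
  have : (G ⋙ E.functor).Linear k := Functor.linear_of_iso k e.symm
  exact ⟨fun {X Y} f c => E.functor.map_injective (by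
    rw [E.functor.map_smul]
    exact (G ⋙ E.functor).map_smul c f)⟩

end DA

section DTwoCat

/-- The 2-category `D_A`, with one object `star`. -/
inductive DTwoCat (k : Type u) [Field k] {A : Type u} [Ring A] [Algebra k A]
    [FiniteDimensional k A] {C : Type w} [SmallCategory C] (E : C ≌ FGModuleCat.{u} A) : Type
  | star

variable {k : Type u} [Field k] {A : Type u} [Ring A] [Algebra k A] [FiniteDimensional k A]
  {C : Type w} [SmallCategory C] [Preadditive C] [Linear k C] {E : C ≌ FGModuleCat.{u} A}

namespace DTwoCat

/-- 1-morphisms are endofunctors of `C` isomorphic to tensoring with bimodules in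
`add(A ⊕ (A ⊗_k A) ⊕ (A* ⊗_k A))`. -/
structure Hom (i j : DTwoCat k E) where
  functor : C ⥤ C
  property : IsDFunctor k E functor

/-- 2-morphisms are all natural transformations. -/
@[ext]
structure Hom₂ {i j : DTwoCat k E} (F G : Hom i j) where
  nat : F.functor ⟶ G.functor

section

variable {i j : DTwoCat k E}

instance : Category (Hom i j) where
  Hom F G := Hom₂ F G
  id F := ⟨𝟙 F.functor⟩
  comp a b := ⟨a.nat ≫ b.nat⟩

lemma hom₂_ext {F G : Hom i j} {a b : F ⟶ G}
    (h : ∀ X, a.nat.app X = b.nat.app X) : a = b :=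
  Hom₂.ext (NatTrans.ext (funext h))

/-- A natural isomorphism of functors, as an invertible 2-morphism. -/
def isoMk {F G : Hom i j} (e : F.functor ≅ G.functor) : F ≅ G where
  hom := ⟨e.hom⟩
  inv := ⟨e.inv⟩
  hom_inv_id := Hom₂.ext e.hom_inv_id
  inv_hom_id := Hom₂.ext e.inv_hom_id

/-- 2-morphisms are natural transformations. -/
def homEquiv (F G : Hom i j) : (F ⟶ G) ≃ (F.functor ⟶ G.functor) where
  toFun a := a.nat
  invFun a := ⟨a⟩

instance : Preadditive (Hom i j) where
  homGroup F G := (homEquiv F G).addCommGroup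
  add_comp _ _ _ _ _ _ := Hom₂.ext (Preadditive.add_comp _ _ _ _ _ _)
  comp_add _ _ _ _ _ _ := Hom₂.ext (Preadditive.comp_add _ _ _ _ _ _)

instance : Linear k (Hom i j) where
  homModule F G := (homEquiv F G).module k
  smul_comp _ _ _ _ _ _ := Hom₂.ext (Linear.smul_comp _ _ _ _ _ _)
  comp_smul _ _ _ _ _ _ := Hom₂.ext (Linear.comp_smul _ _ _ _ _ _)

end

/-- The identity functor. -/
def idHom (i : DTwoCat k E) : Hom i i := ⟨𝟭 C, isDFunctor_id k E⟩

/-- Composition of functors, first `F`, then `G`. -/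
def compHom {i j l : DTwoCat k E} (F : Hom i j) (G : Hom j l) : Hom i l :=
  ⟨F.functor ⋙ G.functor, isDFunctor_comp k E F.property G.property⟩

instance : CategoryStruct (DTwoCat k E) where
  Hom i j := Hom i j
  id i := idHom i
  comp F G := compHom F G

instance (i j : DTwoCat k E) : Category (i ⟶ j) := inferInstanceAs (Category (Hom i j))

instance : Bicategory (DTwoCat k E) where
  whiskerLeft {_ _ _} F {G H} a :=
    (Hom₂.mk (Functor.whiskerLeft (Hom.functor F) (Hom₂.nat a)) : Hom₂ (compHom F G) (compHom F H))
  whiskerRight {_ _ _ F G} a H :=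
    (Hom₂.mk (Functor.whiskerRight (Hom₂.nat a) (Hom.functor H)) :
      Hom₂ (compHom F H) (compHom G H))
  associator F G H := isoMk (F := compHom (compHom F G) H) (G := compHom F (compHom G H))
    (Functor.associator (Hom.functor F) (Hom.functor G) (Hom.functor H))
  leftUnitor {i _} F := isoMk (F := compHom (idHom i) F) (G := F) (Hom.functor F).leftUnitor
  rightUnitor {_ j} F := isoMk (F := compHom F (idHom j)) (G := F) (Hom.functor F).rightUnitor
  whiskerLeft_id _ _ := rfl
  whiskerLeft_comp _ _ _ _ _ _ := rfl
  id_whiskerLeft a := Hom₂.ext (NatTrans.ext (funext fun X =>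
    show (Hom₂.nat a).app _ = 𝟙 _ ≫ (Hom₂.nat a).app _ ≫ 𝟙 _ by simp))
  comp_whiskerLeft F G _ _ a := Hom₂.ext (NatTrans.ext (funext fun X =>
    show (Hom₂.nat a).app _ = 𝟙 _ ≫ (Hom₂.nat a).app _ ≫ 𝟙 _ by simp))
  id_whiskerRight _ H := Hom₂.ext (NatTrans.ext (funext fun X => (Hom.functor H).map_id _))
  comp_whiskerRight _ _ H := Hom₂.ext (NatTrans.ext (funext fun X => (Hom.functor H).map_comp _ _))
  whiskerRight_id a := Hom₂.ext (NatTrans.ext (funext fun X =>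
    show (Hom₂.nat a).app _ = 𝟙 _ ≫ (Hom₂.nat a).app _ ≫ 𝟙 _ by simp))
  whiskerRight_comp a G H := Hom₂.ext (NatTrans.ext (funext fun X =>
    show (Hom.functor H).map ((Hom.functor G).map ((Hom₂.nat a).app _)) =
      𝟙 _ ≫ (Hom.functor H).map ((Hom.functor G).map ((Hom₂.nat a).app _)) ≫ 𝟙 _ by simp))
  whisker_assoc F _ _ a H := Hom₂.ext (NatTrans.ext (funext fun X =>
    show (Hom.functor H).map ((Hom₂.nat a).app _) =
      𝟙 _ ≫ (Hom.functor H).map ((Hom₂.nat a).app _) ≫ 𝟙 _ by simp))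
  whisker_exchange a b := Hom₂.ext (NatTrans.ext (funext fun X =>
    ((Hom₂.nat b).naturality ((Hom₂.nat a).app X)).symm))
  pentagon {_ _ _ _ _} F G H K := Hom₂.ext (NatTrans.ext (funext fun X =>
    show (Hom.functor K).map (𝟙 _) ≫ 𝟙 _ ≫ 𝟙 _ = 𝟙 _ ≫ 𝟙 _ by simp))
  triangle F G := Hom₂.ext (NatTrans.ext (funext fun X =>
    show 𝟙 _ ≫ 𝟙 _ = (Hom.functor G).map (𝟙 _) by simp))

/-- `D_A` is a (strict) 2-category. -/
instance : Bicategory.Strict (DTwoCat k E) where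
  id_comp _ := rfl
  comp_id _ := rfl
  assoc _ _ _ := rfl
  leftUnitor_eqToIso _ := rfl
  rightUnitor_eqToIso _ := rfl
  associator_eqToIso _ _ _ := rfl

instance (i j : DTwoCat k E) : Preadditive (i ⟶ j) := inferInstanceAs (Preadditive (Hom i j))

instance (i j : DTwoCat k E) : Linear k (i ⟶ j) := inferInstanceAs (Linear k (Hom i j))

instance [E.functor.Additive] [E.functor.Linear k] : BilinearComp k (DTwoCat k E) where
  whiskerLeft_add _ _ _ _ _ := rfl
  whiskerLeft_smul _ _ _ _ _ := rfl
  add_whiskerRight _ _ h := Hom₂.ext (NatTrans.ext (funext fun X =>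
    have := (Hom.property h).additive
    (Hom.functor h).map_add))
  smul_whiskerRight c _ h := Hom₂.ext (NatTrans.ext (funext fun X =>
    have := (Hom.property h).linear
    (Hom.functor h).map_smul c _))

variable (k E) in
/-- The defining 2-representation of `D_A` on `C`. -/
def defining [E.functor.Additive] [E.functor.Linear k] : TwoRep.{w} k (DTwoCat k E) where
  obj _ := { carrier := C }
  map F :=
    { functor := Hom.functor F
      additive := (Hom.property F).additive
      linear := (Hom.property F).linear }
  map₂ a := ⟨Hom₂.nat a⟩
  mapId i := LinCat.isoMk (Iso.refl (𝟭 C))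
  mapComp F G := LinCat.isoMk (Iso.refl (Hom.functor F ⋙ Hom.functor G))
  map₂_id _ := rfl
  map₂_comp _ _ := rfl
  map₂_whisker_left F _ _ a := LinCat.hom₂_ext fun X =>
    show (Hom₂.nat a).app _ = 𝟙 _ ≫ (Hom₂.nat a).app _ ≫ 𝟙 _ by simp
  map₂_whisker_right a H := LinCat.hom₂_ext fun X =>
    show (Hom.functor H).map ((Hom₂.nat a).app _) =
      𝟙 _ ≫ (Hom.functor H).map ((Hom₂.nat a).app _) ≫ 𝟙 _ by simp
  map₂_associator F G H := LinCat.hom₂_ext fun X =>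
    show 𝟙 _ = 𝟙 _ ≫ (Hom.functor H).map (𝟙 _) ≫ 𝟙 _ ≫ 𝟙 _ ≫ 𝟙 _ by simp
  map₂_left_unitor F := LinCat.hom₂_ext fun X =>
    show 𝟙 _ = 𝟙 _ ≫ (Hom.functor F).map (𝟙 _) ≫ 𝟙 _ by simp
  map₂_right_unitor F := LinCat.hom₂_ext fun X =>
    show 𝟙 _ = 𝟙 _ ≫ 𝟙 _ ≫ 𝟙 _ by simp

end DTwoCat

end DTwoCat

/-! ## The natural action on projective and injective modules -/

section Natural

open MulOpposite (op)

/-- The left regular module is projective in the category of finitely generated modules. -/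
lemma projective_regular (k : Type u) [Field k] {A : Type u} [Ring A] [Algebra k A] [FiniteDimensional k A] :
     Projective (FGModuleCat.of A A) where
  factors {X Y} f e he := by
    have : IsNoetherianRing A :=
      isNoetherian_of_tower k (isNoetherian_of_isNoetherianRing_of_finite k A)
    have he' : Epi e.hom := inferInstanceAs (Epi ((forget₂ (FGModuleCat A) (ModuleCat A)).map e))
    have hs := (ModuleCat.epi_iff_surjective e.hom).1 he'
    obtain ⟨x, hx⟩ := hs (f.hom.hom (1 : A))
    refine ⟨FGModuleCat.ofHom (LinearMap.toSpanSingleton A X x), FGModuleCat.hom_ext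
      (LinearMap.ext_ring ?_)⟩
    change e.hom.hom ((1 : A) • x) = f.hom.hom (1 : A)
    rw [one_smul]
    exact hx

instance (k : Type u) [Field k] (A : Type u) [Ring A] [Algebra k A] [FiniteDimensional k A] :
    Module.Finite A (DualMod k A) :=
  Module.Finite.of_restrictScalars_finite k A _

/-- The dual of the right regular module is injective in the category of finitely generated
modules. -/
lemma injective_dual (k : Type u) [Field k] {A : Type u} [Ring A] [Algebra k A] [FiniteDimensional k A] :
     Injective (FGModuleCat.of A (DualMod k A)) where
  factors {X Y} f i hi := by
    have : IsNoetherianRing A :=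
      isNoetherian_of_tower k (isNoetherian_of_isNoetherianRing_of_finite k A)
    have hi' : Mono i.hom := inferInstanceAs (Mono ((forget₂ (FGModuleCat A) (ModuleCat A)).map i))
    have hs := (ModuleCat.mono_iff_injective i.hom).1 hi'
    let : Module k X := Module.compHom X (algebraMap k A)
    have : IsScalarTower k A X := IsScalarTower.of_algebraMap_smul fun _ _ => rfl
    let : Module k Y := Module.compHom Y (algebraMap k A)
    have : IsScalarTower k A Y := IsScalarTower.of_algebraMap_smul fun _ _ => rfl
    let ev : DualMod k A →ₗ[k] k := Module.Dual.eval k A 1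
    have hev : ∀ φ : DualMod k A, ev φ = φ.form 1 := fun _ => rfl
    let f' : X →ₗ[A] DualMod k A := f.hom.hom
    let i' : X →ₗ[A] Y := i.hom.hom
    obtain ⟨r, hr⟩ := (i'.restrictScalars k).exists_leftInverse_of_injective
      (LinearMap.ker_eq_bot.2 hs)
    let g : Y →ₗ[k] k := ev ∘ₗ (f'.restrictScalars k) ∘ₗ r
    have hg : ∀ x : X, g (i' x) = (f' x).form 1 := fun x =>
      congrArg (fun x => (f' x).form 1) (LinearMap.congr_fun hr x)
    refine ⟨FGModuleCat.ofHom
      { toFun := fun y => (g ∘ₗ (Algebra.lsmul k k Y : A →ₐ[k] _).toLinearMap.flip y : A →ₗ[k] k)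
        map_add' := fun y y' => DualMod.ext fun a =>
          (congrArg g (smul_add a y y')).trans (map_add g _ _)
        map_smul' := fun c y => DualMod.ext fun a => congrArg g (mul_smul a c y).symm }, ?_⟩
    refine FGModuleCat.hom_ext (LinearMap.ext fun x => DualMod.ext fun a => ?_)
    change g (a • i' x) = (f' x).form a
    rw [← map_smul, hg, map_smul, DualMod.smul_form, one_mul]

variable (k : Type u) [Field k] {A : Type u} [Ring A] [Algebra k A] [FiniteDimensional k A]
  {C : Type w} [SmallCategory C] [Preadditive C] (E : C ≌ FGModuleCat.{u} A)

/-- The additive closure of all projective and all injective objects. -/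
def projInj (C : Type*) [Category C] [Preadditive C] : ObjectProperty C :=
  addClosure fun X => Projective X ∨ Injective X

lemma projInj_tensor {B : FDBimod A} (hB : addBimod k A B) {M : FGModuleCat.{u} A}
    (hM : projInj _ M) : projInj _ ((tensorFunctor B).obj M) := by
  refine addClosure_map (tensorEval M) (fun X hX => ?_) hB
  rcases hX with rfl | rfl | rfl
  · exact addClosure_retract hM (tensorFunctorRegular.hom.app M) (tensorFunctorRegular.inv.app M)
      (tensorFunctorRegular.hom_inv_id_app M)
  · exact addClosure_mono (fun X hX => Or.inl (hX ▸ projective_regular k)) (outer_module k A A M)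
  · exact addClosure_mono (fun X hX => Or.inr (hX ▸ injective_dual k))
      (outer_module k A (DualMod k A) M)

lemma projInj_equivalence {C D : Type*} [Category C] [Category D] [Preadditive C] [Preadditive D]
    (E : C ≌ D) [E.functor.Additive] {X : C} (hX : projInj C X) : projInj D (E.functor.obj X) :=
  addClosure_map E.functor (fun X hX => addClosure_of (hX.imp (E.map_projective_iff X).2
    (E.map_injective_iff X).2)) hX

lemma IsDFunctor.projInj_obj [E.functor.Additive] {G : C ⥤ C} (hG : IsDFunctor k E G) {X : C}
    (hX : projInj C X) : projInj C (G.obj X) := by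
  obtain ⟨B, hB, ⟨e⟩⟩ := hG
  have h1 := projInj_tensor k hB (projInj_equivalence E hX)
  have : E.symm.functor.Additive := inferInstanceAs E.inverse.Additive
  have h2 := projInj_equivalence E.symm h1
  let u : G.obj X ⟶ E.inverse.obj (E.functor.obj (G.obj X)) := E.unit.app (G.obj X)
  let v : E.inverse.obj (E.functor.obj (G.obj X)) ⟶ G.obj X := E.unitInv.app (G.obj X)
  have h3 : E.inverse.map (e.hom.app X) ≫ E.inverse.map (e.inv.app X) = 𝟙 _ := by
    rw [← Functor.map_comp, e.hom_inv_id_app]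
    exact E.inverse.map_id _
  have h4 : u ≫ v = 𝟙 _ := E.unitIso.hom_inv_id_app _
  have h5 : (u ≫ E.inverse.map (e.hom.app X)) ≫ (E.inverse.map (e.inv.app X) ≫ v) = 𝟙 _ := by
    rw [Category.assoc, ← Category.assoc _ _ v, h3]
    exact (congrArg (u ≫ ·) (Category.id_comp v)).trans h4
  exact addClosure_retract h2 _ _ h5

/-- The natural action of `D_A` on the additive category generated by all projective and all
injective objects of `C`. -/
def natural [Linear k C] [E.functor.Additive] [E.functor.Linear k] : TwoRep.{w} k (DTwoCat k E) :=
  (DTwoCat.defining k E).sub (fun _ => projInj C)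
    (fun _ _ F _ hX => (DTwoCat.Hom.property F).projInj_obj k E hX)

end Natural

/-! ## Connected and basic algebras -/

/-- A nonzero ring is connected (indecomposable as a ring) if `0` and `1` are the only central
idempotents. -/
def IsConnectedRing (A : Type*) [Ring A] : Prop :=
  Nontrivial A ∧ ∀ e : A, IsIdempotentElem e → (∀ a : A, e * a = a * e) → e = 0 ∨ e = 1

/-- A primitive idempotent: a nonzero idempotent which is not the sum of two nonzero orthogonal
idempotents. -/
def IsPrimitiveIdempotent {A : Type*} [Ring A] (e : A) : Prop :=
  IsIdempotentElem e ∧ e ≠ 0 ∧ ∀ f g : A, IsIdempotentElem f → IsIdempotentElem g →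
    f * g = 0 → g * f = 0 → f + g = e → f = 0 ∨ g = 0

/-- An algebra is basic if, in every decomposition `1 = e₁ + ⋯ + eₙ` into pairwise orthogonal
primitive idempotents, the left modules `A eᵢ` are pairwise nonisomorphic. -/
def IsBasicRing (A : Type*) [Ring A] : Prop :=
  ∀ (n : ℕ) (e : Fin n → A), CompleteOrthogonalIdempotents e →
    (∀ t, IsPrimitiveIdempotent (e t)) →
    ∀ s t, Nonempty (Submodule.span A {e s} ≃ₗ[A] Submodule.span A {e t}) → s = t

end

/-! Up to the equivalence `E`, a 1-morphism is a functor `B ⊗_A -`, and by the Eilenberg–Watts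
argument (`tensorNat_natBimod`) its 2-morphisms are bimodule homomorphisms. Hence idempotent
2-morphisms split, and indecomposable 1-morphisms have local endomorphism rings by Fitting's lemma.
Since `A` is connected, an indecomposable 1-morphism that is not isomorphic to the identity is a
summand of some `X ⊗_k -` with `X` in the additive closure of projectives and injectives. It is then
a summand of `X ⊗_k e(-)` for a primitive idempotent `e` (`exists_cutRetract`); such 1-morphisms are
called cut by `e`. Composing with a further functor only changes `X`, because `B ⊗_A (X ⊗_k e M)` is
`(B ⊗_A X) ⊗_k e M`. So one idempotent `e` serves the whole left cell and everything above it.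

Let `T` be the simple top of `A e`. As `k` is algebraically closed, `e T` is a line, and evaluation
at `T` sends `X ⊗_k e(-)` to `X ⊗_k e T`, a copy of `X`. Evaluation commutes strictly with the
action, since the value of `F ≫ H` at `T` is `H` applied to the value of `F`. It therefore gives a
morphism of 2-representations into the natural one. It is essentially surjective because every `X`
occurs (`IsTopOf.exists_evalAt_iso`), and it is full because `X ⟶ Y` is realised by tensoring with
the identity of `e(-)` (`IsTopOf.evalAt_surjective`).

It remains to identify the kernel of evaluation with the maximal ideal (`IsTopOf.mem_maxIdeal_iff`).
A transformation `f` from `X ⊗_k -` to `Y ⊗_k -` is a matrix over `A` (`stentry`), with entries in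
the local ring `e A e` once `f` is cut on both sides. It vanishes at `T` exactly when all entries
lie in the radical. If some entry does not, it is invertible in `e A e`, and after applying `Z ⊗_k
-` the projection onto `Z ⊗_k e(-)` factors through `f`. An ideal containing `f` then contains the
identity of a member of the cell (`IsTopOf.exists_id_factorization`). Conversely, a cut idempotent
with all entries in the nilpotent radical is zero, so nonzero cut 1-morphisms do not vanish at `T`
(`IsTopOf.evalAt_ne_zero`) and the kernel of evaluation is itself a proper ideal. -/

noncomputable section

/-! ## Corner algebras of primitive idempotents -/

section Corner

variable {k : Type*} [Field k] {A : Type*} [Ring A] [Algebra k A] [FiniteDimensional k A]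

/-- Fitting's lemma: a suitable multiple of a power of `x` is an idempotent. -/
lemma exists_fitting_idempotent (k : Type*) [Field k] {A : Type*} [Ring A] [Algebra k A]
    [FiniteDimensional k A] (x : A) :
    ∃ (n : ℕ) (u : A), Commute x u ∧ IsIdempotentElem (x ^ (n + 1) * u) ∧
      x ^ (n + 1) * (x ^ (n + 1) * u) = x ^ (n + 1) := by
  have hx : IsIntegral k x := Algebra.IsIntegral.isIntegral x
  obtain ⟨q, hq, hnd⟩ := Polynomial.exists_eq_pow_rootMultiplicity_mul_and_not_dvd
    (minpoly k x) (minpoly.ne_zero hx) 0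
  set n := (minpoly k x).rootMultiplicity 0
  -- The exponent `n + 1` instead of `n` keeps a factor `x` in the idempotent even when `x` is
  -- invertible and `n = 0`. This is what later places the idempotent in a corner `e A e` containing
  -- `x`.
  have hcop : IsCoprime ((Polynomial.X - Polynomial.C (0 : k)) ^ (n + 1)) q :=
    IsCoprime.pow_left ((Polynomial.irreducible_X_sub_C (0 : k)).coprime_iff_not_dvd.2 hnd)
  obtain ⟨a, b, hab⟩ := hcop
  rw [Polynomial.C_0, sub_zero] at hab hq
  have h0 : x ^ (n + 1) * Polynomial.aeval x q = 0 := by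
    have := minpoly.aeval k x
    rw [hq, map_mul, map_pow, Polynomial.aeval_X] at this
    rw [pow_succ', mul_assoc, this, mul_zero]
  have h1 := congrArg (Polynomial.aeval x) hab
  simp only [map_add, map_mul, map_pow, Polynomial.aeval_X, map_one] at h1
  have hc : Commute x (Polynomial.aeval x a) := by
    have := Polynomial.aeval_X (R := k) x
    have h2 := congrArg (Polynomial.aeval x) (mul_comm (Polynomial.X : Polynomial k) a)
    rwa [map_mul, map_mul, this] at h2
  have hcb : Commute (x ^ (n + 1)) (Polynomial.aeval x b) := by
    have h2 := congrArg (Polynomial.aeval x) (mul_comm ((Polynomial.X : Polynomial k) ^ (n + 1)) b)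
    rwa [map_mul, map_mul, map_pow, Polynomial.aeval_X] at h2
  have h3 : x ^ (n + 1) * (x ^ (n + 1) * Polynomial.aeval x a) = x ^ (n + 1) := by
    have h4 : x ^ (n + 1) * (Polynomial.aeval x b * Polynomial.aeval x q) = 0 := by
      rw [← mul_assoc, hcb.eq, mul_assoc, h0, mul_zero]
    conv_rhs => rw [← mul_one (x ^ (n + 1)), ← h1, mul_add, h4, add_zero]
    rw [(hc.pow_left (n + 1)).eq]
  refine ⟨n, Polynomial.aeval x a, hc, ?_, h3⟩
  have h5 := (hc.pow_left (n + 1)).eq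
  rw [IsIdempotentElem]
  conv_lhs => rw [h5, mul_assoc, ← h5, h3]
  rw [h5]

/-- The elements `f` and `e - f` are orthogonal idempotents with sum `e`. -/
lemma IsPrimitiveIdempotent.eq_zero_or_eq {e f : A} (he : IsPrimitiveIdempotent e)
    (hf : IsIdempotentElem f) (h1 : e * f = f) (h2 : f * e = f) : f = 0 ∨ f = e := by
  have h := he.2.2 f (e - f) hf ?_ ?_ ?_ (add_sub_cancel f e)
  · exact h.imp id fun h => (sub_eq_zero.1 h).symm
  · rw [IsIdempotentElem, mul_sub, sub_mul, sub_mul, h1, h2, hf.eq, he.1.eq, sub_self, sub_zero]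
  · rw [mul_sub, h2, hf.eq, sub_self]
  · rw [sub_mul, h1, hf.eq, sub_self]

/-- The Fitting idempotent of `x` lies in `e A e`, so it is `0` or `e`. In the first case a power of
`x` vanishes; in the second the complementary factor of the idempotent provides an inverse. -/
lemma IsPrimitiveIdempotent.nilpotent_or_unit (k : Type*) [Field k] {A : Type*} [Ring A]
    [Algebra k A] [FiniteDimensional k A] {e : A} (he : IsPrimitiveIdempotent e) {x : A}
    (h1 : e * x = x) (h2 : x * e = x) :
    IsNilpotent x ∨ ∃ y, e * y = y ∧ x * y = e ∧ y * x = e := by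
  obtain ⟨n, u, hc, hi, hx⟩ := exists_fitting_idempotent k x
  have h3 : e * (x ^ (n + 1) * u) = x ^ (n + 1) * u := by
    rw [pow_succ', ← mul_assoc, ← mul_assoc, h1]
  have h4 : x ^ (n + 1) * u * e = x ^ (n + 1) * u := by
    rw [(hc.pow_left (n + 1)).eq, pow_succ, mul_assoc, mul_assoc, h2]
  rcases he.eq_zero_or_eq hi h3 h4 with h | h
  · left
    rw [h, mul_zero] at hx
    exact ⟨n + 1, hx.symm⟩
  · right
    refine ⟨e * (x ^ n * u), ?_, ?_, ?_⟩
    · rw [← mul_assoc, he.1.eq]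
    · rw [← mul_assoc, h2, ← mul_assoc, ← pow_succ', h]
    · rw [mul_assoc, mul_assoc, ← hc.eq, ← mul_assoc (x ^ n), ← pow_succ, h, he.1.eq]

/-- The Jacobson radical. -/
abbrev radical (A : Type*) [Ring A] : Ideal A := (⊥ : Ideal A).jacobson

/-- The corner `e A e` is local. A nilpotent `x` in it lies in the radical of the whole algebra,
because `a x` is nilpotent for every `a` and hence `1 + a x` is invertible. -/
lemma IsPrimitiveIdempotent.mem_radical_or_unit (k : Type*) [Field k] {A : Type*} [Ring A]
    [Algebra k A] [FiniteDimensional k A] {e : A} (he : IsPrimitiveIdempotent e) {x : A}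
    (h1 : e * x = x) (h2 : x * e = x) :
    x ∈ radical A ∨ ∃ y, e * y = y ∧ x * y = e ∧ y * x = e := by
  rcases he.nilpotent_or_unit k h1 h2 with ⟨N, hN⟩ | h
  swap
  · exact Or.inr h
  left
  rw [Ideal.mem_jacobson_iff]
  intro a
  -- If `x a e` were invertible in the corner, `x` would have a right inverse there, hence so would
  -- all its powers. That contradicts the nilpotency of `x`.
  have h3 : IsNilpotent (x * a * e) := by
    rcases he.nilpotent_or_unit k (x := x * a * e) (by rw [← mul_assoc, ← mul_assoc, h1])
      (by rw [mul_assoc, he.1.eq]) with h | ⟨y, hy, h, -⟩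
    · exact h
    · exfalso
      have h4 : ∀ m : ℕ, ∃ z, x ^ m * z = e := by
        intro m
        induction m with
        | zero => exact ⟨e, by simp⟩
        | succ m ih =>
          obtain ⟨z, hz⟩ := ih
          refine ⟨a * e * y * z, ?_⟩
          have : x * (a * e * y * z) = e * z := by
            rw [← mul_assoc, ← mul_assoc, ← mul_assoc, h]
          rw [pow_succ, mul_assoc, this]
          cases m with
          | zero => simpa [he.1.eq] using congrArg (e * ·) hz
          | succ m =>
            rw [pow_succ, mul_assoc, ← mul_assoc x, h2]
            rwa [pow_succ, mul_assoc] at hz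
      obtain ⟨z, hz⟩ := h4 N
      rw [hN, zero_mul] at hz
      exact he.2.1 hz.symm
  -- Since `x = e x`, regrouping gives `(a x) ^ (m + 1) = a (x a e) ^ m x`.
  have h4 : IsNilpotent (a * x) := by
    obtain ⟨m, hm⟩ := h3
    refine ⟨m + 1, ?_⟩
    have : ∀ m, (a * x) ^ (m + 1) = a * (x * a * e) ^ m * x := by
      intro m
      induction m with
      | zero => simp
      | succ m ih =>
        rw [pow_succ, ih, pow_succ]
        simp only [mul_assoc, h1]
    rw [this, hm, mul_zero, zero_mul]
  obtain ⟨v, hv⟩ := h4.isUnit_one_add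
  refine ⟨↑v⁻¹, ?_⟩
  have : (↑v⁻¹ : A) * (1 + a * x) = 1 := by rw [← hv]; exact v.inv_mul
  rw [mul_add, mul_one, ← mul_assoc] at this
  rw [add_comm, this, sub_self]
  exact Submodule.zero_mem _

/-- Left multiplication by `x` on `e A` has an eigenvalue `c`, as `k` is algebraically closed. Then
`x - c e` kills a nonzero vector of `e A`, so it is not invertible in the corner and lies in the
radical. -/
lemma IsPrimitiveIdempotent.exists_sub_smul_mem [IsAlgClosed k] {e : A}
    (he : IsPrimitiveIdempotent e) {x : A} (h1 : e * x = x) (h2 : x * e = x) :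
    ∃ c : k, x - c • e ∈ radical A := by
  let V := LinearMap.range (LinearMap.mulLeft k e)
  have hV : ∀ v ∈ V, e * v = v := by
    rintro _ ⟨v, rfl⟩
    simp only [LinearMap.mulLeft_apply]
    rw [← mul_assoc, he.1.eq]
  let f : V →ₗ[k] V := (LinearMap.mulLeft k x).restrict (p := V) (q := V) fun v hv =>
    ⟨x * v, by rw [LinearMap.mulLeft_apply, LinearMap.mulLeft_apply, ← mul_assoc, h1]⟩
  have : Nontrivial V := ⟨⟨⟨e, ⟨e, he.1.eq⟩⟩, 0, fun h => he.2.1 (congrArg Subtype.val h)⟩⟩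
  obtain ⟨c, hc⟩ := Module.End.exists_eigenvalue f
  obtain ⟨v, hv, hv0⟩ := hc.exists_hasEigenvector
  have hv1 : x * v.1 = c • v.1 := congrArg Subtype.val (Module.End.mem_eigenspace_iff.1 hv)
  refine ⟨c, ?_⟩
  rcases he.mem_radical_or_unit k (x := x - c • e)
    (by rw [mul_sub, h1, mul_smul_comm, he.1.eq])
    (by rw [sub_mul, h2, smul_mul_assoc, he.1.eq]) with h | ⟨y, -, -, hy⟩
  · exact h
  · exfalso
    apply hv0
    apply Subtype.ext
    have : y * (x - c • e) * v.1 = 0 := by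
      rw [mul_assoc, sub_mul, hv1, smul_mul_assoc, hV _ v.2, sub_self, mul_zero]
    rw [hy, hV _ v.2] at this
    exact this

lemma radical_isNilpotent (k : Type*) [Field k] (A : Type*) [Ring A] [Algebra k A]
    [FiniteDimensional k A] : IsNilpotent (radical A) := by
  have : IsArtinianRing A := IsArtinianRing.of_finite k A
  exact IsArtinianRing.isNilpotent_jacobson_bot

lemma IsIdempotentElem.notMem_radical (k : Type*) [Field k] {A : Type*} [Ring A] [Algebra k A]
    [FiniteDimensional k A] {e : A} (he : IsIdempotentElem e) (h0 : e ≠ 0) : e ∉ radical A := by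
  intro h
  obtain ⟨n, hn⟩ := radical_isNilpotent k A
  have h1 : e ^ n ∈ radical A ^ n := Ideal.pow_mem_pow h n
  rw [hn] at h1
  cases n with
  | zero =>
    rw [pow_zero] at h1
    exact h0 (by rw [← mul_one e, show (1 : A) = 0 from h1, mul_zero])
  | succ n => exact h0 ((he.pow_succ_eq n).symm.trans h1)

end Corner

/-! ## The functors `X ⊗_k -` on modules -/

section ScalarFunctor

open MulOpposite (op)
open FDBimod (Hom.lin Hom.lin_op homMk)

variable (k : Type u) [Field k] {A : Type u} [Ring A] [Algebra k A] [FiniteDimensional k A]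

/-- The underlying vector space of a module. -/
@[reducible]
def scalarModule (X : FGModuleCat.{u} A) : Module k X := Module.compHom X (algebraMap k A)

attribute [local instance] scalarModule

instance scalarModule_tower (X : FGModuleCat.{u} A) : IsScalarTower k A X :=
  IsScalarTower.of_algebraMap_smul fun _ _ => rfl

instance scalarModule_finite (X : FGModuleCat.{u} A) : FiniteDimensional k X :=
  Module.Finite.trans A X

/-- A homomorphism of modules is linear over the ground field. -/
def scalarHom {X Y : FGModuleCat.{u} A} (f : X ⟶ Y) : X →ₗ[k] Y :=
  f.hom.hom.restrictScalars k

@[simp] lemma scalarHom_apply {X Y : FGModuleCat.{u} A} (f : X ⟶ Y) (x : X) :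
    scalarHom k f x = f.hom.hom x := rfl

/-- The bimodule `X ⊗_k A`. -/
def outerBimod (X : FGModuleCat.{u} A) : FDBimod A := FDBimod.outer k A X

/-- The functor `X ⊗_k -`. -/
abbrev scalarTensor (X : FGModuleCat.{u} A) : FGModuleCat.{u} A ⥤ FGModuleCat.{u} A :=
  tensorFunctor (outerBimod k X)

/-- The element `x ⊗ m` of `X ⊗_k M`. -/
def stmul {X M : FGModuleCat.{u} A} (x : X) (m : M) : (scalarTensor k X).obj M :=
  BTensor.tmul (B := outerBimod k X) (Outer.tmul k A x 1) m

variable {k}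

lemma stmul_add {X M : FGModuleCat.{u} A} (x : X) (m m' : M) :
    stmul k x (m + m') = stmul k x m + stmul k x m' :=
  BTensor.tmul_add (B := outerBimod k X) _ _ _

lemma add_stmul {X M : FGModuleCat.{u} A} (x x' : X) (m : M) :
    stmul k (x + x') m = stmul k x m + stmul k x' m :=
  (congrArg (fun y => BTensor.tmul (B := outerBimod k X) y m)
    (TensorProduct.add_tmul x x' (1 : A))).trans (BTensor.add_tmul (B := outerBimod k X) _ _ _)

lemma smul_stmul {X M : FGModuleCat.{u} A} (a : A) (x : X) (m : M) :
    stmul k (a • x) m = a • stmul k x m := rfl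

lemma tmul_tmul_eq {X M : FGModuleCat.{u} A} (x : X) (a : A) (m : M) :
    (BTensor.tmul (B := outerBimod k X) (Outer.tmul k A x a) m : (scalarTensor k X).obj M) =
      stmul k x (a • m) := by
  refine Eq.trans ?_ (BTensor.op_tmul (B := outerBimod k X) a (Outer.tmul k A x 1) m)
  exact congrArg (fun y => BTensor.tmul (B := outerBimod k X) (Outer.tmul k A x y) m)
    (one_mul a).symm

/-- Seen in `A`, the scalar `c` crosses first the tensor product over `A` and then the one over `k`.
-/
lemma stmul_smul {X M : FGModuleCat.{u} A} (c : k) (x : X) (m : M) :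
    stmul k x (c • m) = c • stmul k x m := by
  refine (tmul_tmul_eq x (algebraMap k A c) m).symm.trans ?_
  change _ = stmul k (c • x) m
  refine congrArg (fun y => BTensor.tmul (B := outerBimod k X) y m) ?_
  change x ⊗ₜ[k] (algebraMap k A c) = (c • x) ⊗ₜ[k] (1 : A)
  rw [TensorProduct.smul_tmul, Algebra.algebraMap_eq_smul_one]

lemma smul_stmul' {X M : FGModuleCat.{u} A} (c : k) (x : X) (m : M) :
    stmul k (c • x) m = c • stmul k x m := rfl

lemma stmul_induction {X M : FGModuleCat.{u} A} {p : (scalarTensor k X).obj M → Prop}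
    (h : ∀ x m, p (stmul k x m)) (hadd : ∀ x y, p x → p y → p (x + y))
    (z : (scalarTensor k X).obj M) : p z := by
  have h0 : p 0 := by
    have := h 0 0
    rwa [show stmul k (0 : X) (0 : M) = 0 by
      rw [← zero_smul k (0 : X), smul_stmul', zero_smul]] at this
  induction z using BTensor.induction with
  | hadd x y hx hy => exact hadd x y hx hy
  | h b m =>
    induction b using Outer.induction with
    | h0 => exact (congrArg p (map_zero (tmulRight (outerBimod k X) (m : M)))).mpr h0
    | h x a => exact (congrArg p (tmul_tmul_eq x a m)).mpr (h _ _)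
    | hadd x y hx hy =>
      exact (congrArg p (BTensor.add_tmul (B := outerBimod k X) x y m)).mpr (hadd _ _ hx hy)

/-- The bilinear map `(x, m) ↦ x ⊗ m`. -/
def stmulLin (X M : FGModuleCat.{u} A) : X →ₗ[k] M →ₗ[k] (scalarTensor k X).obj M :=
  LinearMap.mk₂ k (stmul k) add_stmul (fun _ _ _ => smul_stmul' _ _ _) stmul_add
    (fun _ _ _ => stmul_smul _ _ _)

@[simp] lemma stmulLin_apply {X M : FGModuleCat.{u} A} (x : X) (m : M) :
    stmulLin X M x m = stmul k x m := rfl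

/-- The additive map out of `X ⊗_k M` given by a balanced biadditive map. -/
def stliftAdd {X M : FGModuleCat.{u} A} {P : Type u} [AddCommGroup P] (f : X →+ M →+ P)
    (hf : ∀ (c : k) x m, f (c • x) m = f x (c • m)) : (scalarTensor k X).obj M →+ P :=
  let g : M → Outer k A X →+ P := fun m => TensorProduct.liftAddHom (R := k) (M := X) (N := A)
    (AddMonoidHom.mk' (fun x => (f x).comp (AddMonoidHom.mk' (fun a : A => a • m)
      (fun a b => add_smul a b m))) (fun x y => by ext a; simp))
    (fun c x a => by
      change f (c • x) (a • m) = f x ((c • a) • m)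
      rw [hf, smul_assoc])
  BTensor.liftAdd (B := outerBimod k X) (M := M) (fun b m => g m b)
    (fun b b' m => map_add (g m) b b')
    (fun b m m' => Outer.add_ext (F := g (m + m')) (G := g m + g m')
      (fun x a => (congrArg (f x) (smul_add a m m')).trans (map_add _ _ _)) b)
    (fun a b m => Outer.add_ext (F := (g m).comp (DistribSMul.toAddMonoidHom (Outer k A X) (op a)))
      (G := g (a • m)) (fun x c => congrArg (f x) (mul_smul c a m)) b)

@[simp] lemma stliftAdd_stmul {X M : FGModuleCat.{u} A} {P : Type u} [AddCommGroup P]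
    (f : X →+ M →+ P) (hf : ∀ (c : k) x m, f (c • x) m = f x (c • m)) (x : X) (m : M) :
    stliftAdd f hf (stmul k x m) = f x m :=
  congrArg (f x) (one_smul A m)

lemma st_add_ext {X M : FGModuleCat.{u} A} {P : Type u} [AddCommGroup P]
    {f g : (scalarTensor k X).obj M →+ P} (h : ∀ x m, f (stmul k x m) = g (stmul k x m))
    (z : (scalarTensor k X).obj M) : f z = g z :=
  stmul_induction (p := fun z => f z = g z) h
    (fun x y hx hy => by rw [map_add, map_add, hx, hy]) z

lemma st_hom_ext {X M N : FGModuleCat.{u} A} {f g : (scalarTensor k X).obj M ⟶ N}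
    (h : ∀ x m, f.hom.hom (stmul k x m) = g.hom.hom (stmul k x m)) : f = g :=
  FGModuleCat.hom_ext (LinearMap.ext fun z =>
    st_add_ext (f := f.hom.hom.toAddMonoidHom) (g := g.hom.hom.toAddMonoidHom) h z)

/-- The linear map out of `X ⊗_k M` given by a bilinear map. -/
def stlift {X M : FGModuleCat.{u} A} {P : Type u} [AddCommGroup P] [Module A P] (f : X →+ M →+ P)
    (hf : ∀ (c : k) x m, f (c • x) m = f x (c • m)) (hA : ∀ (a : A) x m, f (a • x) m = a • f x m) :
    (scalarTensor k X).obj M →ₗ[A] P where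
  toFun := stliftAdd f hf
  map_add' := map_add _
  map_smul' a z := st_add_ext
    (f := (stliftAdd f hf).comp (DistribSMul.toAddMonoidHom _ a))
    (g := (DistribSMul.toAddMonoidHom _ a).comp (stliftAdd f hf))
    (fun x m => by
      refine (stliftAdd_stmul f hf (a • x) m).trans ?_
      rw [hA]
      exact congrArg (a • ·) (stliftAdd_stmul f hf x m).symm) z

/-- Functoriality of `X ⊗_k M` in `M`, for linear maps over the ground field. -/
def stmapRight (X : FGModuleCat.{u} A) {M N : FGModuleCat.{u} A} (t : M →ₗ[k] N) :
    (scalarTensor k X).obj M ⟶ (scalarTensor k X).obj N :=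
  FGModuleCat.ofHom (stlift (P := (scalarTensor k X).obj N)
    (AddMonoidHom.mk' (fun x => ((stmulLin X N x).comp t).toAddMonoidHom)
      (fun x y => by ext m; exact add_stmul x y (t m)))
    (fun c x m => by
      change stmul k (c • x) (t m) = stmul k x (t (c • m))
      rw [map_smul, stmul_smul, smul_stmul'])
    (fun a x m => smul_stmul a x (t m)))

@[simp] lemma stmapRight_stmul (X : FGModuleCat.{u} A) {M N : FGModuleCat.{u} A} (t : M →ₗ[k] N)
    (x : X) (m : M) : (stmapRight X t).hom.hom (stmul k x m) = stmul k x (t m) :=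
  congrArg (fun m => stmul k x (t m)) (one_smul A m)

@[simp] lemma scalarTensor_map_stmul (X : FGModuleCat.{u} A) {M N : FGModuleCat.{u} A} (t : M ⟶ N)
    (x : X) (m : M) :
    ((scalarTensor k X).map t).hom.hom (stmul k x m) = stmul k x (t.hom.hom m) := rfl

lemma stmapRight_comp (X : FGModuleCat.{u} A) {M N P : FGModuleCat.{u} A} (t : M →ₗ[k] N)
    (s : N →ₗ[k] P) : stmapRight X t ≫ stmapRight X s = stmapRight X (s ∘ₗ t) :=
  st_hom_ext fun x m => by simp

lemma stmapRight_add (X : FGModuleCat.{u} A) {M N : FGModuleCat.{u} A} (t s : M →ₗ[k] N) :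
    stmapRight X (t + s) = stmapRight X t + stmapRight X s :=
  st_hom_ext fun x m => by
    refine (stmapRight_stmul X (t + s) x m).trans ?_
    refine (stmul_add x (t m) (s m)).trans ?_
    exact (congrArg₂ (· + ·) (stmapRight_stmul X t x m) (stmapRight_stmul X s x m)).symm

/-- A natural family of linear maps over the ground field induces a natural transformation. -/
@[simps] def stwhisker (X : FGModuleCat.{u} A) {F G : FGModuleCat.{u} A ⥤ FGModuleCat.{u} A}
    (t : ∀ M, F.obj M →ₗ[k] G.obj M)
    (ht : ∀ {M N} (f : M ⟶ N) (m), t N ((F.map f).hom.hom m) = (G.map f).hom.hom (t M m)) :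
    F ⋙ scalarTensor k X ⟶ G ⋙ scalarTensor k X where
  app M := stmapRight X (t M)
  naturality M N f := st_hom_ext fun x m => by
    change (stmapRight X (t N)).hom.hom (stmul k x ((F.map f).hom.hom m)) =
      ((scalarTensor k X).map (G.map f)).hom.hom ((stmapRight X (t M)).hom.hom (stmul k x m))
    rw [stmapRight_stmul, stmapRight_stmul, ht, scalarTensor_map_stmul]

variable (k) in
/-- Multiplication by an element of the algebra, as a linear map over the ground field. -/
def actLin (a : A) (M : FGModuleCat.{u} A) : M →ₗ[k] M := Algebra.lsmul k k M a

variable (k) in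
/-- The natural endomorphism `x ⊗ m ↦ x ⊗ a m` of `X ⊗_k -`. -/
def stact (X : FGModuleCat.{u} A) (a : A) : scalarTensor k X ⟶ scalarTensor k X :=
  stwhisker X (F := 𝟭 _) (G := 𝟭 _) (actLin k a) (fun f m => (f.hom.hom.map_smul a m).symm)

@[simp] lemma stact_stmul (X : FGModuleCat.{u} A) (a : A) {M : FGModuleCat.{u} A} (x : X) (m : M) :
    ((stact k X a).app M).hom.hom (stmul k x m) = stmul k x (a • m) := stmapRight_stmul _ _ _ _

/-- The order is reversed because `stact` acts on the module variable by left multiplication. -/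
lemma stact_comp (X : FGModuleCat.{u} A) (a b : A) :
    stact k X a ≫ stact k X b = stact k X (b * a) := by
  ext M : 2
  refine (stmapRight_comp X _ _).trans (congrArg (stmapRight X) ?_)
  ext m
  exact (mul_smul b a m).symm

lemma stact_add (X : FGModuleCat.{u} A) (a b : A) :
    stact k X (a + b) = stact k X a + stact k X b := by
  ext M : 2
  refine Eq.trans (congrArg (stmapRight X) ?_) (stmapRight_add X _ _)
  ext m
  exact add_smul a b m

lemma stact_one (X : FGModuleCat.{u} A) : stact k X (1 : A) = 𝟙 _ := by
  ext M : 2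
  refine st_hom_ext fun x m => ?_
  rw [stact_stmul, one_smul]
  rfl

/-- Functoriality of `X ⊗_k M` in `X`. -/
def stmapLeftLin {X Y : FGModuleCat.{u} A} (f : X ⟶ Y) (M : FGModuleCat.{u} A) :
    (scalarTensor k X).obj M ⟶ (scalarTensor k Y).obj M :=
  FGModuleCat.ofHom (stlift (P := (scalarTensor k Y).obj M)
    ((stmulLin (k := k) Y M).toAddMonoidHom.comp f.hom.hom.toAddMonoidHom |>
      AddMonoidHom.comp (AddMonoidHom.mk' (fun t : M →ₗ[k] _ => t.toAddMonoidHom)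
        (fun _ _ => rfl)))
    (fun c x m => by
      change stmul k (f.hom.hom (c • x)) m = stmul k (f.hom.hom x) (c • m)
      rw [stmul_smul, ← smul_stmul']
      exact congrArg (stmul k · m) (map_smul (scalarHom k f) c x))
    (fun a x m => (congrArg (stmul k · m) (map_smul f.hom.hom a x)).trans (smul_stmul a _ m)))

lemma stmapLeftLin_stmul {X Y : FGModuleCat.{u} A} (f : X ⟶ Y) {M : FGModuleCat.{u} A}
    (x : X) (m : M) :
    (stmapLeftLin (k := k) f M).hom.hom (stmul k x m) = stmul k (f.hom.hom x) m :=
  congrArg (fun m => stmul k (f.hom.hom x) m) (one_smul A m)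

/-- The natural transformation `u ⊗ id`. -/
def stmapLeft {X Y : FGModuleCat.{u} A} (f : X ⟶ Y) : scalarTensor k X ⟶ scalarTensor k Y where
  app M := stmapLeftLin f M
  naturality M N g := st_hom_ext fun x m => by
    change (stmapLeftLin f N).hom.hom (stmul k x (g.hom.hom m)) =
      ((scalarTensor k Y).map g).hom.hom ((stmapLeftLin f M).hom.hom (stmul k x m))
    rw [stmapLeftLin_stmul, stmapLeftLin_stmul, scalarTensor_map_stmul]

@[simp] lemma stmapLeft_stmul {X Y : FGModuleCat.{u} A} (f : X ⟶ Y) {M : FGModuleCat.{u} A}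
    (x : X) (m : M) :
    ((stmapLeft (k := k) f).app M).hom.hom (stmul k x m) = stmul k (f.hom.hom x) m :=
  stmapLeftLin_stmul f x m

/-- Evaluation of a linear form on the first factor. -/
def stcoord {X : FGModuleCat.{u} A} (ψ : X →ₗ[k] k) (M : FGModuleCat.{u} A) :
    (scalarTensor k X).obj M →ₗ[k] M :=
  let g : (scalarTensor k X).obj M →+ M := stliftAdd
    (AddMonoidHom.mk' (fun x => (ψ x • LinearMap.id : M →ₗ[k] M).toAddMonoidHom)
      (fun x y => by ext m; simp [add_smul]))
    (fun c x m => by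
      change ψ (c • x) • m = ψ x • c • m
      rw [map_smul, smul_eq_mul, mul_comm, mul_smul])
  have hg : ∀ x m, g (stmul k x m) = ψ x • m := fun x m => stliftAdd_stmul _ _ x m
  { toFun := g
    map_add' := map_add g
    map_smul' := fun c z => st_add_ext (f := g.comp (DistribSMul.toAddMonoidHom _ c))
      (g := (DistribSMul.toAddMonoidHom _ c).comp g) (fun x m => by
        change g (c • stmul k x m) = c • g (stmul k x m)
        rw [← stmul_smul, hg, hg, smul_comm]) z }

@[simp] lemma stcoord_stmul {X : FGModuleCat.{u} A} (ψ : X →ₗ[k] k) {M : FGModuleCat.{u} A}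
    (x : X) (m : M) : stcoord ψ M (stmul k x m) = ψ x • m :=
  congrArg (fun m => ψ x • m) (one_smul A m)

lemma stcoord_map {X : FGModuleCat.{u} A} (ψ : X →ₗ[k] k) {M N : FGModuleCat.{u} A}
    (f : M ⟶ N) (z : (scalarTensor k X).obj M) :
    stcoord ψ N (((scalarTensor k X).map f).hom.hom z) = f.hom.hom (stcoord ψ M z) :=
  st_add_ext (f := (stcoord ψ N).toAddMonoidHom.comp ((scalarTensor k X).map f).hom.hom.toAddMonoidHom)
    (g := f.hom.hom.toAddMonoidHom.comp (stcoord ψ M).toAddMonoidHom) (fun x m => by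
      change stcoord ψ N (stmul k x (f.hom.hom m)) = f.hom.hom (stcoord ψ M (stmul k x m))
      rw [stcoord_stmul, stcoord_stmul]
      exact (map_smul (scalarHom k f) (ψ x) m).symm) z

lemma sum_stmul_stcoord {X M : FGModuleCat.{u} A} {ι : Type*} [Fintype ι] (b : Module.Basis ι k X)
    (z : (scalarTensor k X).obj M) : ∑ i, stmul k (b i) (stcoord (b.coord i) M z) = z := by
  induction z using stmul_induction with
  | hadd x y hx hy =>
    conv_rhs => rw [← hx, ← hy]
    rw [← Finset.sum_add_distrib]
    exact Finset.sum_congr rfl fun i _ => by rw [map_add, stmul_add]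
  | h x m =>
    simp only [stcoord_stmul, stmul_smul]
    conv_rhs => rw [← b.sum_repr x]
    rw [show stmul k (∑ i, b.repr x i • b i) m = (stmulLin X M).flip m (∑ i, b.repr x i • b i)
      from rfl, map_sum]
    exact Finset.sum_congr rfl fun i _ => by
      rw [map_smul, LinearMap.flip_apply, stmulLin_apply, Module.Basis.coord_apply]

/-- Along a basis of `X`, the space `X ⊗_k M` is a direct sum of copies of `M`, so the dual basis
already separates its elements. Identities between transformations can thus be checked on entries.
-/
lemma st_eq_of_stcoord {X M : FGModuleCat.{u} A} {z z' : (scalarTensor k X).obj M}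
    (h : ∀ ψ : X →ₗ[k] k, stcoord ψ M z = stcoord ψ M z') : z = z' := by
  rw [← sum_stmul_stcoord (Module.finBasis k X) z, ← sum_stmul_stcoord (Module.finBasis k X) z']
  exact Finset.sum_congr rfl fun i _ => by rw [h]

end ScalarFunctor

/-! ## Natural transformations between the functors `X ⊗_k -` -/

section Entries

open MulOpposite (op)
open FDBimod (Hom.lin Hom.lin_op homMk)

variable {k : Type u} [Field k] {A : Type u} [Ring A] [Algebra k A] [FiniteDimensional k A]

attribute [local instance] scalarModule

/-- The homomorphism `A → M`, `a ↦ a m`. -/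
def orbitHom {M : FGModuleCat.{u} A} (m : M) : FGModuleCat.of A A ⟶ M :=
  FGModuleCat.ofHom (LinearMap.toSpanSingleton A M m)

/-- The matrix coefficients of a natural transformation. -/
def stentry {X Y : FGModuleCat.{u} A} (f : scalarTensor k X ⟶ scalarTensor k Y) (ψ : Y →ₗ[k] k)
    (x : X) : A :=
  stcoord ψ (FGModuleCat.of A A)
    ((f.app (FGModuleCat.of A A)).hom.hom (stmul k (M := FGModuleCat.of A A) x (1 : A)))

/-- Every `m` is the image of `1` under a homomorphism from the regular module. By naturality the
transformation is governed by its value at `A`, and its entries act on `M` by multiplication. -/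
lemma stcoord_app {X Y : FGModuleCat.{u} A} (f : scalarTensor k X ⟶ scalarTensor k Y)
    (ψ : Y →ₗ[k] k) (x : X) {M : FGModuleCat.{u} A} (m : M) :
    stcoord ψ M ((f.app M).hom.hom (stmul k x m)) = stentry f ψ x • m := by
  have h1 : stmul k x m = ((scalarTensor k X).map (orbitHom m)).hom.hom
      (stmul k (M := FGModuleCat.of A A) x (1 : A)) :=
    congrArg (stmul k x) (one_smul A m).symm
  have h2 := f.naturality (orbitHom m)
  have h3 : (f.app M).hom.hom (((scalarTensor k X).map (orbitHom m)).hom.hom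
      (stmul k (M := FGModuleCat.of A A) x (1 : A))) =
      ((scalarTensor k Y).map (orbitHom m)).hom.hom ((f.app (FGModuleCat.of A A)).hom.hom
      (stmul k (M := FGModuleCat.of A A) x (1 : A))) :=
    congrArg (fun t => t.hom.hom (stmul k (M := FGModuleCat.of A A) x (1 : A))) h2
  rw [h1, h3, stcoord_map]
  rfl

lemma stcoord_stact {X : FGModuleCat.{u} A} (ψ : X →ₗ[k] k) (a : A) {M : FGModuleCat.{u} A}
    (z : (scalarTensor k X).obj M) :
    stcoord ψ M (((stact k X a).app M).hom.hom z) = a • stcoord ψ M z :=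
  st_add_ext (f := (stcoord ψ M).toAddMonoidHom.comp
      ((stact k X a).app M).hom.hom.toAddMonoidHom)
    (g := (DistribSMul.toAddMonoidHom M a).comp (stcoord ψ M).toAddMonoidHom) (fun x m => by
      change stcoord ψ M (((stact k X a).app M).hom.hom (stmul k x m)) =
        a • stcoord ψ M (stmul k x m)
      rw [stact_stmul, stcoord_stmul, stcoord_stmul, smul_comm]) z

/-- Cutting the source replaces `m` by `e m`; at `1` in the regular module this multiplies entries
by `e` on the right. -/
lemma stentry_cut_right {X Y : FGModuleCat.{u} A} {f : scalarTensor k X ⟶ scalarTensor k Y}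
    {e : A} (hf : stact k X e ≫ f = f) (ψ : Y →ₗ[k] k) (x : X) :
    stentry f ψ x * e = stentry f ψ x := by
  refine (stcoord_app f ψ x (M := FGModuleCat.of A A) e).symm.trans ?_
  conv_rhs => rw [← hf]
  refine congrArg (fun z => stcoord ψ (FGModuleCat.of A A)
    ((f.app (FGModuleCat.of A A)).hom.hom z)) ?_
  refine Eq.trans ?_ (stact_stmul X e (M := FGModuleCat.of A A) x (1 : A)).symm
  exact congrArg (stmul k (M := FGModuleCat.of A A) x) (mul_one e).symm

/-- Cutting the target multiplies every coordinate by `e` on the left. Together with the cut of the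
source, this puts the entries in the local ring `e A e`. -/
lemma stentry_cut_left {X Y : FGModuleCat.{u} A} {f : scalarTensor k X ⟶ scalarTensor k Y}
    {e : A} (hf : f ≫ stact k Y e = f) (ψ : Y →ₗ[k] k) (x : X) :
    e * stentry f ψ x = stentry f ψ x := by
  refine (stcoord_stact ψ e (M := FGModuleCat.of A A) _).symm.trans ?_
  conv_rhs => rw [← hf]
  rfl

/-- The module `L` is generated by `l`, is annihilated by the radical, and `e L` is the line spanned
by `l`. -/
structure IsTopOf (k : Type u) [Field k] [Algebra k A] [FiniteDimensional k A] (e : A)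
    (L : FGModuleCat.{u} A) (l : L) : Prop where
  radical_smul : ∀ a ∈ radical A, ∀ m : L, a • m = 0
  smul_self : e • l = l
  line : ∀ m : L, ∃ c : k, e • m = c • l
  annihilator : ∀ a : A, a • l = 0 → a * e ∈ radical A

/-- The module is `A` modulo the left ideal of all `a` with `a e` in the radical. This quotient is
`A e` modulo its radical, with `l` the class of `e`, which is also the class of `1`. -/
lemma exists_isTopOf [IsAlgClosed k] {e : A} (he : IsPrimitiveIdempotent e) :
    ∃ (L : FGModuleCat.{u} A) (l : L), IsTopOf k e L l := by
  let I : Submodule A A := Submodule.comap (LinearMap.toSpanSingleton A A e) (radical A)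
  have hI : ∀ a, a ∈ I ↔ a * e ∈ radical A := fun a => Iff.rfl
  refine ⟨FGModuleCat.of A (A ⧸ I), Submodule.Quotient.mk (p := I) 1, ?_, ?_, ?_, ?_⟩
  · intro a ha m
    obtain ⟨b, rfl⟩ := Submodule.Quotient.mk_surjective I m
    refine (Submodule.Quotient.mk_eq_zero (p := I) (x := a * b)).2 ?_
    rw [hI, mul_assoc]
    exact Ideal.mul_mem_right _ _ ha
  · refine (Submodule.Quotient.eq I (x := e * 1)).2 ?_
    rw [hI, mul_one, sub_mul, he.1.eq, one_mul, sub_self]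
    exact Submodule.zero_mem _
  · intro m
    obtain ⟨b, rfl⟩ := Submodule.Quotient.mk_surjective I m
    -- An element of `e A e` is a scalar multiple of `e` modulo the radical, so `e` maps every class
    -- into the line through `l`.
    obtain ⟨c, hc⟩ := he.exists_sub_smul_mem (k := k) (x := e * b * e)
      (by rw [← mul_assoc, ← mul_assoc, he.1.eq]) (by rw [mul_assoc, he.1.eq])
    refine ⟨c, (Submodule.Quotient.eq I (x := e * b) (y := algebraMap k A c * 1)).2 ?_⟩
    rwa [hI, sub_mul, mul_one, ← Algebra.smul_def]
  · intro a ha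
    have := (Submodule.Quotient.mk_eq_zero (p := I) (x := a * 1)).1 ha
    rwa [hI, mul_one] at this

namespace IsTopOf

variable {e : A} {L : FGModuleCat.{u} A} {l : L}

lemma ne_zero (h : IsTopOf k e L l) (he : IsPrimitiveIdempotent e) : l ≠ 0 := by
  intro h0
  have := h.annihilator 1 (by rw [h0, smul_zero])
  rw [one_mul] at this
  exact he.1.notMem_radical k he.2.1 this

/-- The product of an entry with `l` is a coordinate of `f.app L`, so the entry annihilates `l`. As
the entry is unchanged by right multiplication with `e`, it lies in the radical. -/
lemma stentry_mem (h : IsTopOf k e L l) {X Y : FGModuleCat.{u} A}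
    {f : scalarTensor k X ⟶ scalarTensor k Y} (hf : stact k X e ≫ f = f) (h0 : f.app L = 0)
    (ψ : Y →ₗ[k] k) (x : X) : stentry f ψ x ∈ radical A := by
  rw [← stentry_cut_right hf]
  apply h.annihilator
  rw [← stcoord_app, h0]
  exact map_zero (stcoord ψ L)

/-- The radical annihilates `L`, so a transformation with all entries in the radical vanishes there.
-/
lemma exists_stentry_notMem (h : IsTopOf k e L l) {X Y : FGModuleCat.{u} A}
    {f : scalarTensor k X ⟶ scalarTensor k Y} (h0 : f.app L ≠ 0) :
    ∃ ψ x, stentry f ψ x ∉ radical A := by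
  by_contra! hc
  exact h0 (st_hom_ext fun x m => st_eq_of_stcoord fun ψ => by
    rw [stcoord_app, h.radical_smul _ (hc ψ x)]
    exact (map_zero (stcoord ψ L)).symm)

/-- All entries of `p` lie in the radical. Since `p` equals each of its powers, the coordinates of
its values lie in every power of the radical times `M`, and the radical is nilpotent. -/
lemma idempotent_eq_zero (h : IsTopOf k e L l) {X : FGModuleCat.{u} A}
    {p : scalarTensor k X ⟶ scalarTensor k X} (hp : p ≫ p = p) (hf : stact k X e ≫ p = p)
    (h0 : p.app L = 0) : p = 0 := by
  have key : ∀ (n : ℕ) (M : FGModuleCat.{u} A) (z : (scalarTensor k X).obj M) (ψ : X →ₗ[k] k),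
      stcoord ψ M ((p.app M).hom.hom z) ∈ radical A ^ n • (⊤ : Submodule A M) := by
    intro n
    induction n with
    | zero =>
      intro M z ψ
      rw [Submodule.pow_zero, Ideal.one_eq_top, Submodule.top_smul]
      trivial
    | succ n ih =>
      intro M z ψ
      have h1 : (p.app M).hom.hom z = (p.app M).hom.hom ((p.app M).hom.hom z) := by
        conv_lhs => rw [← hp]
        rfl
      rw [h1, ← sum_stmul_stcoord (Module.finBasis k X) ((p.app M).hom.hom z), map_sum, map_sum]
      refine Submodule.sum_mem _ fun i _ => ?_
      -- For `n = 0` this says that the radical times the whole ring is the radical, which holds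
      -- because the radical is two-sided.
      have h2 : radical A ^ (n + 1) = radical A * radical A ^ n := by
        rcases eq_or_ne n 0 with rfl | hn
        · rw [Submodule.pow_zero, zero_add, Submodule.pow_one, Ideal.one_eq_top, Ideal.mul_top]
        · exact Submodule.pow_succ' _ hn
      rw [stcoord_app, h2, Submodule.mul_smul]
      exact Submodule.smul_mem_smul (h.stentry_mem hf h0 ψ _) (ih M z _)
  obtain ⟨n, hn⟩ := radical_isNilpotent k A
  ext M : 2
  refine st_hom_ext fun x m => st_eq_of_stcoord fun ψ => ?_
  have h1 := key n M (stmul k x m) ψ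
  rw [hn, Submodule.zero_eq_bot, Submodule.bot_smul, Submodule.mem_bot] at h1
  rw [h1]
  exact (map_zero (stcoord ψ M)).symm

/-- A cut natural transformation which does not vanish on `L` factorizes, after composition with
`Z ⊗_k -`, the idempotent given by `e`. -/
lemma exists_factorization (h : IsTopOf k e L l) (he : IsPrimitiveIdempotent e)
    {X Y : FGModuleCat.{u} A} {f : scalarTensor k X ⟶ scalarTensor k Y}
    (hf : stact k X e ≫ f = f) (hf' : f ≫ stact k Y e = f) (h0 : f.app L ≠ 0)
    (Z : FGModuleCat.{u} A) :
    ∃ (a : scalarTensor k Z ⟶ scalarTensor k X ⋙ scalarTensor k Z)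
      (b : scalarTensor k Y ⋙ scalarTensor k Z ⟶ scalarTensor k Z),
      a ≫ Functor.whiskerRight f (scalarTensor k Z) ≫ b = stact k Z e := by
  obtain ⟨ψ, x, hx⟩ := h.exists_stentry_notMem h0
  obtain ⟨y, -, -, hy⟩ := (he.mem_radical_or_unit k (stentry_cut_left hf' ψ x)
    (stentry_cut_right hf ψ x)).resolve_left hx
  -- The first map inserts `x`, the second applies `ψ` and multiplies by the inverse `y` of the
  -- entry. Both are only `k`-linear in the module variable, which suffices because `A` acts on `Z
  -- ⊗_k -` through `Z`. The composite acts on `m` by `y` times the entry, which is `e`.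
  refine ⟨stwhisker Z (F := 𝟭 _) (G := scalarTensor k X) (fun M => stmulLin X M x)
      (fun f m => rfl),
    stwhisker Z (F := scalarTensor k Y) (G := 𝟭 _) (fun M => actLin k y M ∘ₗ stcoord ψ M)
      (fun {M N} f m => ?_), ?_⟩
  · change y • stcoord ψ N _ = f.hom.hom (y • stcoord ψ M m)
    rw [stcoord_map, map_smul]
  · ext M : 2
    refine st_hom_ext fun z m => ?_
    have h1 : ∀ w : (scalarTensor k X).obj M,
        ((scalarTensor k Z).map (f.app M)).hom.hom (stmul k z w) =
          stmul k z ((f.app M).hom.hom w) := fun w => rfl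
    change (stmapRight Z (actLin k y M ∘ₗ stcoord ψ M)).hom.hom
      (((scalarTensor k Z).map (f.app M)).hom.hom
        ((stmapRight Z (stmulLin X M x)).hom.hom (stmul k z m))) =
      ((stact k Z e).app M).hom.hom (stmul k z m)
    rw [stmapRight_stmul, h1, stmapRight_stmul, stact_stmul, ← hy, mul_smul, ← stcoord_app]
    rfl

/-- The image of `e` on `L` is the line through `l`. The coordinate on this line, composed with the
action of `e`, is the required form. -/
lemma exists_coord (h : IsTopOf k e L l) (he : IsPrimitiveIdempotent e) :
    ∃ χ : L →ₗ[k] k, χ l = 1 ∧ ∀ m, e • m = χ m • l := by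
  obtain ⟨φ, hφ⟩ : ∃ φ : Module.Dual k L, φ l ≠ 0 := by
    by_contra! hc
    exact h.ne_zero he ((Module.forall_dual_apply_eq_zero_iff k l).1 hc)
  refine ⟨(φ l)⁻¹ • φ ∘ₗ actLin k e L, ?_, fun m => ?_⟩
  · change (φ l)⁻¹ * φ (e • l) = 1
    rw [h.smul_self, inv_mul_cancel₀ hφ]
  · obtain ⟨c, hc⟩ := h.line m
    change _ = ((φ l)⁻¹ * φ (e • m)) • l
    rw [hc, map_smul, smul_eq_mul, mul_comm c, ← mul_assoc, inv_mul_cancel₀ hφ, one_mul]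

end IsTopOf

variable (k) in
/-- The map `x ↦ x ⊗ l`. -/
def topIncl (X : FGModuleCat.{u} A) {L : FGModuleCat.{u} A} (l : L) :
    X ⟶ (scalarTensor k X).obj L :=
  FGModuleCat.ofHom
    { toFun := fun x => stmul k x l
      map_add' := fun x y => add_stmul x y l
      map_smul' := fun a x => smul_stmul a x l }

/-- The map `x ⊗ m ↦ χ(m) x`. -/
def topProj (X : FGModuleCat.{u} A) {L : FGModuleCat.{u} A} (χ : L →ₗ[k] k) :
    (scalarTensor k X).obj L ⟶ X :=
  FGModuleCat.ofHom (stlift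
    (AddMonoidHom.mk' (fun x => (LinearMap.toSpanSingleton k X x ∘ₗ χ).toAddMonoidHom)
      (fun x y => by ext m; exact smul_add (χ m) x y))
    (fun c x m => by
      change χ m • c • x = χ (c • m) • x
      rw [map_smul, smul_eq_mul, smul_smul, mul_comm])
    (fun a x m => smul_comm (χ m) a x))

@[simp] lemma topProj_stmul (X : FGModuleCat.{u} A) {L : FGModuleCat.{u} A} (χ : L →ₗ[k] k)
    (x : X) (m : L) : (topProj X χ).hom.hom (stmul k x m) = χ m • x :=
  congrArg (fun m => χ m • x) (one_smul A m)

lemma topIncl_topProj (X : FGModuleCat.{u} A) {L : FGModuleCat.{u} A} {l : L} {χ : L →ₗ[k] k}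
    (hl : χ l = 1) : topIncl k X l ≫ topProj X χ = 𝟙 X :=
  FGModuleCat.hom_ext (LinearMap.ext fun x => by
    change (topProj X χ).hom.hom (stmul k x l) = x
    rw [topProj_stmul, hl, one_smul])

/-- As `e m = χ(m) l`, both sides send `x ⊗ m` to `x ⊗ e m`. With `topIncl_topProj` this identifies
the image of the cut at `L` with `X`. -/
lemma topProj_topIncl (X : FGModuleCat.{u} A) {e : A} {L : FGModuleCat.{u} A} {l : L}
    {χ : L →ₗ[k] k} (hχ : ∀ m, e • m = χ m • l) :
    topProj X χ ≫ topIncl k X l = (stact k X e).app L :=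
  st_hom_ext fun x m => by
    change (topIncl k X l).hom.hom ((topProj X χ).hom.hom (stmul k x m)) =
      ((stact k X e).app L).hom.hom (stmul k x m)
    rw [topProj_stmul, stact_stmul, hχ, stmul_smul]
    rfl

/-- Every homomorphism `X ⊗ L → Y ⊗ L` is, up to cutting with `e`, induced by a homomorphism
`X → Y`. -/
lemma cut_eq_stmapLeft {X Y : FGModuleCat.{u} A} {e : A} {L : FGModuleCat.{u} A} {l : L}
    {χ : L →ₗ[k] k} (hχ : ∀ m, e • m = χ m • l)
    (g : (scalarTensor k X).obj L ⟶ (scalarTensor k Y).obj L) :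
    (stact k X e).app L ≫ g ≫ (stact k Y e).app L =
      (stact k X e ≫ stmapLeft (topIncl k X l ≫ g ≫ topProj Y χ)).app L :=
  st_hom_ext fun x m => by
    have h1 := topProj_topIncl (k := k) Y hχ
    change ((stact k Y e).app L).hom.hom (g.hom.hom (((stact k X e).app L).hom.hom
      (stmul k x m))) = ((stmapLeft (topIncl k X l ≫ g ≫ topProj Y χ)).app L).hom.hom
        (((stact k X e).app L).hom.hom (stmul k x m))
    -- The cut of the source turns `x ⊗ m` into `χ(m)` times `x ⊗ l`, so only the values of `g` on
    -- vectors `x ⊗ l` matter.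
    rw [stact_stmul, stmapLeft_stmul, hχ, stmul_smul, stmul_smul, ← h1]
    change (topIncl k Y l).hom.hom ((topProj Y χ).hom.hom (g.hom.hom (χ m • stmul k x l))) =
      χ m • (topIncl k Y l).hom.hom ((topProj Y χ).hom.hom (g.hom.hom (stmul k x l)))
    rw [← scalarHom_apply k g, map_smul, ← scalarHom_apply k (topProj Y χ), map_smul,
      ← scalarHom_apply k (topIncl k Y l), map_smul]
    rfl

end Entries

/-! ## Natural transformations between tensor functors are bimodule homomorphisms -/

section Watts

open MulOpposite (op)
open FDBimod (Hom.lin Hom.lin_op homMk)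

variable {A : Type u} [Ring A]

/-- The natural transformation induced by a bimodule homomorphism. -/
def tensorNat {B B' : FDBimod A} (f : B ⟶ B') : tensorFunctor B ⟶ tensorFunctor B' where
  app M := (tensorEval M).map f
  naturality M N g := FGModuleCat.hom_ext (BTensor.lin_ext fun b m => rfl)

lemma tensor_nat_ext {B : FDBimod A} {F : FGModuleCat.{u} A ⥤ FGModuleCat.{u} A}
    {φ ψ : tensorFunctor B ⟶ F}
    (h : ∀ (M : FGModuleCat.{u} A) (b : B.carrier) (m : M),
      (φ.app M).hom.hom (BTensor.tmul b m) = (ψ.app M).hom.hom (BTensor.tmul b m)) : φ = ψ := by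
  ext M : 2
  exact FGModuleCat.hom_ext (BTensor.lin_ext fun b m => h M b m)

lemma tensorNat_id (B : FDBimod A) : tensorNat (𝟙 B) = 𝟙 _ := tensor_nat_ext fun _ _ _ => rfl

lemma tensorNat_comp {B B' B'' : FDBimod A} (f : B ⟶ B') (g : B' ⟶ B'') :
    tensorNat (f ≫ g) = tensorNat f ≫ tensorNat g := tensor_nat_ext fun _ _ _ => rfl

lemma tensorNat_add {B B' : FDBimod A} (f g : B ⟶ B') :
    tensorNat (f + g) = tensorNat f + tensorNat g :=
  tensor_nat_ext fun M b m => BTensor.add_tmul (Hom.lin f b) (Hom.lin g b) m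

/-- The bimodule homomorphism underlying a natural transformation of tensor functors. -/
def natBimod {B B' : FDBimod A} (φ : tensorFunctor B ⟶ tensorFunctor B') : B ⟶ B' :=
  homMk ((tensorRegularHom A B').comp
      (((φ.app (FGModuleCat.of A A)).hom.hom : BTensor B A →ₗ[A] BTensor B' A).comp
        (tmulRight B (M := A) (1 : A))))
    (fun a x => by
      -- Right multiplication by `a` is an endomorphism of the left module `A`. Naturality with
      -- respect to it is exactly right linearity of the induced map.
      have h1 : (BTensor.tmul (op a • x) (1 : A) : BTensor B A) =
          BTensor.map (𝟙 B) (LinearMap.toSpanSingleton A A a) (BTensor.tmul x (1 : A)) := by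
        rw [BTensor.op_tmul, BTensor.map_tmul, LinearMap.toSpanSingleton_apply, smul_eq_mul,
          smul_eq_mul, one_mul, mul_one]
        rfl
      have h2 := congrArg (fun t => t.hom.hom (BTensor.tmul x (1 : A) : BTensor B A))
        (φ.naturality (X := FGModuleCat.of A A) (Y := FGModuleCat.of A A) (orbitHom a))
      have h3 : ∀ z : BTensor B' A, tensorRegularHom A B'
          (BTensor.map (𝟙 B') (LinearMap.toSpanSingleton A A a) z) =
          op a • tensorRegularHom A B' z :=
        BTensor.add_ext (f := ((tensorRegularHom A B').comp
            (BTensor.map (𝟙 B') (LinearMap.toSpanSingleton A A a))).toAddMonoidHom)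
          (g := (DistribSMul.toAddMonoidHom B'.carrier (op a)).comp
            (tensorRegularHom A B').toAddMonoidHom)
          (fun b (c : A) => mul_smul (op a) (op c) b)
      change tensorRegularHom A B' (((φ.app (FGModuleCat.of A A)).hom.hom : BTensor B A →ₗ[A] _)
        (BTensor.tmul (op a • x) (1 : A))) = _
      rw [h1]
      exact (congrArg (tensorRegularHom A B') h2).trans (h3 _))

/-- This is the Eilenberg–Watts argument: `b ⊗ m` comes from `b ⊗ 1` along the homomorphism `A → M`
sending `1` to `m`, so naturality recovers the transformation from its value at `A`. -/
lemma tensorNat_natBimod {B B' : FDBimod A} (φ : tensorFunctor B ⟶ tensorFunctor B') :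
    tensorNat (natBimod φ) = φ := by
  refine tensor_nat_ext fun M b m => ?_
  have h1 : (BTensor.tmul b m : BTensor B M) =
      BTensor.map (𝟙 B) (LinearMap.toSpanSingleton A M m) (BTensor.tmul b (1 : A)) :=
    congrArg (BTensor.tmul b) (one_smul A m).symm
  have h2 := congrArg (fun t => t.hom.hom (BTensor.tmul b (1 : A) : BTensor B A))
    (φ.naturality (X := FGModuleCat.of A A) (Y := M) (orbitHom m))
  have h3 : ∀ z : BTensor B' A, BTensor.tmul (tensorRegularHom A B' z) m =
      BTensor.map (𝟙 B') (LinearMap.toSpanSingleton A M m) z :=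
    BTensor.add_ext (f := ((tmulRight B' m).comp (tensorRegularHom A B')).toAddMonoidHom)
      (g := (BTensor.map (𝟙 B') (LinearMap.toSpanSingleton A M m)).toAddMonoidHom)
      (fun b (c : A) => BTensor.op_tmul c b m)
  refine (h3 _).trans ?_
  refine h2.symm.trans ?_
  exact congrArg (φ.app M).hom.hom h1.symm

lemma tensorNat_injective {B B' : FDBimod A} {f g : B ⟶ B'} (h : tensorNat f = tensorNat g) :
    f = g := by
  refine FDBimod.hom_ext fun x => ?_
  have h1 : (BTensor.tmul (Hom.lin f x) (1 : A) : BTensor B' A) =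
      BTensor.tmul (Hom.lin g x) (1 : A) :=
    congrArg (fun t => (t.app (FGModuleCat.of A A)).hom.hom
      (BTensor.tmul x (1 : A) : BTensor B A)) h
  have h2 := congrArg (tensorRegularHom A B') h1
  change (op (1 : A)) • Hom.lin f x = (op (1 : A)) • Hom.lin g x at h2
  rwa [MulOpposite.op_one, one_smul, one_smul] at h2

end Watts

/-! ## Idempotents and endomorphisms of bimodules -/

section Bimodules

open MulOpposite (op)
open FDBimod (Hom.lin Hom.lin_op homMk)

variable {A : Type u} [Ring A]

namespace FDBimod

/-- The right action on the image of an endomorphism. -/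
@[reducible]
def imageRight {B : FDBimod A} (p : B ⟶ B) : Module Aᵐᵒᵖ (LinearMap.range (Hom.lin p)) where
  smul a x := ⟨a • x.1, by
    obtain ⟨y, hy⟩ := x.2
    exact ⟨a • y, (Hom.lin_op p a.unop y).trans (congrArg (a • ·) hy)⟩⟩
  one_smul x := Subtype.ext (one_smul _ x.1)
  mul_smul a b x := Subtype.ext (mul_smul a b x.1)
  smul_zero a := Subtype.ext (smul_zero a)
  smul_add a x y := Subtype.ext (smul_add a x.1 y.1)
  add_smul a b x := Subtype.ext (add_smul a b x.1)
  zero_smul x := Subtype.ext (zero_smul _ x.1)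

/-- The image of an endomorphism, as a bimodule. -/
def image {B : FDBimod A} (p : B ⟶ B) : FDBimod A :=
  letI := imageRight p
  { carrier := LinearMap.range (Hom.lin p)
    comm := ⟨fun a b x => Subtype.ext (smul_comm a b x.1)⟩ }

lemma exists_split {B : FDBimod A} (p : B ⟶ B) (hp : p ≫ p = p) :
    ∃ (B' : FDBimod A) (i : B' ⟶ B) (r : B ⟶ B'), i ≫ r = 𝟙 B' ∧ r ≫ i = p := by
  have h : ∀ x, Hom.lin p (Hom.lin p x) = Hom.lin p x := fun x =>
    congrArg (fun q => Hom.lin q x) hp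
  refine ⟨image p, homMk (B := image p) (LinearMap.range (Hom.lin p)).subtype (fun _ _ => rfl),
    homMk (B' := image p) (Hom.lin p).rangeRestrict
      (fun a x => Subtype.ext (Hom.lin_op p a x)), ?_, ?_⟩
  · refine hom_ext fun x => Subtype.ext ?_
    obtain ⟨_, ⟨y, rfl⟩⟩ := x
    exact h y
  · exact hom_ext fun x => rfl

lemma isIso_of_bijective {B B' : FDBimod A} (f : B ⟶ B') (hf : Function.Bijective (Hom.lin f)) :
    IsIso f := by
  let e := LinearEquiv.ofBijective (Hom.lin f) hf
  refine ⟨homMk e.symm.toLinearMap fun a x => ?_, ?_, ?_⟩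
  · apply e.injective
    refine (e.apply_symm_apply _).trans ?_
    refine Eq.trans ?_ (Hom.lin_op f a (e.symm x)).symm
    exact congrArg (op a • ·) (e.apply_symm_apply x).symm
  · exact hom_ext fun x => e.symm_apply_apply x
  · exact hom_ext fun x => e.apply_symm_apply x

lemma lin_pow {B : FDBimod A} (f : End B) (n : ℕ) (x : B.carrier) :
    Hom.lin (f ^ n : End B) x = (Hom.lin f ^ n : Module.End A B.carrier) x := by
  induction n with
  | zero => rfl
  | succ n ih =>
    rw [pow_succ', pow_succ']
    change Hom.lin f (Hom.lin (f ^ n : End B) x) = _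
    rw [ih]
    rfl

/-- Fitting's lemma for bimodules. -/
lemma exists_fitting [IsArtinianRing A] {B : FDBimod A} (f : End B) :
    ∃ p : B ⟶ B, p ≫ p = p ∧ (p = 0 → IsNilpotent f) ∧ (p = 𝟙 B → IsIso (show B ⟶ B from f)) := by
  -- For a high power of `f` the bimodule is the direct sum of kernel and range. Both are stable
  -- under the right action, and `p` is the projection onto the range along the kernel. Taking the
  -- exponent `n + 1` makes it positive, so that bijectivity of the power passes to `f`.
  obtain ⟨n, hn⟩ := Filter.eventually_atTop.1
    (LinearMap.eventually_isCompl_ker_pow_range_pow (Hom.lin f : Module.End A B.carrier))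
  have hc := (hn (n + 1) (Nat.le_succ n)).symm
  set φ : Module.End A B.carrier := Hom.lin f
  set R := LinearMap.range (φ ^ (n + 1))
  set K := LinearMap.ker (φ ^ (n + 1))
  have hop : ∀ (a : A) x, (φ ^ (n + 1)) (op a • x) = op a • (φ ^ (n + 1)) x := fun a x => by
    rw [← lin_pow f, Hom.lin_op, lin_pow f]
  have hR : ∀ (a : A), ∀ x ∈ R, op a • x ∈ R := by
    rintro a _ ⟨x, rfl⟩
    exact ⟨op a • x, hop a x⟩
  have hK : ∀ (a : A), ∀ x ∈ K, op a • x ∈ K := by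
    intro a x hx
    rw [LinearMap.mem_ker] at hx ⊢
    rw [hop, hx, smul_zero]
  let π := R.projection K hc
  have hπ1 : ∀ x ∈ R, π x = x := fun x hx => Submodule.projection_apply_of_mem_left hc hx
  have hπ2 : ∀ x ∈ K, π x = 0 := fun x hx => Submodule.projection_apply_of_mem_right hc hx
  have hdec : ∀ x, ∃ y ∈ R, ∃ z ∈ K, y + z = x := fun x =>
    Submodule.mem_sup.1 (hc.sup_eq_top ▸ Submodule.mem_top)
  refine ⟨homMk π fun a x => ?_, hom_ext fun x => ?_, fun h => ⟨n + 1, hom_ext fun x => ?_⟩,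
    fun h => ?_⟩
  · obtain ⟨y, hy, z, hz, rfl⟩ := hdec x
    rw [smul_add, map_add, map_add, hπ1 _ (hR a y hy), hπ2 _ (hK a z hz), hπ1 y hy, hπ2 z hz,
      add_zero, add_zero]
  · obtain ⟨y, hy, z, hz, rfl⟩ := hdec x
    change π (π (y + z)) = π (y + z)
    rw [map_add, hπ1 y hy, hπ2 z hz, add_zero, hπ1 y hy]
  · have h1 : π ((φ ^ (n + 1)) x) = 0 := congrArg (fun q => Hom.lin q ((φ ^ (n + 1)) x)) h
    rw [hπ1 _ ⟨x, rfl⟩, ← lin_pow f] at h1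
    exact h1
  · have h1 : ∀ x, π x = x := fun x => congrArg (fun q => Hom.lin q x) h
    have hinj : Function.Injective (φ ^ (n + 1)) := by
      rw [← LinearMap.ker_eq_bot, eq_bot_iff]
      intro x hx
      rw [Submodule.mem_bot, ← h1 x, hπ2 x hx]
    have hsurj : Function.Surjective (φ ^ (n + 1)) := by
      intro x
      obtain ⟨y, hy, z, hz, rfl⟩ := hdec x
      have : y + z = y := by rw [← h1 (y + z), map_add, hπ1 y hy, hπ2 z hz, add_zero]
      rw [this]
      exact hy
    refine isIso_of_bijective _ ⟨?_, ?_⟩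
    · rw [pow_succ] at hinj
      exact Function.Injective.of_comp hinj
    · rw [pow_succ'] at hsurj
      exact Function.Surjective.of_comp hsurj

/-- A bimodule endomorphism of `A` is multiplication by the central element `p(1)`. For an
idempotent endomorphism this is a central idempotent, which is trivial by connectedness. -/
lemma regular_idempotent (hA : IsConnectedRing A) (p : regular A ⟶ regular A) (hp : p ≫ p = p) :
    p = 0 ∨ p = 𝟙 _ := by
  let z : A := Hom.lin p (1 : A)
  have h1 : ∀ a : A, Hom.lin p a = a * z := fun a =>
    (congrArg (Hom.lin p) (mul_one a).symm).trans (map_smul (Hom.lin p) a (1 : A))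
  have h2 : ∀ a : A, Hom.lin p a = z * a := fun a =>
    (congrArg (Hom.lin p) (one_mul a).symm).trans (Hom.lin_op p a (1 : A))
  have hz : IsIdempotentElem z := by
    have : Hom.lin p (Hom.lin p (1 : A)) = Hom.lin p (1 : A) :=
      congrArg (fun q => Hom.lin q (1 : A)) hp
    exact (h1 z).symm.trans this
  rcases hA.2 z hz (fun a => (h2 a).symm.trans (h1 a)) with h | h
  · left
    exact hom_ext fun (a : A) => (h1 a).trans (by rw [h, mul_zero]; rfl)
  · right
    exact hom_ext fun (a : A) => (h1 a).trans (by rw [h, mul_one]; rfl)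

end FDBimod

end Bimodules

/-! ## Tensoring `X ⊗_k -` with a bimodule -/

section Commute

open MulOpposite (op)
open FDBimod (Hom.lin Hom.lin_op homMk)

variable {k : Type u} [Field k] {A : Type u} [Ring A] [Algebra k A] [FiniteDimensional k A]

attribute [local instance] scalarModule

variable (X : FGModuleCat.{u} A) {B : FDBimod A}
  (hB : ∀ (c : k) (x : B.carrier), op (algebraMap k A c) • x = algebraMap k A c • x)

/-- The element `b ⊗ x` of `B ⊗_A X`. -/
def tmulObj {X : FGModuleCat.{u} A} {B : FDBimod A} (b : B.carrier) (x : X) :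
    (tensorFunctor B).obj X := (BTensor.tmul b x : BTensor B X)

/-- The map `x ⊗ m ↦ (b ⊗ x) ⊗ m`. -/
def stcommAux (b : B.carrier) (M : FGModuleCat.{u} A) :
    (scalarTensor k X).obj M →+ (scalarTensor k ((tensorFunctor B).obj X)).obj M :=
  stliftAdd
    (AddMonoidHom.mk' (fun x => (stmulLin (k := k) ((tensorFunctor B).obj X) M
        (tmulObj b x)).toAddMonoidHom) (fun x y => by
      ext m
      exact (congrArg (fun z => stmul k (X := (tensorFunctor B).obj X) z m)
        (BTensor.tmul_add b x y)).trans (add_stmul _ _ m)))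
    (fun c x m => by
      change stmul k (tmulObj b (c • x)) m =
        stmul k (tmulObj b x) (c • m)
      rw [stmul_smul, ← smul_stmul']
      refine congrArg (fun z => stmul k (X := (tensorFunctor B).obj X) z m) ?_
      -- Here centrality of `k` on `B` is needed: the scalar passes from `x` to the right of `b`,
      -- and from there to the left.
      refine (BTensor.op_tmul (algebraMap k A c) b x).symm.trans ?_
      rw [hB]
      exact BTensor.smul_tmul (algebraMap k A c) b x)

lemma stcommAux_stmul (b : B.carrier) {M : FGModuleCat.{u} A} (x : X) (m : M) :
    stcommAux X hB b M (stmul k x m) =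
      stmul k (tmulObj b x) m :=
  congrArg (fun m => stmul k (tmulObj b x) m)
    (one_smul A m)

/-- The map `b ⊗ (x ⊗ m) ↦ (b ⊗ x) ⊗ m`. -/
def stcommLin (M : FGModuleCat.{u} A) :
    BTensor B ((scalarTensor k X).obj M) →ₗ[A]
      (scalarTensor k ((tensorFunctor B).obj X)).obj M :=
  BTensor.lift (fun b z => stcommAux X hB b M z)
    (fun b b' z => st_add_ext (f := stcommAux X hB (b + b') M)
      (g := stcommAux X hB b M + stcommAux X hB b' M) (fun x m => by
        rw [AddMonoidHom.add_apply, stcommAux_stmul, stcommAux_stmul, stcommAux_stmul, ← add_stmul]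
        exact congrArg (fun z => stmul k (X := (tensorFunctor B).obj X) z m)
          (BTensor.add_tmul b b' x)) z)
    (fun b z z' => map_add _ z z')
    (fun a b z => st_add_ext (f := stcommAux X hB (a • b) M)
      (g := (DistribSMul.toAddMonoidHom _ a).comp (stcommAux X hB b M)) (fun x m => by
        change _ = a • stcommAux X hB b M (stmul k x m)
        rw [stcommAux_stmul, stcommAux_stmul, ← smul_stmul]
        rfl) z)
    (fun a b z => st_add_ext (f := stcommAux X hB (op a • b) M)
      (g := (stcommAux X hB b M).comp (DistribSMul.toAddMonoidHom _ a)) (fun x m => by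
        change _ = stcommAux X hB b M (stmul k (a • x) m)
        rw [stcommAux_stmul, stcommAux_stmul]
        exact congrArg (fun z => stmul k (X := (tensorFunctor B).obj X) z m)
          (BTensor.op_tmul a b x)) z)

lemma stcommLin_tmul (b : B.carrier) {M : FGModuleCat.{u} A} (x : X) (m : M) :
    stcommLin X hB M (BTensor.tmul b (stmul k x m)) =
      stmul k (tmulObj b x) m :=
  stcommAux_stmul X hB b x m

/-- The map `(b ⊗ x) ⊗ m ↦ b ⊗ (x ⊗ m)`. -/
def stcommInvLin (M : FGModuleCat.{u} A) :
    (scalarTensor k ((tensorFunctor B).obj X)).obj M →ₗ[A]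
      BTensor B ((scalarTensor k X).obj M) :=
  stlift (X := (tensorFunctor B).obj X) (M := M)
    (AddMonoidHom.mk' (fun y => AddMonoidHom.mk'
        (fun m => BTensor.map (𝟙 B) (topIncl k X m).hom.hom (y : BTensor B X)) (fun m m' =>
        BTensor.add_ext (f := (BTensor.map (𝟙 B) (topIncl k X (m + m')).hom.hom).toAddMonoidHom)
          (g := (BTensor.map (𝟙 B) (topIncl k X m).hom.hom +
            BTensor.map (𝟙 B) (topIncl k X m').hom.hom).toAddMonoidHom)
          (fun b x => (congrArg (BTensor.tmul b) (stmul_add x m m')).trans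
            (BTensor.tmul_add b _ _)) y))
      (fun y y' => by ext m; exact map_add (BTensor.map (𝟙 B) (topIncl k X m).hom.hom) _ _))
    (fun c y m => BTensor.add_ext
      (f := (BTensor.map (𝟙 B) (topIncl k X m).hom.hom).toAddMonoidHom.comp
        (DistribSMul.toAddMonoidHom _ (algebraMap k A c)))
      (g := (BTensor.map (𝟙 B) (topIncl k X (c • m)).hom.hom).toAddMonoidHom)
      (fun b x => by
        change BTensor.tmul (algebraMap k A c • b) (stmul k x m) =
          BTensor.tmul b (stmul k x (c • m))
        rw [← hB, BTensor.op_tmul, stmul_smul]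
        rfl) y)
    (fun a y m => map_smul (BTensor.map (𝟙 B) (topIncl k X m).hom.hom) a y)

lemma stcommInvLin_stmul (b : B.carrier) {M : FGModuleCat.{u} A} (x : X) (m : M) :
    stcommInvLin X hB M (stmul k (tmulObj b x) m) = BTensor.tmul b (stmul k x m) :=
  congrArg (fun m => BTensor.tmul b (stmul k x m)) (one_smul A m)

lemma st_tensor_ext {M N : FGModuleCat.{u} A}
    {f g : (scalarTensor k X ⋙ tensorFunctor B).obj M ⟶ N}
    (h : ∀ b x m, f.hom.hom (BTensor.tmul b (stmul k x m)) =
      g.hom.hom (BTensor.tmul b (stmul k x m))) : f = g :=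
  FGModuleCat.hom_ext (BTensor.lin_ext fun b z => st_add_ext (M := M)
    (f := f.hom.hom.toAddMonoidHom.comp (AddMonoidHom.mk' (fun z => BTensor.tmul b z)
      (BTensor.tmul_add b)))
    (g := g.hom.hom.toAddMonoidHom.comp (AddMonoidHom.mk' (fun z => BTensor.tmul b z)
      (BTensor.tmul_add b))) (fun x m => h b x m) z)

lemma tensor_st_ext {M N : FGModuleCat.{u} A}
    {f g : (scalarTensor k ((tensorFunctor B).obj X)).obj M ⟶ N}
    (h : ∀ b x m, f.hom.hom (stmul k (tmulObj b x) m) = g.hom.hom (stmul k (tmulObj b x) m)) : f = g :=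
  st_hom_ext fun y m => BTensor.add_ext (B := B) (M := X)
    (f := f.hom.hom.toAddMonoidHom.comp
      ((stmulLin (k := k) ((tensorFunctor B).obj X) M).flip m).toAddMonoidHom)
    (g := g.hom.hom.toAddMonoidHom.comp
      ((stmulLin (k := k) ((tensorFunctor B).obj X) M).flip m).toAddMonoidHom)
    (fun b x => h b x m) y

/-- The natural transformation `b ⊗ (x ⊗ m) ↦ (b ⊗ x) ⊗ m`. -/
def stcomm : scalarTensor k X ⋙ tensorFunctor B ⟶ scalarTensor k ((tensorFunctor B).obj X) where
  app M := FGModuleCat.ofHom (stcommLin X hB M)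
  naturality M N f := st_tensor_ext X fun b x m => by
    change stcommLin X hB N (BTensor.tmul b (stmul k x (f.hom.hom m))) =
      ((scalarTensor k ((tensorFunctor B).obj X)).map f).hom.hom
        (stcommLin X hB M (BTensor.tmul b (stmul k x m)))
    rw [stcommLin_tmul, stcommLin_tmul]
    rfl

/-- The natural transformation `(b ⊗ x) ⊗ m ↦ b ⊗ (x ⊗ m)`. -/
def stcommInv :
    scalarTensor k ((tensorFunctor B).obj X) ⟶ scalarTensor k X ⋙ tensorFunctor B where
  app M := FGModuleCat.ofHom (stcommInvLin X hB M)
  naturality M N f := tensor_st_ext X fun b x m => by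
    change stcommInvLin X hB N (stmul k (tmulObj b x) (f.hom.hom m)) =
      ((scalarTensor k X ⋙ tensorFunctor B).map f).hom.hom (stcommInvLin X hB M
        (stmul k (tmulObj b x) m))
    rw [stcommInvLin_stmul, stcommInvLin_stmul]
    rfl

lemma stcomm_stcommInv : stcomm X hB ≫ stcommInv X hB = 𝟙 _ := by
  ext M : 2
  refine st_tensor_ext X fun b x m => ?_
  change stcommInvLin X hB M (stcommLin X hB M (BTensor.tmul b (stmul k x m))) = _
  rw [stcommLin_tmul, stcommInvLin_stmul]
  rfl

/-- The reassociation does not touch the last factor, and `a` acts only there. So the idempotent `e`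
survives tensoring with `B` on the left. -/
lemma whisker_stact_stcomm (a : A) :
    Functor.whiskerRight (stact k X a) (tensorFunctor B) ≫ stcomm X hB =
      stcomm X hB ≫ stact k ((tensorFunctor B).obj X) a := by
  ext M : 2
  refine st_tensor_ext X fun b x m => ?_
  change stcommLin X hB M (BTensor.tmul b (((stact k X a).app M).hom.hom (stmul k x m))) =
    ((stact k ((tensorFunctor B).obj X) a).app M).hom.hom
      (stcommLin X hB M (BTensor.tmul b (stmul k x m)))
  rw [stact_stmul, stcommLin_tmul, stcommLin_tmul, stact_stmul]

end Commute

/-! ## The bimodules `X ⊗_k A` for `X` in the additive closure of projectives and injectives -/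

section ProjInj

open MulOpposite (op)
open FDBimod (Hom.lin Hom.lin_op homMk)

variable (k : Type u) [Field k] {A : Type u} [Ring A] [Algebra k A] [FiniteDimensional k A]

attribute [local instance] scalarModule

/-- The bimodule homomorphism `f ⊗ id`. -/
def outerMap {V W : Type u} [AddCommGroup V] [Module k V] [Module A V] [IsScalarTower k A V]
    [FiniteDimensional k V] [AddCommGroup W] [Module k W] [Module A W] [IsScalarTower k A W]
    [FiniteDimensional k W] (f : V →ₗ[A] W) : FDBimod.outer k A V ⟶ FDBimod.outer k A W :=
  homMk (B := FDBimod.outer k A V) (B' := FDBimod.outer k A W)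
    (TensorProduct.AlgebraTensorModule.map (R := k) (A := A) f (LinearMap.id : A →ₗ[k] A) :
      V ⊗[k] A →ₗ[A] W ⊗[k] A)
    (fun a x => Outer.add_ext
      (F := (TensorProduct.AlgebraTensorModule.map (R := k) (A := A) f
        (LinearMap.id : A →ₗ[k] A)).toAddMonoidHom.comp
          (DistribSMul.toAddMonoidHom (Outer k A V) (op a)))
      (G := (DistribSMul.toAddMonoidHom (Outer k A W) (op a)).comp
        (TensorProduct.AlgebraTensorModule.map (R := k) (A := A) f
          (LinearMap.id : A →ₗ[k] A)).toAddMonoidHom)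
      (fun v c => rfl) x)

lemma outer_hom_ext {V : Type u} [AddCommGroup V] [Module k V] [Module A V] [IsScalarTower k A V]
    [FiniteDimensional k V] {B : FDBimod A} {f g : FDBimod.outer k A V ⟶ B}
    (h : ∀ v c, Hom.lin f (Outer.tmul k A v c) = Hom.lin g (Outer.tmul k A v c)) : f = g :=
  FDBimod.hom_ext fun x => Outer.add_ext (F := (Hom.lin f).toAddMonoidHom)
    (G := (Hom.lin g).toAddMonoidHom) h x

/-- `X ↦ X ⊗_k A` as a functor. -/
def outerFunctor : FGModuleCat.{u} A ⥤ FDBimod A where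
  obj X := outerBimod k X
  map f := outerMap k f.hom.hom
  map_id X := outer_hom_ext k fun v c => rfl
  map_comp f g := outer_hom_ext k fun v c => rfl

instance : (outerFunctor k (A := A)).Additive where
  map_add {X Y f g} := outer_hom_ext k fun v c =>
    TensorProduct.add_tmul (f.hom.hom v) (g.hom.hom v) c

lemma outerMap_equiv {V W : Type u} [AddCommGroup V] [Module k V] [Module A V]
    [IsScalarTower k A V] [FiniteDimensional k V] [AddCommGroup W] [Module k W] [Module A W]
    [IsScalarTower k A W] [FiniteDimensional k W] (e : V ≃ₗ[A] W) :
    outerMap k e.toLinearMap ≫ outerMap k e.symm.toLinearMap = 𝟙 _ :=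
  outer_hom_ext k fun v c => congrArg (fun v => Outer.tmul k A v c) (e.symm_apply_apply v)

/-- The `k`-structure of `X` is restricted from `A`, while `V` carries its own as separate data. An
`A`-linear equivalence is what compares the two outer bimodules. -/
lemma addBimod_outerBimod_of {V : Type u} [AddCommGroup V] [Module k V] [Module A V]
    [IsScalarTower k A V] [FiniteDimensional k V] (h : IsGenerator k A (FDBimod.outer k A V))
    {X : FGModuleCat.{u} A} (e : X ≃ₗ[A] V) : addBimod k A (outerBimod k X) :=
  addClosure_retract (addBimod_of k A h) (outerMap k e.toLinearMap) (outerMap k e.symm.toLinearMap)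
    (outerMap_equiv k e)

lemma fg_sum_apply {M N : FGModuleCat.{u} A} {ι : Type*} (s : Finset ι) (f : ι → (M ⟶ N)) (m : M) :
    (∑ t ∈ s, f t).hom.hom m = ∑ t ∈ s, (f t).hom.hom m := FGModuleCat.hom_sum A s f m

/-- Finitely many generators give an epimorphism from a free module of finite rank, which splits by
projectivity. -/
lemma addClosure_of_projective (k : Type u) [Field k] {A : Type u} [Ring A] [Algebra k A]
    [FiniteDimensional k A] {X : FGModuleCat.{u} A} (hX : Projective X) :
    addClosure (fun Y => Y = FGModuleCat.of A A) X := by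
  obtain ⟨n, s, hs⟩ := Module.Finite.exists_fin (R := A) (M := X)
  let π : FGModuleCat.of A (Fin n → A) ⟶ X := FGModuleCat.ofHom (Fintype.linearCombination A s)
  have : IsNoetherianRing A :=
    isNoetherian_of_tower k (isNoetherian_of_isNoetherianRing_of_finite k A)
  have hπ : Function.Surjective (Fintype.linearCombination A s) := by
    rw [← LinearMap.range_eq_top, Fintype.range_linearCombination, hs]
  have : Epi π := by
    refine (forget₂ (FGModuleCat A) (ModuleCat A)).epi_of_epi_map ?_
    exact (ModuleCat.epi_iff_surjective π.hom).2 hπ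
  have h1 := Projective.factorThru_comp (𝟙 X) π
  refine ⟨n, fun _ => FGModuleCat.of A A, fun _ => rfl,
    fun t => Projective.factorThru (𝟙 X) π ≫ FGModuleCat.ofHom (LinearMap.proj t),
    fun t => orbitHom (s t), ?_⟩
  refine FGModuleCat.hom_ext (LinearMap.ext fun x => (fg_sum_apply _ _ x).trans ?_)
  exact congrArg (fun t => t.hom.hom x) h1

/-- The homomorphism `M → A*` given by a linear form. -/
def coorbitHom {M : FGModuleCat.{u} A} (ψ : M →ₗ[k] k) : M ⟶ FGModuleCat.of A (DualMod k A) :=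
  FGModuleCat.ofHom
    { toFun := fun m => (ψ ∘ₗ (Algebra.lsmul k k M : A →ₐ[k] _).toLinearMap.flip m : A →ₗ[k] k)
      map_add' := fun y y' => DualMod.ext fun a =>
          (congrArg ψ (smul_add a y y')).trans (map_add ψ _ _)
      map_smul' := fun c y => DualMod.ext fun a => congrArg ψ (mul_smul a c y).symm }

/-- Each coordinate form `ψ` on `X` gives the homomorphism `m ↦ (a ↦ ψ(a m))` into `A*`, whose value
at `1` is `ψ(m)`. Jointly they embed `X` into a finite power of `A*`, and the embedding splits by
injectivity. -/
lemma addClosure_of_injective {X : FGModuleCat.{u} A} (hX : Injective X) :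
    addClosure (fun Y => Y = FGModuleCat.of A (DualMod k A)) X := by
  let b := Module.finBasis k X
  let j : X →ₗ[A] (Fin (Module.finrank k X) → DualMod k A) :=
    LinearMap.pi fun t => (coorbitHom k (b.coord t)).hom.hom
  let ι : X ⟶ FGModuleCat.of A (Fin (Module.finrank k X) → DualMod k A) := FGModuleCat.ofHom j
  have : IsNoetherianRing A :=
    isNoetherian_of_tower k (isNoetherian_of_isNoetherianRing_of_finite k A)
  have hj : Function.Injective j := by
    intro x y hxy
    refine b.ext_elem fun t => ?_
    have := congrArg (fun z => (z t).form 1) hxy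
    change b.coord t ((1 : A) • x) = b.coord t ((1 : A) • y) at this
    rwa [one_smul, one_smul] at this
  have : Mono ι := by
    refine (forget₂ (FGModuleCat A) (ModuleCat A)).mono_of_mono_map ?_
    exact (ModuleCat.mono_iff_injective ι.hom).2 hj
  have h1 := Injective.comp_factorThru (𝟙 X) ι
  refine ⟨_, fun _ => FGModuleCat.of A (DualMod k A), fun _ => rfl,
    fun t => coorbitHom k (b.coord t),
    fun t => FGModuleCat.ofHom (LinearMap.single A (fun _ => DualMod k A) t) ≫
      Injective.factorThru (𝟙 X) ι, ?_⟩
  refine FGModuleCat.hom_ext (LinearMap.ext fun x => (fg_sum_apply _ _ x).trans ?_)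
  refine Eq.trans ?_ (congrArg (fun t => t.hom.hom x) h1)
  let ρ : (Fin (Module.finrank k X) → DualMod k A) →ₗ[A] X :=
    (Injective.factorThru (𝟙 X) ι).hom.hom
  change ∑ t, ρ (Pi.single t (j x t)) = ρ (j x)
  rw [← map_sum, Finset.univ_sum_single]

/-- The functor `X ↦ X ⊗_k A` is additive and sends `A` and `A*` to generators, and these two
modules generate all projectives and injectives under direct sums and summands. -/
lemma addBimod_outerBimod {X : FGModuleCat.{u} A} (hX : projInj _ X) :
    addBimod k A (outerBimod k X) := by
  refine addClosure_map (outerFunctor k) (P := fun X => Projective X ∨ Injective X)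
    (fun X h => ?_) hX
  rcases h with h | h
  · refine addClosure_map (outerFunctor k) (fun Y hY => ?_) (addClosure_of_projective k h)
    subst hY
    exact addBimod_outerBimod_of k (V := A) (Or.inr (Or.inl rfl)) (LinearEquiv.refl A A)
  · refine addClosure_map (outerFunctor k) (fun Y hY => ?_) (addClosure_of_injective k h)
    subst hY
    exact addBimod_outerBimod_of k (V := DualMod k A) (Or.inr (Or.inr rfl))
      (LinearEquiv.refl A (DualMod k A))

/-- Every bimodule in `add(A ⊕ (A ⊗_k A) ⊕ (A* ⊗_k A))` is a summand of a sum of copies of `A` and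
`X ⊗_k A` with `X` projective or injective. -/
lemma addBimod_iff_outerBimod {B : FDBimod A} (hB : addBimod k A B) :
    addClosure (fun Y => Y = FDBimod.regular A ∨
      ∃ X, projInj _ X ∧ Y = outerBimod k X) B := by
  have key : ∀ (V : Type u) [AddCommGroup V] [Module k V] [Module A V]
      [IsScalarTower k A V] [FiniteDimensional k V] (X : FGModuleCat.{u} A), projInj _ X →
      (X ≃ₗ[A] V) → addClosure (fun Y => Y = FDBimod.regular A ∨
        ∃ X, projInj _ X ∧ Y = outerBimod k X) (FDBimod.outer k A V) := by
    intro V _ _ _ _ _ X hX e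
    exact addClosure_retract (addClosure_of (Or.inr ⟨X, hX, rfl⟩)) (outerMap k e.symm.toLinearMap)
      (outerMap k e.toLinearMap) (outerMap_equiv k e.symm)
  refine addClosure_map (𝟭 _) (fun Y hY => ?_) hB
  rcases hY with rfl | rfl | rfl
  · exact addClosure_of (Or.inl rfl)
  · exact key A (FGModuleCat.of A A) (addClosure_of (Or.inl (projective_regular k)))
      (LinearEquiv.refl A A)
  · exact key (DualMod k A) (FGModuleCat.of A (DualMod k A))
      (addClosure_of (Or.inr (injective_dual k))) (LinearEquiv.refl A (DualMod k A))

end ProjInj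

/-! ## The category of 1-morphisms of `D_A` -/

section Endo

variable (k : Type u) [Field k] {A : Type u} [Ring A] [Algebra k A] [FiniteDimensional k A]
  {C : Type w} [SmallCategory C] [Preadditive C] [Linear k C] (E : C ≌ FGModuleCat.{u} A)

/-- The 1-morphisms of `D_A`. -/
abbrev DEndo := (DTwoCat.star : DTwoCat k E) ⟶ DTwoCat.star

/-- Conjugation with the equivalence `E`. -/
def conjEquiv : (FGModuleCat.{u} A ⥤ FGModuleCat.{u} A) ≌ (C ⥤ C) :=
  E.symm.congrRight.trans E.symm.congrLeft

/-- Conjugation is compatible with composition. -/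
def conjComp (T T' : FGModuleCat.{u} A ⥤ FGModuleCat.{u} A) :
    (conjEquiv E).functor.obj T ⋙ (conjEquiv E).functor.obj T' ≅
      (conjEquiv E).functor.obj (T ⋙ T') :=
  NatIso.ofComponents
    (fun M => E.inverse.mapIso (T'.mapIso (E.counitIso.app (T.obj (E.functor.obj M)))))
    (fun {M N} f => by
      change E.inverse.map (T'.map (E.functor.map (E.inverse.map (T.map (E.functor.map f))))) ≫
          E.inverse.map (T'.map (E.counit.app _)) =
        E.inverse.map (T'.map (E.counit.app _)) ≫ E.inverse.map (T'.map (T.map (E.functor.map f)))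
      rw [← Functor.map_comp, ← Functor.map_comp, ← Functor.map_comp, ← Functor.map_comp]
      exact congrArg (fun t => E.inverse.map (T'.map t)) (E.counit.naturality _))

/-- The comparison inserts the counit of `E` between the two functors, so the square is naturality
of the counit. -/
lemma conjComp_naturality {T T₁ : FGModuleCat.{u} A ⥤ FGModuleCat.{u} A} (f : T ⟶ T₁)
    (T' : FGModuleCat.{u} A ⥤ FGModuleCat.{u} A) :
    Functor.whiskerRight ((conjEquiv E).functor.map f) ((conjEquiv E).functor.obj T') ≫
        (conjComp E T₁ T').hom =
      (conjComp E T T').hom ≫ (conjEquiv E).functor.map (Functor.whiskerRight f T') := by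
  ext M
  change E.inverse.map (T'.map (E.functor.map (E.inverse.map (f.app (E.functor.obj M))))) ≫
      E.inverse.map (T'.map (E.counit.app _)) =
    E.inverse.map (T'.map (E.counit.app _)) ≫ E.inverse.map (T'.map (f.app (E.functor.obj M)))
  rw [← Functor.map_comp, ← Functor.map_comp, ← Functor.map_comp, ← Functor.map_comp]
  exact congrArg (fun t => E.inverse.map (T'.map t)) (E.counit.naturality _)

/-- The value of a conjugated functor. -/
def conjEval (T : FGModuleCat.{u} A ⥤ FGModuleCat.{u} A) (L : FGModuleCat.{u} A) :
    ((conjEquiv E).functor.obj T).obj (E.inverse.obj L) ≅ E.inverse.obj (T.obj L) :=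
  E.inverse.mapIso (T.mapIso (E.counitIso.app L))

lemma conjEval_naturality {T T' : FGModuleCat.{u} A ⥤ FGModuleCat.{u} A} (f : T ⟶ T')
    (L : FGModuleCat.{u} A) :
    ((conjEquiv E).functor.map f).app (E.inverse.obj L) ≫ (conjEval E T' L).hom =
      (conjEval E T L).hom ≫ E.inverse.map (f.app L) := by
  change E.inverse.map (f.app _) ≫ E.inverse.map (T'.map (E.counit.app L)) =
    E.inverse.map (T.map (E.counit.app L)) ≫ E.inverse.map (f.app L)
  rw [← Functor.map_comp, ← Functor.map_comp]
  exact congrArg E.inverse.map (f.naturality (E.counit.app L)).symm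

variable {k} in
lemma isDFunctor_conj {B : FDBimod A} (hB : addBimod k A B) :
    IsDFunctor k E ((conjEquiv E).functor.obj (tensorFunctor B)) :=
  ⟨B, hB, ⟨Functor.isoWhiskerLeft (E.functor ⋙ tensorFunctor B) E.counitIso⟩⟩

/-- The 1-morphism given by a bimodule. -/
def bimodObj (B : FDBimod A) (hB : addBimod k A B) : DEndo k E :=
  ⟨(conjEquiv E).functor.obj (tensorFunctor B), isDFunctor_conj E hB⟩

variable {k E}

/-- The 2-morphism given by a natural transformation of tensor functors. -/
def bimodMap {B B' : FDBimod A} {hB : addBimod k A B} {hB' : addBimod k A B'}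
    (f : tensorFunctor B ⟶ tensorFunctor B') : bimodObj k E B hB ⟶ bimodObj k E B' hB' :=
  DTwoCat.Hom₂.mk ((conjEquiv E).functor.map f)

/-- The natural transformation of a 2-morphism. -/
abbrev DNat {F G : DEndo k E} (f : F ⟶ G) : DTwoCat.Hom.functor F ⟶ DTwoCat.Hom.functor G :=
  DTwoCat.Hom₂.nat f

lemma dhom_ext {F G : DEndo k E} {f g : F ⟶ G} (h : DNat f = DNat g) : f = g :=
  DTwoCat.Hom₂.ext h

section

variable {B B' B'' : FDBimod A} {hB : addBimod k A B} {hB' : addBimod k A B'}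
  {hB'' : addBimod k A B''}

lemma bimodMap_id : bimodMap (E := E) (hB := hB) (hB' := hB) (𝟙 (tensorFunctor B)) = 𝟙 _ :=
  dhom_ext ((conjEquiv E).functor.map_id _)

lemma bimodMap_comp (f : tensorFunctor B ⟶ tensorFunctor B')
    (g : tensorFunctor B' ⟶ tensorFunctor B'') :
    bimodMap (E := E) (hB := hB) (hB' := hB'') (f ≫ g) =
      bimodMap (hB' := hB') f ≫ bimodMap g :=
  dhom_ext ((conjEquiv E).functor.map_comp _ _)

lemma bimodMap_surjective (f : bimodObj k E B hB ⟶ bimodObj k E B' hB') :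
    ∃ g, bimodMap g = f := by
  obtain ⟨g, hg⟩ := (conjEquiv E).functor.map_surjective (DNat f)
  exact ⟨g, dhom_ext hg⟩

lemma bimodMap_injective {f g : tensorFunctor B ⟶ tensorFunctor B'}
    (h : bimodMap (E := E) (hB := hB) (hB' := hB') f = bimodMap g) : f = g :=
  (conjEquiv E).functor.map_injective (congrArg DTwoCat.Hom₂.nat h)

variable [E.functor.Additive]

instance : E.inverse.Additive := E.inverse_additive

lemma bimodMap_add (f g : tensorFunctor B ⟶ tensorFunctor B') :
    bimodMap (E := E) (hB := hB) (hB' := hB') (f + g) = bimodMap f + bimodMap g :=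
  dhom_ext (NatTrans.ext (funext fun M => E.inverse.map_add))

lemma bimodMap_zero :
    bimodMap (E := E) (hB := hB) (hB' := hB') (0 : tensorFunctor B ⟶ tensorFunctor B') = 0 :=
  dhom_ext (NatTrans.ext (funext fun M => E.inverse.map_zero _ _))

end

variable (k E) in
/-- Bimodules as 1-morphisms. -/
def bimodFunctor : (addBimod k A).FullSubcategory ⥤ DEndo k E where
  obj B := bimodObj k E B.obj B.property
  map f := bimodMap (tensorNat f.hom)
  map_id B := (congrArg bimodMap (tensorNat_id B.obj)).trans bimodMap_id
  map_comp f g := (congrArg bimodMap (tensorNat_comp f.hom g.hom)).trans (bimodMap_comp _ _)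

/-- With the faithfulness and essential surjectivity below, `bimodFunctor` is an equivalence onto
the category of 1-morphisms. Splitting of idempotents and Fitting's lemma are transported along it.
-/
instance : (bimodFunctor k E).Full where
  map_surjective {B B'} f := by
    obtain ⟨g, rfl⟩ := bimodMap_surjective (hB := B.property) (hB' := B'.property) f
    exact ⟨ObjectProperty.homMk (natBimod g), congrArg bimodMap (tensorNat_natBimod g)⟩

instance : (bimodFunctor k E).Faithful where
  map_injective {B B' f g} h := ObjectProperty.hom_ext _
    (tensorNat_injective (bimodMap_injective (hB := B.property) (hB' := B'.property) h))

instance [E.functor.Additive] : (bimodFunctor k E).Additive where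
  map_add {B B' f g} := (congrArg bimodMap (tensorNat_add f.hom g.hom)).trans (bimodMap_add _ _)

lemma exists_iso_bimodObj (F : DEndo k E) :
    ∃ (B : FDBimod A) (hB : addBimod k A B), Nonempty (F ≅ bimodObj k E B hB) := by
  obtain ⟨B, hB, ⟨e⟩⟩ := DTwoCat.Hom.property F
  refine ⟨B, hB, ⟨DTwoCat.isoMk (F := F) (G := bimodObj k E B hB) ?_⟩⟩
  exact (DTwoCat.Hom.functor F).rightUnitor.symm ≪≫
    Functor.isoWhiskerLeft _ E.unitIso ≪≫ (Functor.associator _ _ _).symm ≪≫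
    Functor.isoWhiskerRight e E.inverse ≪≫ Functor.associator _ _ _

instance : (bimodFunctor k E).EssSurj where
  mem_essImage F := by
    obtain ⟨B, hB, ⟨e⟩⟩ := exists_iso_bimodObj F
    exact ⟨⟨B, hB⟩, ⟨e.symm⟩⟩

variable [E.functor.Additive]

/-- The idempotent corresponds to one of a bimodule. Its image is a summand of a bimodule in the
additive closure, hence again defines a 1-morphism. -/
lemma dendo_exists_split (F : DEndo k E) (p : F ⟶ F) (hp : p ≫ p = p) :
    ∃ (Y : DEndo k E) (i : Y ⟶ F) (r : F ⟶ Y), i ≫ r = 𝟙 Y ∧ r ≫ i = p := by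
  let R := bimodFunctor k E
  let e := R.objObjPreimageIso F
  obtain ⟨q, hq⟩ := R.map_surjective (e.hom ≫ p ≫ e.inv)
  have hq2 : q ≫ q = q := R.map_injective (by
    rw [R.map_comp, hq]
    simp only [Category.assoc, Iso.inv_hom_id_assoc]
    rw [reassoc_of% hp])
  obtain ⟨B', i, r, hir, hri⟩ := FDBimod.exists_split q.hom (congrArg (·.hom) hq2)
  have hB' : addBimod k A B' := addClosure_retract (R.objPreimage F).property i r hir
  let Y : (addBimod k A).FullSubcategory := ⟨B', hB'⟩
  let i' : Y ⟶ R.objPreimage F := ObjectProperty.homMk i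
  let r' : R.objPreimage F ⟶ Y := ObjectProperty.homMk r
  have h1 : i' ≫ r' = 𝟙 Y := ObjectProperty.hom_ext _ hir
  have h2 : r' ≫ i' = q := ObjectProperty.hom_ext _ hri
  refine ⟨R.obj Y, R.map i' ≫ e.hom, e.inv ≫ R.map r', ?_, ?_⟩
  · rw [Category.assoc, Iso.hom_inv_id_assoc, ← R.map_comp, h1, R.map_id]
  · rw [Category.assoc, ← R.map_comp_assoc, h2, hq]
    simp

lemma isArtinianRing_of_finiteDimensional (k : Type u) [Field k] (A : Type u) [Ring A]
    [Algebra k A] [FiniteDimensional k A] : IsArtinianRing A := IsArtinianRing.of_finite k A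

/-- This is `FDBimod.exists_fitting` for the corresponding bimodule, conjugated back to `F`.
Nilpotency and invertibility are preserved by the equivalence. -/
lemma dendo_exists_fitting (F : DEndo k E) (f : End F) :
    ∃ p : F ⟶ F, p ≫ p = p ∧ (p = 0 → IsNilpotent f) ∧ (p = 𝟙 F → IsUnit f) := by
  have := isArtinianRing_of_finiteDimensional k A
  let R := bimodFunctor k E
  let e := R.objObjPreimageIso F
  obtain ⟨g, hg⟩ := R.map_surjective (e.hom ≫ f ≫ e.inv)
  obtain ⟨p, hp, h0, h1⟩ := FDBimod.exists_fitting (g.hom : End (R.objPreimage F).obj)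
  let p' : R.objPreimage F ⟶ R.objPreimage F := ObjectProperty.homMk p
  have hp' : p' ≫ p' = p' := ObjectProperty.hom_ext _ hp
  have hf : f = e.conj (R.map g) := by
    rw [hg]
    simp [Iso.conj_apply]
  refine ⟨e.inv ≫ R.map p' ≫ e.hom, ?_, fun h => ?_, fun h => ?_⟩
  · simp only [Category.assoc, Iso.hom_inv_id_assoc]
    rw [← R.map_comp_assoc, hp']
  · have h2 : p' = 0 := R.map_injective (by
      rw [R.map_zero]
      have := congrArg (fun t => e.hom ≫ t ≫ e.inv) h
      simpa using this)
    obtain ⟨n, hn⟩ := h0 (congrArg (·.hom) h2)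
    let g' : End (R.objPreimage F) := g
    have h3 : g' ^ n = (0 : R.objPreimage F ⟶ R.objPreimage F) :=
      ObjectProperty.hom_ext _ ((map_pow ((addBimod k A).ι.mapEnd (R.objPreimage F)) g' n).trans hn)
    refine ⟨n, ?_⟩
    have h4 : f ^ n = e.conj (R.mapEnd (R.objPreimage F) (g' ^ n)) := by
      rw [map_pow, map_pow]
      exact congrArg (· ^ n) hf
    have h5 : R.mapEnd (R.objPreimage F) (g' ^ n) = (0 : R.obj _ ⟶ R.obj _) :=
      (congrArg R.map h3).trans (R.map_zero _ _)
    rw [h4, h5, Iso.conj_apply, Limits.zero_comp, Limits.comp_zero]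
  · have h2 : p' = 𝟙 _ := R.map_injective (by
      rw [R.map_id]
      have := congrArg (fun t => e.hom ≫ t ≫ e.inv) h
      simpa using this)
    have h3 := h1 (congrArg (·.hom) h2)
    have h4 : IsIso g := by
      refine ⟨ObjectProperty.homMk (inv g.hom), ?_, ?_⟩
      · exact ObjectProperty.hom_ext _ (IsIso.hom_inv_id g.hom)
      · exact ObjectProperty.hom_ext _ (IsIso.inv_hom_id g.hom)
    rw [isUnit_iff_isIso, hf]
    change IsIso (e.inv ≫ R.map g ≫ e.hom)
    infer_instance

end Endo

/-! ### Idempotents of indecomposable objects and local rings -/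

section Local

variable {D : Type*} [Category D] [Preadditive D]

/-- Splitting both `p` and `𝟙 F - p` writes `F` as a biproduct of the two images, one of which must
be zero. -/
lemma IsIndecomposable.idempotent
    (hD : ∀ (F : D) (p : F ⟶ F), p ≫ p = p → ∃ (Y : D) (i : Y ⟶ F) (r : F ⟶ Y),
      i ≫ r = 𝟙 Y ∧ r ≫ i = p) {F : D} (hF : IsIndecomposable F) (p : F ⟶ F) (hp : p ≫ p = p) :
    p = 0 ∨ p = 𝟙 F := by
  obtain ⟨Y, i, r, hir, hri⟩ := hD F p hp
  obtain ⟨Y', i', r', hir', hri'⟩ := hD F (𝟙 F - p) (by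
    simp [Preadditive.sub_comp, Preadditive.comp_sub, hp])
  have h1 : i ≫ p = i := by rw [← hri, reassoc_of% hir]
  have h2 : p ≫ r = r := by rw [← hri, Category.assoc, hir, Category.comp_id]
  have h3 : i' ≫ (𝟙 F - p) = i' := by rw [← hri', reassoc_of% hir']
  have h4 : (𝟙 F - p) ≫ r' = r' := by rw [← hri', Category.assoc, hir', Category.comp_id]
  have h5 : p ≫ (𝟙 F - p) = 0 := by rw [Preadditive.comp_sub, Category.comp_id, hp, sub_self]
  have h6 : (𝟙 F - p) ≫ p = 0 := by rw [Preadditive.sub_comp, Category.id_comp, hp, sub_self]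
  let b : Limits.BinaryBicone Y Y' :=
    { pt := F
      fst := r
      snd := r'
      inl := i
      inr := i'
      inl_fst := hir
      inr_snd := hir'
      inl_snd := by rw [← h1, ← h4, Category.assoc, reassoc_of% h5]; simp
      inr_fst := by rw [← h3, ← h2, Category.assoc, reassoc_of% h6]; simp }
  have hb : b.IsBilimit := Limits.isBinaryBilimitOfTotal b (by
    change r ≫ i + r' ≫ i' = 𝟙 F
    rw [hri, hri', add_sub_cancel])
  rcases hF.2 Y Y' b ⟨hb⟩ ⟨Iso.refl F⟩ with h | h
  · left
    rw [← hri, h.eq_of_tgt r 0, Limits.zero_comp]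
  · right
    have : 𝟙 F - p = 0 := by rw [← hri', h.eq_of_tgt r' 0, Limits.zero_comp]
    exact (sub_eq_zero.1 this).symm

lemma exists_isUnit_of_sum {R : Type*} [Ring R] [IsLocalRing R] {ι : Type*} (s : Finset ι)
    (x : ι → R) (h : IsUnit (∑ t ∈ s, x t)) : ∃ t ∈ s, IsUnit (x t) := by
  classical
  induction s using Finset.induction_on with
  | empty =>
    rw [Finset.sum_empty] at h
    exact (not_isUnit_zero h).elim
  | insert a s ha ih =>
    rw [Finset.sum_insert ha] at h
    rcases IsLocalRing.isUnit_or_isUnit_of_isUnit_add h with h | h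
    · exact ⟨a, Finset.mem_insert_self a s, h⟩
    · obtain ⟨t, ht, hu⟩ := ih h
      exact ⟨t, Finset.mem_insert_of_mem ht, hu⟩

/-- Needed because `bimodFunctor` starts from a full subcategory, while decompositions of bimodules
are found in the ambient category. -/
lemma addClosure_fullSubcategory {P Q : ObjectProperty D} (hPQ : ∀ Y, P Y → Q Y)
    {X : Q.FullSubcategory} (h : addClosure P X.obj) :
    addClosure (fun Y : Q.FullSubcategory => P Y.obj) X := by
  obtain ⟨n, Y, hY, a, b, hab⟩ := h
  refine ⟨n, fun t => ⟨Y t, hPQ _ (hY t)⟩, hY, fun t => ObjectProperty.homMk (a t),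
    fun t => ObjectProperty.homMk (b t), Q.ι.map_injective ?_⟩
  rw [Functor.map_sum]
  exact hab

end Local

/-! ### Decomposition of 1-morphisms into indecomposables -/

section Endo

variable {k : Type u} [Field k] {A : Type u} [Ring A] [Algebra k A] [FiniteDimensional k A]
  {C : Type w} [SmallCategory C] [Preadditive C] [Linear k C] {E : C ≌ FGModuleCat.{u} A}
  [E.functor.Additive]

/-- The Fitting projection of `f` is an idempotent of an indecomposable object, hence `0` or the
identity. So `f` is nilpotent or invertible. -/
lemma dendo_isLocalRing {F : DEndo k E} (hF : IsIndecomposable F) : IsLocalRing (End F) := by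
  have : Nontrivial (End F) := ⟨⟨(𝟙 F : F ⟶ F), (0 : F ⟶ F), fun h =>
    hF.1 ((Limits.IsZero.iff_id_eq_zero F).2 h)⟩⟩
  refine IsLocalRing.of_isUnit_or_isUnit_one_sub_self fun f => ?_
  obtain ⟨p, hp, h0, h1⟩ := dendo_exists_fitting F f
  rcases hF.idempotent dendo_exists_split p hp with h | h
  · exact Or.inr (h0 h).isUnit_one_sub
  · exact Or.inl (h1 h)

/-- An indecomposable 1-morphism is a summand of one of the summands in any decomposition. -/
lemma exists_retract_of_addClosure {P : ObjectProperty (DEndo k E)} {F : DEndo k E}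
    (hF : IsIndecomposable F) (h : addClosure P F) : ∃ Y, P Y ∧ Nonempty (Retract F Y) := by
  have := dendo_isLocalRing hF
  obtain ⟨n, Y, hY, a, b, hab⟩ := h
  -- The identity of `F` is a sum of endomorphisms that factor through the `Y t`. In a local ring
  -- one of them is invertible, and its inverse turns the factorization into a retraction.
  obtain ⟨t, -, ht⟩ := exists_isUnit_of_sum (R := End F) Finset.univ (fun t => a t ≫ b t) (by
    have h1 : ∑ t, (show End F from a t ≫ b t) = 1 := hab
    rw [h1]
    exact isUnit_one)
  rw [isUnit_iff_isIso] at ht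
  refine ⟨Y t, hY t, ⟨⟨inv (a t ≫ b t) ≫ a t, b t, ?_⟩⟩⟩
  rw [Category.assoc, IsIso.inv_hom_id]

variable (k E) in
/-- The 1-morphism `X ⊗_k -`. -/
def scalarObj (X : FGModuleCat.{u} A) (hX : projInj _ X) : DEndo k E :=
  bimodObj k E (outerBimod k X) (addBimod_outerBimod k hX)

lemma dendo_addClosure (F : DEndo k E) :
    addClosure (fun Y => Y = bimodObj k E (FDBimod.regular A) (addBimod_regular k A) ∨
      ∃ X hX, Y = scalarObj k E X hX) F := by
  obtain ⟨B, hB, ⟨e⟩⟩ := exists_iso_bimodObj F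
  refine addClosure_retract (Y := bimodObj k E B hB) ?_ e.hom e.inv e.hom_inv_id
  have h1 := addClosure_fullSubcategory (Q := addBimod k A) (X := ⟨B, hB⟩) (fun Y hY => by
    rcases hY with rfl | ⟨X, hX, rfl⟩
    · exact addBimod_regular k A
    · exact addBimod_outerBimod k hX) (addBimod_iff_outerBimod k hB)
  refine addClosure_map (bimodFunctor k E) ?_ h1
  rintro ⟨Y, hY⟩ (rfl | ⟨X, hX, rfl⟩)
  · exact addClosure_of (Or.inl rfl)
  · exact addClosure_of (Or.inr ⟨X, hX, rfl⟩)

variable (k E) in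
/-- The regular bimodule gives the identity. -/
def regularIso :
    bimodObj k E (FDBimod.regular A) (addBimod_regular k A) ≅ 𝟙 (DTwoCat.star : DTwoCat k E) :=
  DTwoCat.isoMk (F := bimodObj k E (FDBimod.regular A) (addBimod_regular k A))
    (G := DTwoCat.idHom _)
    ((conjEquiv E).functor.mapIso tensorFunctorRegular ≪≫ E.unitIso.symm)

/-- A nonzero summand of the identity is isomorphic to it. -/
lemma iso_id_of_retract (hA : IsConnectedRing A) {F : DEndo k E} (hF : ¬ Limits.IsZero F)
    (r : Retract F (bimodObj k E (FDBimod.regular A) (addBimod_regular k A))) :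
    Nonempty (F ≅ 𝟙 (DTwoCat.star : DTwoCat k E)) := by
  let R : (addBimod k A).FullSubcategory := ⟨FDBimod.regular A, addBimod_regular k A⟩
  -- The projection onto the summand comes from an idempotent bimodule endomorphism of `A`.
  -- Connectedness leaves only `0`, excluded since `F` is nonzero, and the identity.
  obtain ⟨p, hp⟩ := (bimodFunctor k E).map_surjective
    (show (bimodFunctor k E).obj R ⟶ (bimodFunctor k E).obj R from r.r ≫ r.i)
  have hpp : p ≫ p = p := (bimodFunctor k E).map_injective (by
    rw [Functor.map_comp, hp]
    change (r.r ≫ r.i) ≫ r.r ≫ r.i = r.r ≫ r.i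
    rw [Category.assoc, r.retract_assoc])
  rcases FDBimod.regular_idempotent hA p.hom (congrArg (·.hom) hpp) with h | h
  · exfalso
    have h1 : p = 0 := ObjectProperty.hom_ext _ h
    rw [h1, Functor.map_zero] at hp
    apply hF
    rw [Limits.IsZero.iff_id_eq_zero]
    have h2 : r.r ≫ r.i = 0 := hp.symm
    have h3 : 𝟙 F = r.i ≫ (r.r ≫ r.i) ≫ r.r := by
      rw [Category.assoc, r.retract_assoc, r.retract]
    rw [h3, h2, Limits.zero_comp, Limits.comp_zero]
  · have h1 : p = 𝟙 R := ObjectProperty.hom_ext _ h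
    rw [h1, CategoryTheory.Functor.map_id] at hp
    exact ⟨⟨r.i, r.r, r.retract, hp.symm⟩ ≪≫ regularIso k E⟩

end Endo

/-! ## Evaluation of 1-morphisms at the top of an indecomposable projective module -/

section Cut

variable {k : Type u} [Field k] {A : Type u} [Ring A] [Algebra k A] [FiniteDimensional k A]
  {C : Type w} [SmallCategory C] [Preadditive C] [Linear k C] {E : C ≌ FGModuleCat.{u} A}
  [E.functor.Additive]

attribute [local instance] scalarModule

/-- Evaluation of 1-morphisms at an object. -/
def evalAt (M : C) : DEndo k E ⥤ C where
  obj F := (DTwoCat.Hom.functor F).obj M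
  map f := (DNat f).app M
  map_id _ := rfl
  map_comp _ _ := rfl

instance (M : C) : (evalAt (k := k) (E := E) M).Additive where
  map_add := rfl

/-- The value of `X ⊗_k -`. -/
def evalScalar (X : FGModuleCat.{u} A) (hX : projInj _ X) (L : FGModuleCat.{u} A) :
    (evalAt (E.inverse.obj L)).obj (scalarObj k E X hX) ≅
      E.inverse.obj ((scalarTensor k X).obj L) :=
  conjEval E (scalarTensor k X) L

variable {X Y : FGModuleCat.{u} A} {hX : projInj _ X} {hY : projInj _ Y}

variable (k E) in
/-- The 2-morphism induced by a natural transformation. -/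
abbrev scalarMap (hX : projInj _ X) (hY : projInj _ Y) (f : scalarTensor k X ⟶ scalarTensor k Y) :
    scalarObj k E X hX ⟶ scalarObj k E Y hY := bimodMap f

lemma evalScalar_naturality (f : scalarTensor k X ⟶ scalarTensor k Y) (L : FGModuleCat.{u} A) :
    (evalAt (E.inverse.obj L)).map (scalarMap k E hX hY f) ≫ (evalScalar Y hY L).hom =
      (evalScalar X hX L).hom ≫ E.inverse.map (f.app L) :=
  conjEval_naturality E f L

lemma evalAt_scalarMap (f : scalarTensor k X ⟶ scalarTensor k Y) (L : FGModuleCat.{u} A) :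
    (evalAt (E.inverse.obj L)).map (scalarMap k E hX hY f) =
      (evalScalar X hX L).hom ≫ E.inverse.map (f.app L) ≫ (evalScalar Y hY L).inv := by
  rw [← Category.assoc, Iso.eq_comp_inv, evalScalar_naturality]

lemma evalAt_scalarMap_eq_zero_iff (f : scalarTensor k X ⟶ scalarTensor k Y)
    (L : FGModuleCat.{u} A) :
    (evalAt (E.inverse.obj L)).map (scalarMap k E hX hY f) = 0 ↔ f.app L = 0 := by
  rw [evalAt_scalarMap]
  constructor
  · intro h
    have h1 := congrArg (fun t => (evalScalar X hX L).inv ≫ t ≫ (evalScalar Y hY L).hom) h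
    simp only [Category.assoc, Iso.inv_hom_id, Iso.inv_hom_id_assoc, Category.comp_id,
      Limits.zero_comp, Limits.comp_zero] at h1
    exact E.inverse.map_injective (h1.trans (E.inverse.map_zero _ _).symm)
  · intro h
    rw [h, Functor.map_zero, Limits.zero_comp, Limits.comp_zero]

variable (k E) in
/-- The idempotent of `X ⊗_k -` given by `e`. -/
def cutMap (e : A) (X : FGModuleCat.{u} A) (hX : projInj _ X) :
    scalarObj k E X hX ⟶ scalarObj k E X hX := scalarMap k E hX hX (stact k X e)

lemma cutMap_idem {e : A} (he : IsIdempotentElem e) (X : FGModuleCat.{u} A) (hX : projInj _ X) :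
    cutMap k E e X hX ≫ cutMap k E e X hX = cutMap k E e X hX := by
  refine (bimodMap_comp _ _).symm.trans (congrArg bimodMap ?_)
  rw [stact_comp, he.eq]

variable (k) in
/-- A 1-morphism which is a summand of `X ⊗_k e(-)`. -/
structure CutRetract (e : A) (F : DEndo k E) where
  X : FGModuleCat.{u} A
  projInj_X : projInj _ X
  i : F ⟶ scalarObj k E X projInj_X
  r : scalarObj k E X projInj_X ⟶ F
  i_cut : i ≫ cutMap k E e X projInj_X = i
  cut_r : cutMap k E e X projInj_X ≫ r = r
  i_r : i ≫ r = 𝟙 F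

/-- Constructor from a factorization of the identity through the idempotent. -/
def CutRetract.mk' {e : A} (he : IsIdempotentElem e) {F : DEndo k E} {X : FGModuleCat.{u} A}
    (hX : projInj _ X) (i : F ⟶ scalarObj k E X hX) (r : scalarObj k E X hX ⟶ F)
    (h : i ≫ cutMap k E e X hX ≫ r = 𝟙 F) : CutRetract k e F where
  X := X
  projInj_X := hX
  i := i ≫ cutMap k E e X hX
  r := cutMap k E e X hX ≫ r
  i_cut := by rw [Category.assoc, cutMap_idem he]
  cut_r := by rw [← Category.assoc, cutMap_idem he]
  i_r := by rw [Category.assoc, ← Category.assoc (cutMap k E e X hX), cutMap_idem he, h]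

/-- A summand of a cut 1-morphism is cut. -/
def CutRetract.ofRetract {e : A} (he : IsIdempotentElem e) {F G : DEndo k E}
    (c : CutRetract k e G) (s : Retract F G) : CutRetract k e F where
  X := c.X
  projInj_X := c.projInj_X
  i := s.i ≫ c.i
  r := c.r ≫ s.r
  i_cut := by rw [Category.assoc, c.i_cut]
  cut_r := by rw [← Category.assoc, c.cut_r]
  i_r := by rw [Category.assoc, ← Category.assoc c.i, c.i_r, Category.id_comp, s.retract]

/-- If `H` is tensoring with `B`, the new module is `Y = B ⊗_A X`, by the reassociation `stcomm`,
which commutes with the action of `e`. Only the split monomorphism is recorded, as summands are all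
that matters. -/
lemma cutMap_whiskerRight_retract (e : A) (X : FGModuleCat.{u} A) (hX : projInj _ X)
    (H : DEndo k E) : ∃ (Y : FGModuleCat.{u} A) (hY : projInj _ Y)
      (i : scalarObj k E X hX ≫ H ⟶ scalarObj k E Y hY)
      (r : scalarObj k E Y hY ⟶ scalarObj k E X hX ≫ H),
      i ≫ r = 𝟙 _ ∧ cutMap k E e X hX ▷ H ≫ i = i ≫ cutMap k E e Y hY := by
  obtain ⟨B, hB, ⟨φ⟩⟩ := exists_iso_bimodObj H
  let Y := (tensorFunctor B).obj X
  have hY : projInj _ Y := projInj_tensor k hB hX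
  have hc := addBimod_central k A hB
  let ν : scalarObj k E X hX ≫ bimodObj k E B hB ⟶ scalarObj k E Y hY :=
    DTwoCat.Hom₂.mk ((conjComp E (scalarTensor k X) (tensorFunctor B)).hom ≫
      (conjEquiv E).functor.map (stcomm X hc))
  let ν' : scalarObj k E Y hY ⟶ scalarObj k E X hX ≫ bimodObj k E B hB :=
    DTwoCat.Hom₂.mk ((conjEquiv E).functor.map (stcommInv X hc) ≫
      (conjComp E (scalarTensor k X) (tensorFunctor B)).inv)
  have h0 : ((conjComp E (scalarTensor k X) (tensorFunctor B)).hom ≫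
      (conjEquiv E).functor.map (stcomm X hc)) ≫ (conjEquiv E).functor.map (stcommInv X hc) ≫
      (conjComp E (scalarTensor k X) (tensorFunctor B)).inv = 𝟙 _ := by
    rw [Category.assoc, ← Functor.map_comp_assoc, stcomm_stcommInv, CategoryTheory.Functor.map_id,
      Category.id_comp, Iso.hom_inv_id]
  have h1 : ν ≫ ν' = 𝟙 _ := dhom_ext h0
  have h2 : cutMap k E e X hX ▷ bimodObj k E B hB ≫ ν = ν ≫ cutMap k E e Y hY := by
    refine dhom_ext ?_
    change Functor.whiskerRight ((conjEquiv E).functor.map (stact k X e))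
        ((conjEquiv E).functor.obj (tensorFunctor B)) ≫
        (conjComp E (scalarTensor k X) (tensorFunctor B)).hom ≫
          (conjEquiv E).functor.map (stcomm X hc) =
      ((conjComp E (scalarTensor k X) (tensorFunctor B)).hom ≫
          (conjEquiv E).functor.map (stcomm X hc)) ≫ (conjEquiv E).functor.map (stact k Y e)
    rw [← Category.assoc, conjComp_naturality, Category.assoc, Category.assoc, ← Functor.map_comp,
      ← Functor.map_comp, whisker_stact_stcomm]
  refine ⟨Y, hY, scalarObj k E X hX ◁ φ.hom ≫ ν, ν' ≫ scalarObj k E X hX ◁ φ.inv, ?_, ?_⟩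
  · rw [Category.assoc, reassoc_of% h1, ← whiskerLeft_comp, Iso.hom_inv_id, whiskerLeft_id]
  -- The exchange law moves the cut past the isomorphism of `H` with a bimodule functor.
  · rw [Category.assoc, ← h2, whisker_exchange_assoc]

/-- Cut 1-morphisms are stable under composition with arbitrary 1-morphisms. -/
lemma CutRetract.comp {e : A} (he : IsIdempotentElem e) {F : DEndo k E} (c : CutRetract k e F)
    (H : DEndo k E) : Nonempty (CutRetract k e (F ≫ H)) := by
  obtain ⟨Y, hY, i, r, hir, hcut⟩ := cutMap_whiskerRight_retract e c.X c.projInj_X H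
  refine ⟨CutRetract.mk' he hY (c.i ▷ H ≫ i) (r ≫ c.r ▷ H) ?_⟩
  rw [Category.assoc, ← reassoc_of% hcut, reassoc_of% hir, ← comp_whiskerRight,
    ← comp_whiskerRight, c.cut_r, c.i_r, id_whiskerRight]

section Top

variable {e : A} {L : FGModuleCat.{u} A} {l : L}

/-- The statement for transformations of tensor functors carries over because conjugation with `E`
is full and faithful and vanishing at the top is unaffected by it. A cut on the source alone
suffices. -/
lemma IsTopOf.dendo_idempotent_eq_zero (h : IsTopOf k e L l) {p : scalarObj k E X hX ⟶ _}
    (hp : p ≫ p = p) (hc : cutMap k E e X hX ≫ p = p)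
    (h0 : (evalAt (E.inverse.obj L)).map p = 0) : p = 0 := by
  obtain ⟨p, rfl⟩ := bimodMap_surjective p
  rw [h.idempotent_eq_zero (p := p) (bimodMap_injective ((bimodMap_comp p p).trans hp))
    (bimodMap_injective ((bimodMap_comp _ p).trans hc))
    ((evalAt_scalarMap_eq_zero_iff p L).1 h0)]
  exact bimodMap_zero

/-- The factorization at the level of modules is conjugated by `E`, with `conjComp` identifying
composites of conjugated functors. -/
lemma IsTopOf.dendo_exists_factorization (h : IsTopOf k e L l) (he : IsPrimitiveIdempotent e)
    {f : scalarObj k E X hX ⟶ scalarObj k E Y hY} (hf : cutMap k E e X hX ≫ f = f)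
    (hf' : f ≫ cutMap k E e Y hY = f) (h0 : (evalAt (E.inverse.obj L)).map f ≠ 0)
    (Z : FGModuleCat.{u} A) (hZ : projInj _ Z) :
    ∃ (a : scalarObj k E Z hZ ⟶ scalarObj k E X hX ≫ scalarObj k E Z hZ)
      (b : scalarObj k E Y hY ≫ scalarObj k E Z hZ ⟶ scalarObj k E Z hZ),
      a ≫ f ▷ scalarObj k E Z hZ ≫ b = cutMap k E e Z hZ := by
  obtain ⟨f, rfl⟩ := bimodMap_surjective f
  obtain ⟨a, b, hab⟩ := h.exists_factorization he (f := f)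
    (bimodMap_injective ((bimodMap_comp _ f).trans hf))
    (bimodMap_injective ((bimodMap_comp f _).trans hf'))
    (fun h => h0 ((evalAt_scalarMap_eq_zero_iff f L).2 h)) Z
  refine ⟨DTwoCat.Hom₂.mk ((conjEquiv E).functor.map a ≫
      (conjComp E (scalarTensor k X) (scalarTensor k Z)).inv),
    DTwoCat.Hom₂.mk ((conjComp E (scalarTensor k Y) (scalarTensor k Z)).hom ≫
      (conjEquiv E).functor.map b), dhom_ext ?_⟩
  change ((conjEquiv E).functor.map a ≫
      (conjComp E (scalarTensor k X) (scalarTensor k Z)).inv) ≫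
    Functor.whiskerRight ((conjEquiv E).functor.map f)
      ((conjEquiv E).functor.obj (scalarTensor k Z)) ≫
    (conjComp E (scalarTensor k Y) (scalarTensor k Z)).hom ≫ (conjEquiv E).functor.map b =
    (conjEquiv E).functor.map (stact k Z e)
  rw [← Category.assoc (Functor.whiskerRight _ _), conjComp_naturality, Category.assoc,
    Category.assoc, Iso.inv_hom_id_assoc, ← Functor.map_comp, ← Functor.map_comp, hab]

/-- After cutting on both sides, a homomorphism between the values at the top is induced by some `X
⟶ Y`. Tensoring this homomorphism with the identity gives a transformation defined everywhere. -/
lemma IsTopOf.dendo_exists_lift (h : IsTopOf k e L l) (he : IsPrimitiveIdempotent e)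
    (g : (evalAt (E.inverse.obj L)).obj (scalarObj k E X hX) ⟶
      (evalAt (E.inverse.obj L)).obj (scalarObj k E Y hY)) :
    ∃ f : scalarObj k E X hX ⟶ scalarObj k E Y hY,
      (evalAt (E.inverse.obj L)).map (cutMap k E e X hX) ≫ g ≫
        (evalAt (E.inverse.obj L)).map (cutMap k E e Y hY) = (evalAt (E.inverse.obj L)).map f := by
  obtain ⟨χ, -, hχ⟩ := h.exists_coord he
  obtain ⟨g', hg'⟩ := E.inverse.map_surjective
    ((evalScalar X hX L).inv ≫ g ≫ (evalScalar Y hY L).hom)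
  have h1 := cut_eq_stmapLeft hχ g'
  refine ⟨scalarMap k E hX hY (stact k X e ≫ stmapLeft (topIncl k X l ≫ g' ≫ topProj Y χ)), ?_⟩
  rw [evalAt_scalarMap, ← h1, Functor.map_comp, Functor.map_comp, hg']
  rw [cutMap, cutMap, evalAt_scalarMap, evalAt_scalarMap]
  simp only [Category.assoc]

/-- The cut value at the top is `X ⊗_k e L`, and `e L` is the line through `l`. The maps `x ↦ x ⊗ l`
and `x ⊗ m ↦ χ(m) x` identify it with `X`. -/
lemma IsTopOf.dendo_exists_section (h : IsTopOf k e L l) (he : IsPrimitiveIdempotent e)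
    (X : FGModuleCat.{u} A) (hX : projInj _ X) :
    ∃ (a : E.inverse.obj X ⟶ (evalAt (E.inverse.obj L)).obj (scalarObj k E X hX))
      (b : (evalAt (E.inverse.obj L)).obj (scalarObj k E X hX) ⟶ E.inverse.obj X),
      a ≫ b = 𝟙 _ ∧ b ≫ a = (evalAt (E.inverse.obj L)).map (cutMap k E e X hX) := by
  obtain ⟨χ, hl, hχ⟩ := h.exists_coord he
  refine ⟨E.inverse.map (topIncl k X l) ≫ (evalScalar X hX L).inv,
    (evalScalar X hX L).hom ≫ E.inverse.map (topProj X χ), ?_, ?_⟩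
  · rw [Category.assoc, Iso.inv_hom_id_assoc, ← Functor.map_comp, topIncl_topProj X hl,
      CategoryTheory.Functor.map_id]
  · rw [cutMap, evalAt_scalarMap, ← topProj_topIncl X hχ, Functor.map_comp]
    simp only [Category.assoc]

/-- Evaluation at the top is full on cut 1-morphisms. -/
lemma IsTopOf.evalAt_surjective (h : IsTopOf k e L l) (he : IsPrimitiveIdempotent e)
    {F G : DEndo k E} (c : CutRetract k e F) (d : CutRetract k e G)
    (g : (evalAt (E.inverse.obj L)).obj F ⟶ (evalAt (E.inverse.obj L)).obj G) :
    ∃ f : F ⟶ G, (evalAt (E.inverse.obj L)).map f = g := by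
  let V := evalAt (k := k) (E := E) (E.inverse.obj L)
  -- The map `g` is extended to the ambient functors. The two cuts introduced by the lift are
  -- absorbed by `c.r` and `d.i`.
  obtain ⟨f, hf⟩ := h.dendo_exists_lift he (hX := c.projInj_X) (hY := d.projInj_X)
    (V.map c.r ≫ g ≫ V.map d.i)
  refine ⟨c.i ≫ f ≫ d.r, ?_⟩
  rw [Functor.map_comp, Functor.map_comp, ← hf]
  change V.map c.i ≫ (V.map _ ≫ (V.map c.r ≫ g ≫ V.map d.i) ≫ V.map _) ≫ V.map d.r = g
  have h1 : V.map c.i ≫ V.map (cutMap k E e c.X c.projInj_X) ≫ V.map c.r = 𝟙 _ := by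
    rw [← V.map_comp, c.cut_r, ← V.map_comp, c.i_r, V.map_id]
  have h2 : V.map d.i ≫ V.map (cutMap k E e d.X d.projInj_X) ≫ V.map d.r = 𝟙 _ := by
    rw [← V.map_comp, d.cut_r, ← V.map_comp, d.i_r, V.map_id]
  simp only [Category.assoc]
  rw [reassoc_of% h1, h2, Category.comp_id]

/-- A nonzero cut 1-morphism does not vanish at the top. -/
lemma IsTopOf.evalAt_ne_zero (h : IsTopOf k e L l) {F : DEndo k E} (c : CutRetract k e F)
    (hF : ¬ Limits.IsZero F) : ¬ Limits.IsZero ((evalAt (E.inverse.obj L)).obj F) := by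
  intro h0
  -- The projection onto `F` is a cut idempotent factoring through `F`. If `F` vanishes at the top,
  -- so does this idempotent, and it is therefore zero.
  have h1 : c.r ≫ c.i = 0 := h.dendo_idempotent_eq_zero
    (by rw [Category.assoc, ← Category.assoc c.i, c.i_r, Category.id_comp])
    (by rw [← Category.assoc, c.cut_r])
    (by rw [Functor.map_comp, h0.eq_of_tgt ((evalAt _).map c.r) 0, Limits.zero_comp])
  apply hF
  rw [Limits.IsZero.iff_id_eq_zero]
  have h2 : 𝟙 F = c.i ≫ (c.r ≫ c.i) ≫ c.r := by
    rw [Category.assoc, c.i_r, Category.comp_id, c.i_r]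
  rw [h2, h1, Limits.zero_comp, Limits.comp_zero]

/-- The identity of a cut 1-morphism factorizes through every 2-morphism which does not vanish at
the top, up to composing with a further 1-morphism. -/
lemma IsTopOf.exists_id_factorization (h : IsTopOf k e L l) (he : IsPrimitiveIdempotent e)
    {F F' G : DEndo k E} (c : CutRetract k e F) (c' : CutRetract k e F') (d : CutRetract k e G)
    (f : F ⟶ F') (h0 : (evalAt (E.inverse.obj L)).map f ≠ 0) :
    ∃ (H : DEndo k E) (a : G ⟶ F ≫ H) (b : F' ≫ H ⟶ G), a ≫ f ▷ H ≫ b = 𝟙 G := by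
  -- Moved to the ambient functors, `f'` is cut on both sides. It stays nonzero at the top because
  -- `f` is recovered from it.
  let f' := c.r ≫ f ≫ c'.i
  obtain ⟨a, b, hab⟩ := h.dendo_exists_factorization he (f := f')
    (by rw [← Category.assoc, c.cut_r])
    (by rw [Category.assoc, Category.assoc, c'.i_cut])
    (fun h1 => h0 (by
      have h2 : f = c.i ≫ f' ≫ c'.r := by
        rw [Category.assoc, Category.assoc, c'.i_r, Category.comp_id, ← Category.assoc, c.i_r,
          Category.id_comp]
      rw [h2, Functor.map_comp, Functor.map_comp, h1, Limits.zero_comp, Limits.comp_zero]))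
    d.X d.projInj_X
  refine ⟨scalarObj k E d.X d.projInj_X, d.i ≫ a ≫ c.r ▷ _, c'.i ▷ _ ≫ b ≫ d.r, ?_⟩
  have h3 : c.r ▷ scalarObj k E d.X d.projInj_X ≫ f ▷ _ ≫ c'.i ▷ _ = f' ▷ _ := by
    rw [← comp_whiskerRight, ← comp_whiskerRight]
  simp only [Category.assoc]
  rw [reassoc_of% h3, reassoc_of% hab, d.cut_r, d.i_r]

end Top

/-- An indecomposable summand of `X ⊗_k -` is a summand of `X ⊗_k e(-)` for a primitive
idempotent. -/
lemma exists_cutRetract {G : DEndo k E} (hG : IsIndecomposable G)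
    (s : Retract G (scalarObj k E X hX)) :
    ∃ e : A, IsPrimitiveIdempotent e ∧ Nonempty (CutRetract k e G) := by
  have := dendo_isLocalRing hG
  -- `S` consists of the idempotents through whose cut the identity of `G` factors; it contains `1`.
  -- An element of `S` with `e A` of least dimension turns out to be primitive, because `End G` is
  -- local.
  let S : Set A := {e | IsIdempotentElem e ∧ ∃ (i : G ⟶ scalarObj k E X hX)
    (r : scalarObj k E X hX ⟶ G), i ≫ cutMap k E e X hX ≫ r = 𝟙 G}
  let d : A → ℕ := fun e => Module.finrank k (LinearMap.range (LinearMap.mulLeft k e))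
  have hS : S.Nonempty := ⟨1, IsIdempotentElem.one, s.i, s.r, by
    have : cutMap k E 1 X hX = 𝟙 _ :=
      (congrArg bimodMap (stact_one X)).trans bimodMap_id
    rw [this, Category.id_comp, s.retract]⟩
  obtain ⟨e, ⟨he, i, r, hir⟩, hmin⟩ : ∃ e ∈ S, ∀ f ∈ S, d e ≤ d f :=
    ⟨_, Function.argminOn_mem d S hS, fun f hf => Function.argminOn_le d S hf⟩
  -- If the part belonging to `f` is invertible, then `f` lies in `S` and minimality gives `f A = e
  -- A`. So `e` lies in `f A` and `g e = 0`, while `g e = g`.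
  have key : ∀ f g : A, IsIdempotentElem f → f * g = 0 → g * f = 0 → f + g = e →
      IsIdempotentElem g → IsUnit (show End G from i ≫ cutMap k E f X hX ≫ r) → g = 0 := by
    intro f g hf hfg hgf hfge hg hu
    rw [isUnit_iff_isIso] at hu
    have hfS : f ∈ S := ⟨hf, i, r ≫ inv (i ≫ cutMap k E f X hX ≫ r), by
      rw [← Category.assoc (cutMap k E f X hX), ← Category.assoc, IsIso.hom_inv_id]⟩
    have h1 := hmin f hfS
    have h2 : LinearMap.range (LinearMap.mulLeft k f) ≤ LinearMap.range (LinearMap.mulLeft k e) := by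
      rintro _ ⟨a, rfl⟩
      refine ⟨f * a, ?_⟩
      rw [LinearMap.mulLeft_apply, LinearMap.mulLeft_apply, ← mul_assoc, ← hfge, add_mul, hf.eq,
        hgf, add_zero]
    have h3 := Submodule.eq_of_le_of_finrank_le h2 h1
    have h4 : e ∈ LinearMap.range (LinearMap.mulLeft k f) := by
      rw [h3]
      exact ⟨1, mul_one e⟩
    obtain ⟨a, ha⟩ := h4
    rw [LinearMap.mulLeft_apply] at ha
    have h5 : g * e = 0 := by rw [← ha, ← mul_assoc, hgf, zero_mul]
    rwa [← hfge, mul_add, hgf, zero_add, hg.eq] at h5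
  refine ⟨e, ⟨he, ?_, ?_⟩, ⟨CutRetract.mk' he hX i r hir⟩⟩
  · rintro rfl
    apply hG.1
    rw [Limits.IsZero.iff_id_eq_zero, ← hir]
    have h0 : stact k X (0 : A) = 0 := by
      have := stact_add (k := k) X (0 : A) 0
      rw [add_zero] at this
      exact left_eq_add.1 this
    have : cutMap k E 0 X hX = 0 := (congrArg bimodMap h0).trans bimodMap_zero
    rw [this, Limits.zero_comp, Limits.comp_zero]
  · intro f g hf hg hfg hgf hfge
    have h1 : cutMap k E e X hX = cutMap k E f X hX + cutMap k E g X hX := by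
      rw [← hfge]
      exact (congrArg bimodMap (stact_add X f g)).trans (bimodMap_add _ _)
    -- The parts of `f` and `g` add up to the identity of `G`, so one of them is invertible and the
    -- other idempotent vanishes.
    have h2 : IsUnit ((show End G from i ≫ cutMap k E f X hX ≫ r) +
        (show End G from i ≫ cutMap k E g X hX ≫ r)) := by
      have : (i ≫ cutMap k E f X hX ≫ r) + (i ≫ cutMap k E g X hX ≫ r) = 𝟙 G := by
        rw [← Preadditive.comp_add, ← Preadditive.add_comp, ← h1, hir]
      rw [show (show End G from i ≫ cutMap k E f X hX ≫ r) +
        (show End G from i ≫ cutMap k E g X hX ≫ r) = 1 from this]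
      exact isUnit_one
    rcases IsLocalRing.isUnit_or_isUnit_of_isUnit_add h2 with h | h
    · exact Or.inr (key f g hf hfg hgf hfge hg h)
    · exact Or.inl (key g f hg hgf hfg ((add_comm g f).trans hfge) hf h)

end Cut

/-! ## Cells -/

section Cells

variable {𝒞 : Type v} [Bicategory.{w, w} 𝒞]

lemma LeftGE.refl {i j : 𝒞} (F : i ⟶ j) : LeftGE F F :=
  ⟨𝟙 j, ⟨⟨(ρ_ F).inv, (ρ_ F).hom, (ρ_ F).inv_hom_id⟩⟩⟩

/-- The two-sided preorder is invariant under isomorphisms. -/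
lemma TwoSidedGE.of_iso {i j i' j' : 𝒞} {F F' : i ⟶ j} {G G' : i' ⟶ j'} (h : TwoSidedGE F G)
    (φ : F' ≅ F) (ψ : G ≅ G') : TwoSidedGE F' G' := by
  obtain ⟨H', H, ⟨r⟩⟩ := h
  exact ⟨H', H, ⟨(Retract.ofIso φ).trans (r.trans
    (Retract.ofIso (whiskerLeftIso H' (whiskerRightIso ψ H))))⟩⟩

variable [∀ i j : 𝒞, Preadditive (i ⟶ j)]

/-- A two-sided cell is closed under isomorphisms. -/
lemma IsTwoSidedCell.of_iso {J : ∀ i j : 𝒞, (i ⟶ j) → Prop} (hJ : IsTwoSidedCell J) {i j : 𝒞}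
    {F F' : i ⟶ j} (hF : J i j F) (φ : F ≅ F') : J i j F' := by
  obtain ⟨i', j', G, -, h⟩ := hJ
  rw [h] at hF ⊢
  obtain ⟨⟨h0, h1⟩, h2, h3⟩ := hF
  exact ⟨⟨fun h => h0 (h.of_iso φ), fun Y Z b hb ⟨ψ⟩ => h1 Y Z b hb ⟨φ ≪≫ ψ⟩⟩,
    h2.of_iso φ.symm (Iso.refl G), h3.of_iso (Iso.refl G) φ⟩

end Cells

/-! ### Cut 1-morphisms and left cells -/

section CutCell

variable {k : Type u} [Field k] {A : Type u} [Ring A] [Algebra k A] [FiniteDimensional k A]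
  {C : Type w} [SmallCategory C] [Preadditive C] [Linear k C] {E : C ≌ FGModuleCat.{u} A}
  [E.functor.Additive]

/-- The indecomposable 1-morphisms which are not isomorphic to the identity are cut. -/
lemma exists_cutRetract_of_not_iso_id (hA : IsConnectedRing A) {G : DEndo k E}
    (hG : IsIndecomposable G) (h1 : ¬ Nonempty (G ≅ 𝟙 (DTwoCat.star : DTwoCat k E))) :
    ∃ e : A, IsPrimitiveIdempotent e ∧ Nonempty (CutRetract k e G) := by
  -- An indecomposable 1-morphism is a summand of the identity or of a single `X ⊗_k -`. The first
  -- case would make it isomorphic to the identity.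
  obtain ⟨_, rfl | ⟨X, hX, rfl⟩, ⟨r⟩⟩ := exists_retract_of_addClosure hG (dendo_addClosure G)
  · exact absurd (iso_id_of_retract hA hG.1 r) h1
  · exact exists_cutRetract hG r

/-- Composites `G ≫ H` and their summands stay cut by the same idempotent, so `e` is constant along
the left preorder. -/
lemma CutRetract.of_leftGE {e : A} (he : IsIdempotentElem e) {F G : DEndo k E}
    (c : CutRetract k e G) (h : LeftGE F G) : Nonempty (CutRetract k e F) := by
  obtain ⟨H, ⟨r⟩⟩ := h
  obtain ⟨c'⟩ := c.comp he H
  exact ⟨c'.ofRetract he r⟩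

section Top

variable [E.functor.Linear k] {e : A} {T : FGModuleCat.{u} A} {l : T}

/-- The value of a cut 1-morphism at the top is a summand of a module which is projective or
injective. -/
lemma IsTopOf.projInj_evalAt (h : IsTopOf k e T l) (he : IsPrimitiveIdempotent e)
    {F : DEndo k E} (c : CutRetract k e F) : projInj C ((evalAt (E.inverse.obj T)).obj F) := by
  obtain ⟨a, b, -, hba⟩ := h.dendo_exists_section (E := E) he c.X c.projInj_X
  have : E.symm.functor.Additive := inferInstanceAs E.inverse.Additive
  let V := evalAt (k := k) (E := E) (E.inverse.obj T)
  refine addClosure_retract (projInj_equivalence E.symm c.projInj_X)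
    (V.map c.i ≫ b) (a ≫ V.map c.r) ?_
  rw [Category.assoc, reassoc_of% hba, ← V.map_comp, ← V.map_comp, c.cut_r, c.i_r, V.map_id]

/-- Every object in the additive closure of projective and injective objects is the value of a cut
1-morphism at the top. -/
lemma IsTopOf.exists_evalAt_iso (h : IsTopOf k e T l) (he : IsPrimitiveIdempotent e)
    {M : C} (hM : projInj C M) : ∃ F : DEndo k E, Nonempty (CutRetract k e F) ∧
      Nonempty ((evalAt (k := k) (E.inverse.obj T)).obj F ≅ M) := by
  have hX := projInj_equivalence E hM
  obtain ⟨a, b, hab, hba⟩ := h.dendo_exists_section (E := E) he _ hX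
  -- `F` is the image of the cut on `E.functor.obj M ⊗_k -`. At the top this image is a copy of
  -- `E.functor.obj M` carried back by `E.inverse`, hence `M` up to the unit.
  obtain ⟨F, i, r, hir, hri⟩ := dendo_exists_split _ _ (cutMap_idem (k := k) (E := E) he.1 _ hX)
  let V := evalAt (k := k) (E := E) (E.inverse.obj T)
  have h1 : V.map i ≫ V.map r = 𝟙 _ := by rw [← V.map_comp, hir, V.map_id]
  have h2 : V.map r ≫ V.map i = b ≫ a := by rw [← V.map_comp, hri, hba]
  refine ⟨F, ⟨⟨_, hX, i, r, ?_, ?_, hir⟩⟩, ⟨Iso.trans ⟨V.map i ≫ b, a ≫ V.map r, ?_, ?_⟩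
    (E.unitIso.app M).symm⟩⟩
  · rw [← hri, reassoc_of% hir]
  · rw [← hri, Category.assoc, hir, Category.comp_id]
  · rw [Category.assoc, ← reassoc_of% h2, h1, Category.comp_id, h1]
  · rw [Category.assoc, reassoc_of% h2, reassoc_of% hab, hab]

variable {L : ∀ j : DTwoCat k E, (DTwoCat.star ⟶ j) → Prop} {G : DEndo k E}

/-- The members of `L` are above `G` and hence cut by the idempotent of `G`; everything above them
is then cut as well. -/
lemma cellObj_le_cut (hL : ∀ j F, L j F → LeftGE F G) (he : IsIdempotentElem e)
    (d : CutRetract k e G) {F : DEndo k E} (hF : cellObj L DTwoCat.star F) :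
    addClosure (fun F => Nonempty (CutRetract k e F)) F := by
  refine addClosure_mono ?_ hF
  rintro F ⟨⟨⟩, G', hG', hF⟩
  obtain ⟨d'⟩ := d.of_leftGE he (hL _ _ hG')
  exact d'.of_leftGE he hF

/-- The identity of `G` is nonzero at the top, so the identity of any cut `F` factors through `G ≫
H` for a suitable `H`. Thus `F` is above `G` in the left preorder. -/
lemma IsTopOf.cellObj_of_cut (h : IsTopOf k e T l) (he : IsPrimitiveIdempotent e)
    (hG : ¬ Limits.IsZero G) (hLG : L DTwoCat.star G) (d : CutRetract k e G) {F : DEndo k E}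
    (c : CutRetract k e F) : cellObj L DTwoCat.star F := by
  obtain ⟨H, a, b, hab⟩ := h.exists_id_factorization he d d c (𝟙 G) (fun h0 =>
    h.evalAt_ne_zero d hG ((Limits.IsZero.iff_id_eq_zero _).2
      (((evalAt _).map_id G).symm.trans h0)))
  rw [id_whiskerRight, Category.id_comp] at hab
  exact addClosure_of ⟨_, G, hLG, H, ⟨⟨a, b, hab⟩⟩⟩

/-- Fullness passes to additive closures: the matrix components of `g` between cut 1-morphisms are
lifted one by one and reassembled. -/
lemma IsTopOf.evalAt_surjective_of_addClosure (h : IsTopOf k e T l)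
    (he : IsPrimitiveIdempotent e) {F F' : DEndo k E}
    (hF : addClosure (fun F => Nonempty (CutRetract k e F)) F)
    (hF' : addClosure (fun F => Nonempty (CutRetract k e F)) F')
    (g : (evalAt (E.inverse.obj T)).obj F ⟶ (evalAt (E.inverse.obj T)).obj F') :
    ∃ f : F ⟶ F', (evalAt (E.inverse.obj T)).map f = g := by
  obtain ⟨m, Y, hY, a, b, hab⟩ := hF
  obtain ⟨n, Y', hY', a', b', hab'⟩ := hF'
  let V := evalAt (k := k) (E := E) (E.inverse.obj T)
  choose f hf using fun s t => h.evalAt_surjective he (hY s).some (hY' t).some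
    (V.map (b s) ≫ g ≫ V.map (a' t))
  refine ⟨∑ s, ∑ t, a s ≫ f s t ≫ b' t, ?_⟩
  change V.map _ = g
  have h1 : ∑ s, V.map (a s) ≫ V.map (b s) = 𝟙 _ := by
    simp only [← V.map_comp]
    rw [← V.map_sum, hab, V.map_id]
  have h2 : ∑ t, V.map (a' t) ≫ V.map (b' t) = 𝟙 _ := by
    simp only [← V.map_comp]
    rw [← V.map_sum, hab', V.map_id]
  rw [V.map_sum]
  calc ∑ s, V.map (∑ t, a s ≫ f s t ≫ b' t)
      = ∑ s, ∑ t, (V.map (a s) ≫ V.map (b s)) ≫ g ≫ V.map (a' t) ≫ V.map (b' t) := by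
        refine Finset.sum_congr rfl fun s _ => ?_
        rw [V.map_sum]
        refine Finset.sum_congr rfl fun t _ => ?_
        rw [V.map_comp, V.map_comp, hf]
        simp only [Category.assoc]
    _ = (∑ s, V.map (a s) ≫ V.map (b s)) ≫ g ≫ ∑ t, V.map (a' t) ≫ V.map (b' t) := by
        simp only [Preadditive.comp_sum, Preadditive.sum_comp]
        exact Finset.sum_comm
    _ = g := by rw [h1, h2, Category.comp_id, Category.id_comp]

/-- A 2-morphism between sums of cut 1-morphisms is detected at the top by its components. -/
lemma exists_component_ne_zero {F F' : DEndo k E}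
    (hF : addClosure (fun F => Nonempty (CutRetract k e F)) F)
    (hF' : addClosure (fun F => Nonempty (CutRetract k e F)) F') (f : F ⟶ F') {M : C}
    (h0 : (evalAt M).map f ≠ 0) : ∃ (Y Y' : DEndo k E) (_ : CutRetract k e Y)
      (_ : CutRetract k e Y') (b : Y ⟶ F) (a : F' ⟶ Y'), (evalAt M).map (b ≫ f ≫ a) ≠ 0 := by
  obtain ⟨m, Y, hY, a, b, hab⟩ := hF
  obtain ⟨n, Y', hY', a', b', hab'⟩ := hF'
  by_contra! hc
  apply h0
  have h1 : f = ∑ s, ∑ t, a s ≫ (b s ≫ f ≫ a' t) ≫ b' t := by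
    calc f = (∑ s, a s ≫ b s) ≫ f ≫ ∑ t, a' t ≫ b' t := by
          rw [hab, hab', Category.comp_id, Category.id_comp]
      _ = _ := by
          simp only [Preadditive.comp_sum, Preadditive.sum_comp, Category.assoc]
          exact Finset.sum_comm
  rw [h1, Functor.map_sum]
  refine Finset.sum_eq_zero fun s _ => ?_
  rw [Functor.map_sum]
  refine Finset.sum_eq_zero fun t _ => ?_
  rw [Functor.map_comp, Functor.map_comp, hc _ _ (hY s).some (hY' t).some, Limits.zero_comp,
    Limits.comp_zero]

/-! ## The maximal ideal -/

variable (k L) in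
/-- Evaluation of the 1-morphisms in the additive closure of a left cell. -/
def cellEval (M : C) (j : DTwoCat k E) : ((cellSub k L).obj j).carrier ⥤ C where
  obj F := (DTwoCat.Hom.functor F.obj).obj M
  map f := (DTwoCat.Hom₂.nat f.hom).app M
  map_id _ := rfl
  map_comp _ _ := rfl

instance (M : C) (j : DTwoCat k E) : (cellEval k L M j).Additive where
  map_add := rfl

instance (M : C) (j : DTwoCat k E) : (cellEval k L M j).Linear k where
  map_smul _ _ := rfl

variable (k L) in
/-- The ideal of all 2-morphisms which vanish at an object. -/
def cellEvalIdeal (M : C) : (cellSub k L).Ideal where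
  hom j X Y := LinearMap.ker ((cellEval k L M j).mapLinearMap k (X := X) (Y := Y))
  comp_mem j X Y Z a b hb := by
    change (cellEval k L M j).map (a ≫ b) = 0
    have : (cellEval k L M j).map b = 0 := hb
    rw [Functor.map_comp, this, Limits.comp_zero]
  mem_comp j X Y Z a b ha := by
    change (cellEval k L M j).map (a ≫ b) = 0
    have : (cellEval k L M j).map a = 0 := ha
    rw [Functor.map_comp, this, Limits.zero_comp]
  map_mem {i j} f X Y a ha := by
    have := (DTwoCat.Hom.property f).additive
    have ha : (cellEval k L M i).map a = 0 := ha
    exact (congrArg (DTwoCat.Hom.functor f).map ha).trans ((DTwoCat.Hom.functor f).map_zero _ _)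

lemma mem_cellEvalIdeal {M : C} {j : DTwoCat k E} {X Y : ((cellSub k L).obj j).carrier}
    {f : X ⟶ Y} : f ∈ (cellEvalIdeal k L M).hom j X Y ↔ (cellEval k L M j).map f = 0 :=
  Iff.rfl

/-- The evaluation ideal at the top is the maximal ideal of the left cell. -/
lemma IsTopOf.mem_maxIdeal_iff (h : IsTopOf k e T l) (he : IsPrimitiveIdempotent e)
    (hG : ¬ Limits.IsZero G) (hLG : L DTwoCat.star G)
    (hL : ∀ j F, L j F → LeftGE F G ∧ LeftGE G F) (d : CutRetract k e G)
    {j : DTwoCat k E} {X Y : ((cellSub k L).obj j).carrier} (f : X ⟶ Y) :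
    f ∈ (maxIdeal k L).hom j X Y ↔ (cellEval k L (E.inverse.obj T) j).map f = 0 := by
  have hle : ∀ {F : DEndo k E}, cellObj L DTwoCat.star F →
      addClosure (fun F => Nonempty (CutRetract k e F)) F :=
    cellObj_le_cut (fun j F hF => (hL j F hF).1) he.1 d
  constructor
  · intro hf
    rw [← mem_cellEvalIdeal]
    have : (maxIdeal k L).hom j X Y ≤ (cellEvalIdeal k L (E.inverse.obj T)).hom j X Y := by
      refine iSup_le ?_
      rintro ⟨I, hI⟩ f hf
      by_contra h0
      cases j
      -- If an element of a proper ideal were nonzero at the top, a component of it between cut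
      -- 1-morphisms would be nonzero there, and the identity of `G` would factor through that
      -- component after applying some `H`.
      obtain ⟨Z, Z', c, c', b, a, hab⟩ :=
        exists_component_ne_zero (hle X.property) (hle Y.property) f.hom h0
      obtain ⟨H, u, v, huv⟩ := h.exists_id_factorization he c c' d _ hab
      let Z₁ : (cellObj L DTwoCat.star).FullSubcategory := ⟨Z, h.cellObj_of_cut he hG hLG d c⟩
      let Z₂ : (cellObj L DTwoCat.star).FullSubcategory := ⟨Z', h.cellObj_of_cut he hG hLG d c'⟩
      let G' : (cellObj L DTwoCat.star).FullSubcategory := ⟨G, h.cellObj_of_cut he hG hLG d d⟩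
      let b' : Z₁ ⟶ X := ObjectProperty.homMk b
      let a' : Y ⟶ Z₂ := ObjectProperty.homMk a
      -- The ideal is stable under composition and under the action of `H`, so it follows the
      -- factorization up to the identity of `G`, contradicting properness.
      have h1 := I.map_mem H (I.comp_mem _ b' (I.mem_comp _ a' hf))
      let u' : G' ⟶ ((cellSub k L).map H).functor.obj Z₁ := ObjectProperty.homMk u
      let v' : ((cellSub k L).map H).functor.obj Z₂ ⟶ G' := ObjectProperty.homMk v
      have h2 := I.comp_mem _ u' (I.mem_comp _ v' h1)
      have h3 : u' ≫ ((cellSub k L).map H).functor.map (b' ≫ f ≫ a') ≫ v' = 𝟙 G' :=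
        ObjectProperty.hom_ext _ huv
      exact hI _ G' hLG (Eq.mp (congrArg (· ∈ I.hom _ G' G') h3) h2)
    exact this hf
  · intro hf
    -- Conversely, the evaluation ideal is one of the ideals in the sum as soon as it is proper.
    refine Submodule.mem_iSup_of_mem
      (⟨cellEvalIdeal k L (E.inverse.obj T), ?_⟩ :
        {I : (cellSub k L).Ideal // IsProperIdeal k L I}) hf
    rintro ⟨⟩ X hX h0
    have h1 : (evalAt (E.inverse.obj T)).map (𝟙 X.obj : X.obj ⟶ X.obj) = 0 := h0
    -- `G` is a summand of `X.obj ≫ H`. If `X.obj` vanished at the top, so would `G`.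
    obtain ⟨H, ⟨r⟩⟩ := (hL _ _ hX).2
    have := (DTwoCat.Hom.property H).additive
    apply h.evalAt_ne_zero d hG
    have h2 : Limits.IsZero ((evalAt (E.inverse.obj T)).obj (X.obj ≫ H)) :=
      (DTwoCat.Hom.functor H).map_isZero ((Limits.IsZero.iff_id_eq_zero
        ((evalAt (E.inverse.obj T)).obj X.obj)).2 h1)
    rw [Limits.IsZero.iff_id_eq_zero, ← (r.map (evalAt (E.inverse.obj T))).retract,
      h2.eq_of_tgt (r.map (evalAt (E.inverse.obj T))).i 0, Limits.zero_comp]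

end Top

end CutCell

/-! ### Evaluation as a morphism from the cell 2-representation to the natural one -/

section Transformation

variable {k : Type u} [Field k] {A : Type u} [Ring A] [Algebra k A] [FiniteDimensional k A]
  {C : Type w} [SmallCategory C] [Preadditive C] [Linear k C] {E : C ≌ FGModuleCat.{u} A}
  [E.functor.Additive] [E.functor.Linear k] {L : ∀ j : DTwoCat k E, (DTwoCat.star ⟶ j) → Prop}
  {M : C} (hM : ∀ (j : DTwoCat k E) (F : ((cellSub k L).obj j).carrier),
    projInj C ((cellEval k L M j).obj F))
  (h0 : ∀ (j : DTwoCat k E) (X Y : ((cellSub k L).obj j).carrier) (f : X ⟶ Y),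
    f ∈ (maxIdeal k L).hom j X Y → (cellEval k L M j).map f = 0)

/-- Evaluation on the quotient by the maximal ideal. -/
def cellQuotEval (j : DTwoCat k E) :
    ((cellTwoRep k L).obj j).carrier ⥤ ((natural k E).obj j).carrier :=
  CategoryTheory.Quotient.lift ((maxIdeal k L).rel j) ((projInj C).lift (cellEval k L M j) (hM j))
    (fun X Y f g hfg => ObjectProperty.hom_ext _ (by
      have h1 := h0 j X Y _ hfg
      rw [Functor.map_sub] at h1
      exact sub_eq_zero.1 h1))

instance (j : DTwoCat k E) : (cellQuotEval hM h0 j).Additive where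
  map_add {X Y f g} := by
    obtain ⟨f, rfl⟩ := (maxIdeal k L).proj_surj f
    obtain ⟨g, rfl⟩ := (maxIdeal k L).proj_surj g
    rfl

instance (j : DTwoCat k E) : (cellQuotEval hM h0 j).Linear k where
  map_smul {X Y} f c := by
    obtain ⟨f, rfl⟩ := (maxIdeal k L).proj_surj f
    rfl

/-- Evaluation as a morphism of 2-representations. -/
def cellTransformation : Pseudofunctor.StrongTrans (cellTwoRep k L) (natural k E) where
  app j := LinCat.Hom.mk (cellQuotEval hM h0 j)
  -- Evaluating the composite with `f` at `M` is the same as applying `f` to the value at `M`, so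
  -- the structure isomorphisms are identities.
  naturality {i j} f := LinCat.isoMk (NatIso.ofComponents (fun X => Iso.refl _) (fun {X Y} u => by
    obtain ⟨u, rfl⟩ := (maxIdeal k L).proj_surj u
    exact (Category.comp_id _).trans (Category.id_comp _).symm))
  naturality_naturality {i j f g} η := LinCat.hom₂_ext fun X =>
    (Category.comp_id _).trans (Category.id_comp _).symm
  naturality_id j := LinCat.hom₂_ext fun X => by
    refine ObjectProperty.hom_ext _ ?_
    change 𝟙 _ ≫ 𝟙 _ = 𝟙 _ ≫ 𝟙 _ ≫ 𝟙 _
    simp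
  naturality_comp {i j l} f g := LinCat.hom₂_ext fun X => by
    have := (DTwoCat.Hom.property g).additive
    refine ObjectProperty.hom_ext _ ?_
    change 𝟙 _ ≫ 𝟙 _ = 𝟙 _ ≫ 𝟙 _ ≫ 𝟙 _ ≫ 𝟙 _ ≫ (DTwoCat.Hom.functor g).map (𝟙 _) ≫ 𝟙 _
    simp

end Transformation

end

theorem proposition7p3 {k : Type u} [Field k] [IsAlgClosed k]
    {A : Type u} [Ring A] [Algebra k A] [FiniteDimensional k A]
    (hconn : IsConnectedRing A) (hbasic : IsBasicRing A)
    {C : Type w} [SmallCategory C] [Preadditive C] [Linear k C]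
    (E : C ≌ FGModuleCat.{u} A) [E.functor.Additive] [E.functor.Linear k]
    (J : ∀ i j : DTwoCat k E, (i ⟶ j) → Prop) (hJ : IsTwoSidedCell J)
    (hJ1 : ¬ J DTwoCat.star DTwoCat.star (𝟙 DTwoCat.star))
    (L : ∀ j : DTwoCat k E, (DTwoCat.star ⟶ j) → Prop) (hL : IsLeftCell L)
    (hLJ : ∀ (j : DTwoCat k E) (F : DTwoCat.star ⟶ j), L j F → J DTwoCat.star j F) :
    TwoRep.Equivalent (cellTwoRep k L) (natural k E) := by
  obtain ⟨⟨⟩, G, hG, hLG⟩ := hL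
  have hG' : L DTwoCat.star G := (hLG _ G).2 ⟨hG, LeftGE.refl G, LeftGE.refl G⟩
  -- `G` is not isomorphic to the identity, because two-sided cells are closed under isomorphism and
  -- `J` does not contain the identity.
  obtain ⟨e, he, ⟨d⟩⟩ := exists_cutRetract_of_not_iso_id hconn hG
    (fun ⟨φ⟩ => hJ1 (hJ.of_iso (hLJ _ G hG') φ))
  obtain ⟨T, l, h⟩ := exists_isTopOf (k := k) he
  have hL : ∀ j F, L j F → LeftGE F G ∧ LeftGE G F := fun j F hF => ((hLG j F).1 hF).2
  have hcut : ∀ {F : DEndo k E}, cellObj L DTwoCat.star F →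
      addClosure (fun F => Nonempty (CutRetract k e F)) F :=
    cellObj_le_cut (fun j F hF => (hL j F hF).1) he.1 d
  have hM : ∀ (j : DTwoCat k E) (F : ((cellSub k L).obj j).carrier),
      projInj C ((cellEval k L (E.inverse.obj T) j).obj F) := by
    rintro ⟨⟩ F
    exact addClosure_map (evalAt (E.inverse.obj T)) (fun F ⟨c⟩ => h.projInj_evalAt he c)
      (hcut F.property)
  have h0 : ∀ (j : DTwoCat k E) (X Y : ((cellSub k L).obj j).carrier) (f : X ⟶ Y),
      f ∈ (maxIdeal k L).hom j X Y ↔ (cellEval k L (E.inverse.obj T) j).map f = 0 :=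
    fun j X Y f => h.mem_maxIdeal_iff he hG.1 hG' hL d f
  refine ⟨cellTransformation hM (fun j X Y f => (h0 j X Y f).1), ?_⟩
  rintro ⟨⟩
  have h1 : (cellQuotEval hM (fun j X Y f => (h0 j X Y f).1) DTwoCat.star).Full := by
    constructor
    rintro ⟨X⟩ ⟨Y⟩ g
    obtain ⟨f, hf⟩ := h.evalAt_surjective_of_addClosure he (hcut X.property) (hcut Y.property) g.hom
    exact ⟨((maxIdeal k L).proj _).map (ObjectProperty.homMk f), ObjectProperty.hom_ext _ hf⟩
  have h2 : (cellQuotEval hM (fun j X Y f => (h0 j X Y f).1) DTwoCat.star).Faithful := by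
    constructor
    rintro ⟨X⟩ ⟨Y⟩ f g hfg
    obtain ⟨f, rfl⟩ := (maxIdeal k L).proj_surj f
    obtain ⟨g, rfl⟩ := (maxIdeal k L).proj_surj g
    -- Faithfulness on the quotient is the statement that the maximal ideal contains everything
    -- vanishing at the top.
    refine ((maxIdeal k L).proj_eq_iff f g).2 ((h0 _ _ _ _).2 ?_)
    rw [Functor.map_sub, sub_eq_zero]
    exact congrArg (·.hom) hfg
  have h3 : (cellQuotEval hM (fun j X Y f => (h0 j X Y f).1) DTwoCat.star).EssSurj := by
    constructor
    rintro ⟨M, hM'⟩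
    -- The preimage found is a cut 1-morphism, and every cut 1-morphism belongs to the additive
    -- closure attached to the cell.
    obtain ⟨F, ⟨c⟩, ⟨φ⟩⟩ := h.exists_evalAt_iso (E := E) he hM'
    exact ⟨((maxIdeal k L).proj _).obj ⟨F, h.cellObj_of_cut he hG.1 hG' d c⟩,
      ⟨(projInj C).isoMk φ⟩⟩
  exact { full := h1, faithful := h2, essSurj := h3 }
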